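/- Let $e(z)=\exp(2\pi i z)$, and let $\mathbb{H}_g^{(1)}$ be the set of symmetric $\Omega\in M_g(\mathbb{C})$ whose imaginary part has signature $(g-1,1)$. For a real symmetric matrix $M$ of signature $(g-1,1)$ put $R_M=\{c\in\mathbb{C}^g : \bar c^\top M c<0\}$. For $v\in\mathbb{R}^g$ with $v^\top M v<0$ let $c\mapsto\sqrt{-c^\top M c}$ denote the holomorphic square root of $-c^\top Mc$ on $R_M$ that is positive at $c=v$ ($v$ and $-v$ give the two opposite branches), and put $\sqrt{-\tfrac12 c^\top Mc}=\tfrac1{\sqrt2}\sqrt{-c^\top Mc}$. For $\Omega\in\mathbb{H}_g^{(1)}$, $v\in\mathbb{R}^g$ with $v^\top \mathrm{Im}(\Omega)v<0$, $c_1,c_2\in R_{\mathrm{Im}\,\Omega}$ and $z\in\mathbb{C}^g$, let $$\Theta_v^{c_1,c_2}[f](z;\Omega)=\sum_{n\in\mathbb{Z}^g}\left(\mathcal{E}_f(\alpha_n(c_2))-\mathcal{E}_f(\alpha_n(c_1))\right)e\left(\tfrac12 n^\top\Omega n+n^\top z\right),\qquad \alpha_n(c)=\frac{c^\top\mathrm{Im}(\Omega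 n+z)}{\sqrt{-\tfrac12c^\top \mathrm{Im}(\Omega)c}},$$ with the branch positive at $v$, where $\mathcal{E}_f(\alpha)=\int_0^\alpha f(u)e^{-\pi u^2}\,du$. Here $f$ is an entire function with $|f(\xi)|\le e^{\varepsilon|\xi|^2}$ for every $\varepsilon>0$ and all sufficiently large $|\xi|$; if $c_1,c_2$ are real it is enough that $f$ is continuous on $\mathbb{R}$ with this growth on $\mathbb{R}$. Write $\Theta_v^{c_1,c_2}$ for $\Theta_v^{c_1,c_2}[1]$. For a symmetric matrix $\Omega$ with positive definite imaginary part let $\sqrt{\det(-i\Omega)}=\left(\int_{\mathbb{R}^g}e(\tfrac12x^\top\Omega x)\,dx\right)^{-1}$. For an invertible $\Omega\in\mathbb{H}_g^{(1)}$, with $M=\mathrm{Im}\,\Omega$, let $$\sqrt{\det(-i\Omega)}=\frac{\sqrt{-c^\top Mc}\,\sqrt{\det\left(-i\left(\Omega-\frac{2i}{c^\top Mc}Mcc^\top M\right)\right)}}{\sqrt{-(\bar\Omega c)^\top\mathrm{Im}(-\Omega^{-1})(\bar\Omega c)}}$$ for any $c\in R_M$ (the value does not depend on $c$), formed with chosen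 branches for $\mathrm{Im}(\Omega)$ and $\mathrm{Im}(-\Omega^{-1})$. Theorem. Let $\Omega\in\mathbb{H}_g^{(1)}$ and $z\in\mathbb{C}^g$. All the series below converge absolutely, and the following hold. (1) For $A\in \mathrm{GL}_g(\mathbb{Z})$, real $v$ with $v^\top\mathrm{Im}(A^\top\Omega A)v<0$, $c_1,c_2\in R_{\mathrm{Im}(A^\top\Omega A)}$ and every $f$ as above, $\Theta_v^{c_1,c_2}[f](z;A^\top\Omega A)=\Theta_{Av}^{Ac_1,Ac_2}[f](A^{-\top}z;\Omega)$. (2) For symmetric $B\in M_g(\mathbb{Z})$, real $v$ with $v^\top\mathrm{Im}(\Omega)v<0$, $c_1,c_2\in R_{\mathrm{Im}\,\Omega}$ and every $f$ as above, $\Theta_v^{c_1,c_2}[f](z;\Omega+2B)=\Theta_v^{c_1,c_2}[f](z;\Omega)$. (3) If $\Omega$ is invertible, then for all real $v,w$ with $v^\top\mathrm{Im}(\Omega)v<0$ and $w^\top\mathrm{Im}(-\Omega^{-1})w<0$ and all $c_1,c_2\in R_{\mathrm{Im}(-\Omega^{-1})}$, $$\Theta_w^{c_1,c_2}(z;-\Omega^{-1})=-\frac{e^{\pi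 i z^\top\Omega z}}{\sqrt{\det(i\Omega^{-1})}}\,\Theta_v^{-\bar\Omega^{-1}c_1,-\bar\Omega^{-1}c_2}(\Omega z;\Omega),$$ where $\sqrt{\det(i\Omega^{-1})}$ is the square root just defined for $-\Omega^{-1}$, formed with the same two branches (positive at $w$ for $\mathrm{Im}(-\Omega^{-1})$ and at $v$ for $\mathrm{Im}\,\Omega$). -/

import Mathlib

noncomputable section

namespace IndefTheta

open Matrix

variable {g : ℕ}

/-- `e(z) = exp(2πi z)`. -/
def e (z : ℂ) : ℂ := Complex.exp (2 * Real.pi * Complex.I * z)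

/-- The entrywise imaginary part of a complex matrix. -/
def imPart (Ω : Matrix (Fin g) (Fin g) ℂ) : Matrix (Fin g) (Fin g) ℝ := Ω.map Complex.im

/-- The entrywise complex conjugate (not transposed). -/
def conjMat (Ω : Matrix (Fin g) (Fin g) ℂ) : Matrix (Fin g) (Fin g) ℂ :=
  Ω.map (starRingEnd ℂ)

/-- A real matrix regarded as a complex matrix. -/
def realMat (M : Matrix (Fin g) (Fin g) ℝ) : Matrix (Fin g) (Fin g) ℂ := M.map Complex.ofReal

/-- An integer matrix regarded as a complex matrix. -/
def intMat (A : Matrix (Fin g) (Fin g) ℤ) : Matrix (Fin g) (Fin g) ℂ :=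
  A.map (fun a : ℤ => (a : ℂ))

/-- A real vector regarded as a complex vector. -/
def realVec (x : Fin g → ℝ) : Fin g → ℂ := fun i => (x i : ℂ)

/-- An integer vector regarded as a complex vector. -/
def intVec (n : Fin g → ℤ) : Fin g → ℂ := fun i => (n i : ℂ)

/-- The Siegel intermediate half-space of genus `g` and index `k`: symmetric complex matrices
whose imaginary part has signature `(g - k, k)`. -/
def siegelIntermediate (g k : ℕ) : Set (Matrix (Fin g) (Fin g) ℂ) :=
  {Ω | Ω.IsSymm ∧ sigPos (imPart Ω).toQuadraticForm' = g - k ∧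
    sigNeg (imPart Ω).toQuadraticForm' = k}

/-- The bilinear form `xᵀ M y` of a real matrix `M` on complex vectors. -/
def bil (M : Matrix (Fin g) (Fin g) ℝ) (x y : Fin g → ℂ) : ℂ := x ⬝ᵥ (realMat M *ᵥ y)

/-- The region `R_M` of the complex vectors `c` with `c̄ᵀ M c < 0` (for symmetric `M` the number
`c̄ᵀ M c` is real). -/
def negRegion (M : Matrix (Fin g) (Fin g) ℝ) : Set (Fin g → ℂ) :=
  {c | (bil M (star c) c).re < 0}

/-- The real vectors `v` with `vᵀ M v < 0`; each of the two opposite vectors `v` and `-v`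
singles out one of the two holomorphic square roots of `-cᵀ M c` on `R_M`. -/
def negReal (M : Matrix (Fin g) (Fin g) ℝ) : Set (Fin g → ℝ) :=
  {v | v ⬝ᵥ (M *ᵥ v) < 0}

/-- `√(-cᵀ M c)` for `c ∈ R_M`: the holomorphic square root of `-cᵀ M c` on `R_M` that is
positive at the real vector `v` with `vᵀ M v < 0`.

If `P` is a real invertible matrix with `M = Pᵀ J P`, `J = diag(-1, 1, …, 1)`, and
`v = P⁻¹ e₁`, `w = P c`, this is `w₁ √(1 - (w₂/w₁)² - ⋯ - (w_g/w₁)²)`: there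
`vᵀ M v = -1`, `vᵀ M c = -w₁` and `-cᵀ M c = w₁² - w₂² - ⋯ - w_g²`, and on `R_M` the
argument of the principal square root has positive real part. -/
def sqrtNeg (M : Matrix (Fin g) (Fin g) ℝ) (v : Fin g → ℝ) (c : Fin g → ℂ) : ℂ :=
  (-bil M (realVec v) c) / (Real.sqrt (-(v ⬝ᵥ (M *ᵥ v))) : ℂ) *
    Complex.sqrt (bil M c c * bil M (realVec v) (realVec v) / bil M (realVec v) c ^ 2)

/-- `√(-½ cᵀ M c) = (1/√2) √(-cᵀ M c)`. -/
def sqrtHalfNeg (M : Matrix (Fin g) (Fin g) ℝ) (v : Fin g → ℝ) (c : Fin g → ℂ) : ℂ :=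
  (1 / (Real.sqrt 2 : ℂ)) * sqrtNeg M v c

/-- The canonical square root `√det(-iΩ)` for symmetric `Ω` with positive definite imaginary
part: the inverse of the Gaussian integral of `e(½ xᵀ Ω x)` over `ℝ^g`. -/
def sqrtDetDefinite (Ω : Matrix (Fin g) (Fin g) ℂ) : ℂ :=
  (∫ x : Fin g → ℝ, e (1 / 2 * (realVec x ⬝ᵥ (Ω *ᵥ realVec x))))⁻¹

/-- The square root `√det(-iΩ)` for `Ω` of index `1`, with `M = Im Ω`:
`√(-cᵀMc) · √det(-i(Ω - (2i / cᵀMc) M c cᵀ M)) / √(-(Ω̄c)ᵀ Im(-Ω⁻¹) (Ω̄c))`.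
The branches of the two outer square roots are the ones positive at `v` (a negative vector of
`Im Ω`) and at `w` (a negative vector of `Im(-Ω⁻¹)`), and `c ∈ R_M` is auxiliary. -/
def sqrtDet (v w : Fin g → ℝ) (Ω : Matrix (Fin g) (Fin g) ℂ) (c : Fin g → ℂ) : ℂ :=
  sqrtNeg (imPart Ω) v c *
      sqrtDetDefinite (Ω - (2 * Complex.I / bil (imPart Ω) c c) •
        (realMat (imPart Ω) * vecMulVec c c * realMat (imPart Ω))) /
    sqrtNeg (imPart (-Ω⁻¹)) w (conjMat Ω *ᵥ c)

/-- The incomplete Gaussian transform `∫_0^α f(u) e^{-πu²} du`, along the segment from `0` to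
`α`. For entire `f` the contour does not matter; for real `α` only the values of `f` on the real
line enter. -/
def incGauss (f : ℂ → ℂ) (α : ℂ) : ℂ :=
  α * ∫ t in (0 : ℝ)..1, f (t * α) * Complex.exp (-Real.pi * (t * α) ^ 2)

/-- The argument `cᵀ Im(Ωn + z) / √(-½ cᵀ Im(Ω) c)` of the incomplete Gaussian transform. -/
def thetaArg (v : Fin g → ℝ) (c z : Fin g → ℂ) (Ω : Matrix (Fin g) (Fin g) ℂ)
    (n : Fin g → ℤ) : ℂ :=
  (c ⬝ᵥ realVec (fun i => ((Ω *ᵥ intVec n + z) i).im)) / sqrtHalfNeg (imPart Ω) v c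

/-- The term of index `n` of the indefinite theta series. -/
def thetaTerm (v : Fin g → ℝ) (f : ℂ → ℂ) (c₁ c₂ z : Fin g → ℂ)
    (Ω : Matrix (Fin g) (Fin g) ℂ) (n : Fin g → ℤ) : ℂ :=
  (incGauss f (thetaArg v c₂ z Ω n) - incGauss f (thetaArg v c₁ z Ω n)) *
    e (1 / 2 * (intVec n ⬝ᵥ (Ω *ᵥ intVec n)) + intVec n ⬝ᵥ z)

/-- The indefinite theta function `Θ^{c₁,c₂}[f](z;Ω)`, formed with the branch of the square root
that is positive at `v`. -/
def theta (v : Fin g → ℝ) (f : ℂ → ℂ) (c₁ c₂ z : Fin g → ℂ)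
    (Ω : Matrix (Fin g) (Fin g) ℂ) : ℂ :=
  ∑' n : Fin g → ℤ, thetaTerm v f c₁ c₂ z Ω n

/-- Admissible test functions for the parameters `c₁, c₂`: either `f` is entire and
`log |f(ξ)| ≤ o(|ξ|²)` on `ℂ`, or `c₁, c₂` are real and `f` is continuous on the real line with
the same growth there (its values off the real line are then irrelevant). -/
def IsTestFunction (f : ℂ → ℂ) (c₁ c₂ : Fin g → ℂ) : Prop :=
  (Differentiable ℂ f ∧
    ∀ ε : ℝ, 0 < ε → ∀ᶠ ξ : ℂ in Filter.cocompact ℂ, ‖f ξ‖ ≤ Real.exp (ε * ‖ξ‖ ^ 2)) ∨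
  ((∀ i, (c₁ i).im = 0) ∧ (∀ i, (c₂ i).im = 0) ∧ Continuous (fun x : ℝ => f x) ∧
    ∀ ε : ℝ, 0 < ε → ∀ᶠ x : ℝ in Filter.cocompact ℝ, ‖f (x : ℂ)‖ ≤ Real.exp (ε * x ^ 2))

end IndefTheta

end

open Matrix IndefTheta

/-!
The transformation laws under `GL_g(ℤ)` and under integral translations hold term by term; only
absolute convergence and the inversion formula need an argument.

A form of signature `(g - 1, 1)` is used through one property: it is positive definite on the
orthogonal complement of each negative vector (`Lorentzian`). With `z = ζ + Ωb` for real `ζ`, `b`,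
completing the square (`thetaTerm_eq_kern`) turns the theta series into a sum, twisted by a
character, of the values on `ℤ^g + b` of the function
`kern v f c₁ c₂ Ω x = (𝓔_f(α_x(c₂)) - 𝓔_f(α_x(c₁))) e(½ xᵀΩx)`.

Convergence follows from Gaussian decay of `kern` (`exists_norm_kern_le`). Where `xᵀMx`, for
`M = Im Ω`, is at least a fixed multiple of `|x|²`, the factor `e(½ xᵀΩx)` decays, and the growth
of each `𝓔_f(α_x(c))` is controlled by `xᵀMx + Re α_x(c)² > 0`. In the remaining directions `Re α_x(c)²`
is positive, so that `Re α_x(c)` keeps its sign on the connected region `R_M`; the difference of the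
two transforms is then an integral of `f(u) e^{-πu²}` along a segment on which this integrand is
small.

For the inversion, put `W = -Ω⁻¹` and `ĉ = W̄c`. The map `c ↦ ĉ` carries `R_{Im W}` to
`R_{Im Ω}` (`conj_mem_negRegion`). Differentiating `kern` in `c` gives a linear form in `x` times
`e^{-πα²} e(½ xᵀWx)`, and this product of exponentials is the Gaussian of the rank one modification
`twist W c` of `W`, whose imaginary part is positive definite (`exp_alpha_mul_gauss`,
`twist_im_pos`). The matrices `twist W c` and `twist Ω ĉ` are again negative inverses of each other
(`twist_neg_inv`), and `twist Ω ĉ` carries the linear form for `W` to a multiple of the one for `Ω`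
(`twist_mulVec_alphaForm`). Hence the Fourier transform of the derivative for `W` is the derivative
for `Ω` times `-1/√det(iΩ⁻¹)` (`integral_alphaDeriv_mul_gauss_mul_e`). This factor does not depend
on `c`: its square is a constant by the determinant formula for rank one modifications, and it is
continuous on a connected set (`invSqrtDet_eq`). Integrating along a segment from the vector `w`
that fixes the branch gives the Fourier transform of `kern` (`integral_kern_mul_e`), and Poisson
summation (`tsum_eq_tsum_fourier`) gives the inversion formula (`theta_neg_inv`).
-/

open Matrix MeasureTheory

namespace IndefTheta

/-! ### Lorentzian forms -/

section

variable {g : ℕ}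

/-- The entrywise real part of a complex vector. -/
def reVec (c : Fin g → ℂ) : Fin g → ℝ := fun i => (c i).re

/-- The entrywise imaginary part of a complex vector. -/
def imVec (c : Fin g → ℂ) : Fin g → ℝ := fun i => (c i).im

lemma realMat_mulVec_re (M : Matrix (Fin g) (Fin g) ℝ) (c : Fin g → ℂ) (i : Fin g) :
    ((realMat M *ᵥ c) i).re = (M *ᵥ reVec c) i := by
  simp [realMat, mulVec, dotProduct, reVec]

lemma realMat_mulVec_im (M : Matrix (Fin g) (Fin g) ℝ) (c : Fin g → ℂ) (i : Fin g) :
    ((realMat M *ᵥ c) i).im = (M *ᵥ imVec c) i := by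
  simp [realMat, mulVec, dotProduct, imVec]

lemma bil_re (M : Matrix (Fin g) (Fin g) ℝ) (c d : Fin g → ℂ) :
    (bil M c d).re = reVec c ⬝ᵥ (M *ᵥ reVec d) - imVec c ⬝ᵥ (M *ᵥ imVec d) := by
  simp only [bil, dotProduct, Complex.re_sum, Complex.mul_re, realMat_mulVec_re,
    realMat_mulVec_im, Finset.sum_sub_distrib]
  rfl

lemma bil_im (M : Matrix (Fin g) (Fin g) ℝ) (c d : Fin g → ℂ) :
    (bil M c d).im = reVec c ⬝ᵥ (M *ᵥ imVec d) + imVec c ⬝ᵥ (M *ᵥ reVec d) := by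
  simp only [bil, dotProduct, Complex.im_sum, Complex.mul_im, realMat_mulVec_re,
    realMat_mulVec_im, Finset.sum_add_distrib]
  rfl

@[simp] lemma reVec_realVec (x : Fin g → ℝ) : reVec (realVec x) = x := by
  ext i; simp [reVec, realVec]

@[simp] lemma imVec_realVec (x : Fin g → ℝ) : imVec (realVec x) = 0 := by
  ext i; simp [imVec, realVec]

@[simp] lemma reVec_star (c : Fin g → ℂ) : reVec (star c) = reVec c := by
  ext i; simp [reVec]

@[simp] lemma imVec_star (c : Fin g → ℂ) : imVec (star c) = -imVec c := by
  ext i; simp [imVec]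

lemma bil_realVec (M : Matrix (Fin g) (Fin g) ℝ) (x y : Fin g → ℝ) :
    bil M (realVec x) (realVec y) = ((x ⬝ᵥ (M *ᵥ y) : ℝ) : ℂ) := by
  apply Complex.ext <;> simp [bil_re, bil_im]

lemma bil_star_self_re (M : Matrix (Fin g) (Fin g) ℝ) (c : Fin g → ℂ) :
    (bil M (star c) c).re = reVec c ⬝ᵥ (M *ᵥ reVec c) + imVec c ⬝ᵥ (M *ᵥ imVec c) := by
  simp [bil_re]

lemma bil_add_left (M : Matrix (Fin g) (Fin g) ℝ) (a b c : Fin g → ℂ) :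
    bil M (a + b) c = bil M a c + bil M b c := add_dotProduct _ _ _

lemma bil_add_right (M : Matrix (Fin g) (Fin g) ℝ) (a b c : Fin g → ℂ) :
    bil M a (b + c) = bil M a b + bil M a c := by
  simp [bil, mulVec_add, dotProduct_add]

lemma bil_smul_left (M : Matrix (Fin g) (Fin g) ℝ) (k : ℂ) (a b : Fin g → ℂ) :
    bil M (k • a) b = k * bil M a b := by simp [bil]

lemma bil_smul_right (M : Matrix (Fin g) (Fin g) ℝ) (k : ℂ) (a b : Fin g → ℂ) :
    bil M a (k • b) = k * bil M a b := by simp [bil, mulVec_smul]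

lemma dotProduct_mulVec_symm {R : Type*} [CommRing R] {M : Matrix (Fin g) (Fin g) R}
    (hM : M.IsSymm) (x y : Fin g → R) : x ⬝ᵥ (M *ᵥ y) = y ⬝ᵥ (M *ᵥ x) := by
  rw [dotProduct_mulVec, ← mulVec_transpose, hM.eq, dotProduct_comm]

lemma realMat_isSymm {M : Matrix (Fin g) (Fin g) ℝ} (hM : M.IsSymm) : (realMat M).IsSymm := by
  unfold Matrix.IsSymm realMat
  rw [← Matrix.transpose_map, hM.eq]

lemma bil_symm {M : Matrix (Fin g) (Fin g) ℝ} (hM : M.IsSymm) (x y : Fin g → ℂ) :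
    bil M x y = bil M y x := dotProduct_mulVec_symm (realMat_isSymm hM) x y

lemma continuous_bil (M : Matrix (Fin g) (Fin g) ℝ) :
    Continuous fun p : (Fin g → ℂ) × (Fin g → ℂ) => bil M p.1 p.2 := by
  unfold bil mulVec dotProduct
  fun_prop

/-- A real symmetric matrix is *Lorentzian* if it is positive definite on the orthogonal
complement of each of its negative vectors. As soon as there is a negative vector this says that
the signature is `(g - 1, 1)`. -/
def Lorentzian (M : Matrix (Fin g) (Fin g) ℝ) : Prop :=
  M.IsSymm ∧ ∀ v x : Fin g → ℝ, v ⬝ᵥ (M *ᵥ v) < 0 → v ⬝ᵥ (M *ᵥ x) = 0 → x ≠ 0 →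
    0 < x ⬝ᵥ (M *ᵥ x)

/-- A vector `x` orthogonal to a negative vector `v` with `xᵀMx ≤ 0` would span with `v` a
negative semidefinite plane, too large beside a positive definite subspace of dimension
`g - 1`. -/
lemma lorentzian_of_sigPos {M : Matrix (Fin g) (Fin g) ℝ} (hM : M.IsSymm)
    (h : sigPos M.toQuadraticForm' = g - 1) : Lorentzian M := by
  refine ⟨hM, fun v x hv hvx hx => ?_⟩
  by_contra! hxx
  have hli : LinearIndependent ℝ ![v, x] := by
    rw [LinearIndependent.pair_iff]
    intro s t hst
    have h1 : v ⬝ᵥ (M *ᵥ (s • v + t • x)) = 0 := by simp [hst]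
    simp only [mulVec_add, mulVec_smul, dotProduct_add, dotProduct_smul, hvx, smul_eq_mul,
      mul_zero, add_zero] at h1
    have hs : s = 0 := by
      rcases mul_eq_zero.1 h1 with h1 | h1
      · exact h1
      · exact absurd h1 hv.ne
    subst hs
    simpa [hx] using hst
  have hfin := finrank_span_eq_card hli
  have hle := QuadraticForm.sigPos_add_finrank_le_of_nonpos (Q := M.toQuadraticForm')
    (V := Submodule.span ℝ (Set.range ![v, x])) (fun y hy => by
      have : Set.range ![v, x] = {v, x} := by simp [Set.pair_comm]
      rw [this, Submodule.mem_span_pair] at hy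
      obtain ⟨s, t, rfl⟩ := hy
      have hxv : x ⬝ᵥ (M *ᵥ v) = 0 := by rw [dotProduct_mulVec_symm hM, hvx]
      simp only [toQuadraticForm', LinearMap.BilinMap.toQuadraticMap_apply, toLinearMap₂'_apply',
        mulVec_add, mulVec_smul, dotProduct_add, dotProduct_smul, add_dotProduct, smul_dotProduct,
        hvx, hxv, smul_eq_mul]
      nlinarith [mul_nonneg (sq_nonneg s) (neg_nonneg.2 hv.le),
        mul_nonneg (sq_nonneg t) (neg_nonneg.2 hxx)])
  rw [hfin, h] at hle
  simp only [Fintype.card_fin, Module.finrank_fintype_fun_eq_card] at hle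
  have : g ≠ 0 := by
    rintro rfl
    exact hx (Subsingleton.elim _ _)
  omega

namespace Lorentzian

variable {M : Matrix (Fin g) (Fin g) ℝ} {v : Fin g → ℝ}

lemma nonneg (hM : Lorentzian M) (hv : v ∈ negReal M) {x : Fin g → ℝ}
    (hx : v ⬝ᵥ (M *ᵥ x) = 0) : 0 ≤ x ⬝ᵥ (M *ᵥ x) := by
  by_cases h : x = 0
  · simp [h]
  · exact (hM.2 v x hv hx h).le

/-- The Cauchy–Schwarz inequality on the orthogonal complement of a negative vector. -/
lemma cauchy_schwarz (hM : Lorentzian M) (hv : v ∈ negReal M) {x y : Fin g → ℝ}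
    (hx : v ⬝ᵥ (M *ᵥ x) = 0) (hy : v ⬝ᵥ (M *ᵥ y) = 0) :
    (x ⬝ᵥ (M *ᵥ y)) ^ 2 ≤ (x ⬝ᵥ (M *ᵥ x)) * (y ⬝ᵥ (M *ᵥ y)) := by
  have key : ∀ t : ℝ, 0 ≤ (y ⬝ᵥ (M *ᵥ y)) * (t * t) + (2 * (x ⬝ᵥ (M *ᵥ y))) * t
      + x ⬝ᵥ (M *ᵥ x) := fun t => by
    have h := hM.nonneg hv (x := x + t • y)
      (by simp [mulVec_add, mulVec_smul, hx, hy])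
    simp only [mulVec_add, mulVec_smul, dotProduct_add, dotProduct_smul, add_dotProduct,
      smul_dotProduct, smul_eq_mul] at h
    rw [dotProduct_mulVec_symm hM.1 y x] at h
    linarith
  have := discrim_le_zero key
  unfold discrim at this
  nlinarith

/-- Otherwise the real and imaginary parts of `c` would lie in `v^⊥`, where the form is
nonnegative. -/
lemma bil_ne_zero (hM : Lorentzian M) (hv : v ∈ negReal M) {c : Fin g → ℂ}
    (hc : c ∈ negRegion M) : bil M (realVec v) c ≠ 0 := by
  intro h
  have h1 := congrArg Complex.re h
  have h2 := congrArg Complex.im h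
  simp only [bil_re, bil_im, reVec_realVec, imVec_realVec, zero_dotProduct, sub_zero, add_zero,
    Complex.zero_re, Complex.zero_im] at h1 h2
  have hc' : (bil M (star c) c).re < 0 := hc
  rw [bil_star_self_re] at hc'
  linarith [hM.nonneg hv h1, hM.nonneg hv h2]

lemma norm_bil_le (hM : Lorentzian M) (hv : v ∈ negReal M) {u : Fin g → ℂ}
    (hu : bil M (realVec v) u = 0) : ‖bil M u u‖ ≤ (bil M (star u) u).re := by
  have h1 := congrArg Complex.re hu
  have h2 := congrArg Complex.im hu
  simp only [bil_re, bil_im, reVec_realVec, imVec_realVec, zero_dotProduct, sub_zero, add_zero,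
    Complex.zero_re, Complex.zero_im] at h1 h2
  have hcs := hM.cauchy_schwarz hv h1 h2
  rw [bil_star_self_re]
  have p1 := hM.nonneg hv h1
  have p2 := hM.nonneg hv h2
  rw [← abs_of_nonneg (add_nonneg p1 p2), ← sq_le_sq₀ (norm_nonneg _) (abs_nonneg _), sq_abs,
    ← Complex.normSq_eq_norm_sq, Complex.normSq_apply, bil_re, bil_im,
    dotProduct_mulVec_symm hM.1 (imVec u) (reVec u)]
  nlinarith

/-- A vector of `R_M` is a multiple of a vector `v + u` with `u` orthogonal to `v`. -/
lemma exists_smul_add (hM : Lorentzian M) (hv : v ∈ negReal M) {c : Fin g → ℂ}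
    (hc : c ∈ negRegion M) : ∃ (k : ℂ) (u : Fin g → ℂ), k ≠ 0 ∧ bil M (realVec v) u = 0 ∧
      c = k • (realVec v + u) := by
  have hb := hM.bil_ne_zero hv hc
  have hv0 : bil M (realVec v) (realVec v) ≠ 0 := by
    rw [bil_realVec]; exact_mod_cast (show v ⬝ᵥ (M *ᵥ v) < 0 from hv).ne
  refine ⟨bil M (realVec v) c / bil M (realVec v) (realVec v),
    (bil M (realVec v) (realVec v) / bil M (realVec v) c) • c + (-1 : ℂ) • realVec v,
    div_ne_zero hb hv0, ?_, ?_⟩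
  · rw [bil_add_right, bil_smul_right, bil_smul_right, div_mul_cancel₀ _ hb]
    ring
  · ext i
    simp only [Pi.smul_apply, Pi.add_apply, smul_eq_mul]
    field_simp
    ring

lemma smul_mem_negRegion_iff {k : ℂ} (hk : k ≠ 0) {c : Fin g → ℂ} :
    k • c ∈ negRegion M ↔ c ∈ negRegion M := by
  have : (bil M (star (k • c)) (k • c)).re = Complex.normSq k * (bil M (star c) c).re := by
    have h : bil M (star (k • c)) (k • c) = (Complex.normSq k : ℂ) * bil M (star c) c := by
      rw [star_smul, bil_smul_left, bil_smul_right, ← mul_assoc, ← Complex.mul_conj,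
        mul_comm k]
      rfl
    rw [h, Complex.re_ofReal_mul]
  simp only [negRegion, Set.mem_ofPred_eq, this]
  have := Complex.normSq_pos.2 hk
  constructor
  · intro h; by_contra! h'; nlinarith
  · intro h; nlinarith

lemma bil_star_add (hM : Lorentzian M) {u : Fin g → ℂ}
    (hu : bil M (realVec v) u = 0) (t : ℝ) :
    (bil M (star (realVec v + (t : ℂ) • u)) (realVec v + (t : ℂ) • u)).re =
      v ⬝ᵥ (M *ᵥ v) + t ^ 2 * (bil M (star u) u).re := by
  have h1 := congrArg Complex.re hu
  simp only [bil_re, reVec_realVec, imVec_realVec, zero_dotProduct, sub_zero,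
    Complex.zero_re] at h1
  have e1 : reVec (realVec v + (t : ℂ) • u) = v + t • reVec u := by
    ext i; simp [reVec, realVec]
  have e2 : imVec (realVec v + (t : ℂ) • u) = t • imVec u := by
    ext i; simp [imVec, realVec]
  rw [bil_star_self_re, bil_star_self_re, e1, e2]
  simp only [mulVec_add, mulVec_smul, dotProduct_add, dotProduct_smul, add_dotProduct,
      smul_dotProduct, smul_eq_mul, h1, dotProduct_mulVec_symm hM.1 (reVec u) v]
  ring

/-- `R_M` is star-shaped about `v` inside the affine hyperplane `v + v^⊥`. -/
lemma segment_mem (hM : Lorentzian M) (hv : v ∈ negReal M) {u : Fin g → ℂ}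
    (hu : bil M (realVec v) u = 0) (hc : realVec v + u ∈ negRegion M) {t : ℝ}
    (ht : t ∈ Set.Icc (0 : ℝ) 1) : realVec v + (t : ℂ) • u ∈ negRegion M := by
  have h1 := hM.bil_star_add hu 1
  have hc' : (bil M (star (realVec v + u)) (realVec v + u)).re < 0 := hc
  have hv' : v ⬝ᵥ (M *ᵥ v) < 0 := hv
  simp only [Complex.ofReal_one, one_smul] at h1
  change (bil M _ _).re < 0
  rw [hM.bil_star_add hu t]
  have h0 : 0 ≤ (bil M (star u) u).re := (norm_nonneg _).trans (hM.norm_bil_le hv hu)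
  nlinarith [mul_le_mul_of_nonneg_right (show t ^ 2 ≤ 1 by nlinarith [ht.1, ht.2]) h0]

lemma realVec_mem_negRegion (hv : v ∈ negReal M) : realVec v ∈ negRegion M := by
  change (bil M _ _).re < 0
  have hv' : v ⬝ᵥ (M *ᵥ v) < 0 := hv
  rw [bil_star_self_re]
  simpa using hv'

/-- The argument of the principal square root in `sqrtNeg` has positive real part. -/
lemma ratio_re_pos (hM : Lorentzian M) (hv : v ∈ negReal M) {c : Fin g → ℂ}
    (hc : c ∈ negRegion M) :
    0 < (bil M c c * bil M (realVec v) (realVec v) / bil M (realVec v) c ^ 2).re := by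
  obtain ⟨k, u, hk, hu, rfl⟩ := hM.exists_smul_add hv hc
  have hv' : v ⬝ᵥ (M *ᵥ v) < 0 := hv
  have hv0 : bil M (realVec v) (realVec v) ≠ 0 := by
    rw [bil_realVec]; exact_mod_cast hv'.ne
  have hc' : (bil M (star (realVec v + u)) (realVec v + u)).re < 0 :=
    (smul_mem_negRegion_iff hk).1 hc
  have h1 := hM.bil_star_add hu 1
  simp only [Complex.ofReal_one, one_smul] at h1
  have hn := hM.norm_bil_le hv hu
  have e : bil M (k • (realVec v + u)) (k • (realVec v + u)) * bil M (realVec v) (realVec v)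
      / bil M (realVec v) (k • (realVec v + u)) ^ 2 =
      1 + bil M u u / bil M (realVec v) (realVec v) := by
    simp only [bil_smul_left, bil_smul_right, bil_add_left, bil_add_right, hu,
      bil_symm hM.1 u (realVec v)]
    rw [div_eq_iff (pow_ne_zero 2 (by simpa [hk] using hv0))]
    field_simp
    ring
  rw [e, bil_realVec, Complex.add_re, Complex.one_re, Complex.div_ofReal_re]
  have hb := Complex.abs_re_le_norm (bil M u u)
  have : |(bil M u u).re / (v ⬝ᵥ (M *ᵥ v))| < 1 := by
    rw [abs_div, abs_of_neg hv', div_lt_one (by linarith)]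
    linarith
  linarith [(abs_lt.1 this).1]

lemma bil_self_ne_zero (hM : Lorentzian M) (hv : v ∈ negReal M) {c : Fin g → ℂ}
    (hc : c ∈ negRegion M) : bil M c c ≠ 0 := by
  intro h
  have := hM.ratio_re_pos hv hc
  simp [h] at this

lemma det_ne_zero (hM : Lorentzian M) (hv : v ∈ negReal M) : M.det ≠ 0 := by
  intro h
  obtain ⟨x, hx, hMx⟩ := Matrix.exists_mulVec_eq_zero_iff.2 h
  have := hM.2 v x hv (by simp [hMx]) hx
  simp [hMx] at this

/-- After a rescaling `cᵀMc = -1`; then the real and imaginary parts `a`, `b` of `c` are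
orthogonal, `a` is negative with `-aᵀMa > 1/2`, and `bᵀMb < 1/2`. -/
lemma exists_normalized (hM : Lorentzian M) (hv : v ∈ negReal M) {c : Fin g → ℂ}
    (hc : c ∈ negRegion M) : ∃ k : ℂ, k ≠ 0 ∧ bil M (k • c) (k • c) = -1 ∧
      reVec (k • c) ∈ negReal M ∧ reVec (k • c) ⬝ᵥ (M *ᵥ imVec (k • c)) = 0 ∧
      reVec (k • c) ⬝ᵥ (M *ᵥ reVec (k • c)) - imVec (k • c) ⬝ᵥ (M *ᵥ imVec (k • c)) = -1 ∧
      reVec (k • c) ⬝ᵥ (M *ᵥ reVec (k • c)) + imVec (k • c) ⬝ᵥ (M *ᵥ imVec (k • c)) < 0 := by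
  have hcc := hM.bil_self_ne_zero hv hc
  obtain ⟨k, hk⟩ : ∃ k : ℂ, k * k * bil M c c = -1 := by
    obtain ⟨k, hk⟩ := IsAlgClosed.exists_pow_nat_eq (-1 / bil M c c) (n := 2) (by norm_num)
    exact ⟨k, by rw [← sq, hk]; field_simp⟩
  have hk0 : k ≠ 0 := by rintro rfl; simp at hk
  have hdd : bil M (k • c) (k • c) = -1 := by rw [bil_smul_left, bil_smul_right, ← mul_assoc, hk]
  have hdn : (bil M (star (k • c)) (k • c)).re < 0 := (smul_mem_negRegion_iff hk0).2 hc
  have r1 := congrArg Complex.re hdd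
  have r2 := congrArg Complex.im hdd
  rw [bil_re] at r1
  rw [bil_im, dotProduct_mulVec_symm hM.1 (imVec (k • c))] at r2
  rw [bil_star_self_re] at hdn
  simp only [Complex.neg_re, Complex.neg_im, Complex.one_re, Complex.one_im] at r1 r2
  exact ⟨k, hk0, hdd, show reVec (k • c) ⬝ᵥ (M *ᵥ reVec (k • c)) < 0 by linarith,
    by linarith, r1, hdn⟩

/-- For `M = Im Ω` this is positivity of the quadratic form of the imaginary part of
`Ω - (2i / cᵀMc) M c cᵀ M`. -/
lemma twisted_pos (hM : Lorentzian M) (hv : v ∈ negReal M) {c : Fin g → ℂ}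
    (hc : c ∈ negRegion M) {x : Fin g → ℝ} (hx : x ≠ 0) :
    0 < x ⬝ᵥ (M *ᵥ x) - 2 * (bil M c (realVec x) ^ 2 / bil M c c).re := by
  have hcc := hM.bil_self_ne_zero hv hc
  obtain ⟨k, hk0, hdd, ha, hab, r1, hdn⟩ := hM.exists_normalized hv hc
  have e : bil M c (realVec x) ^ 2 / bil M c c = - bil M (k • c) (realVec x) ^ 2 := by
    rw [bil_smul_left, bil_smul_right] at hdd
    rw [bil_smul_left, div_eq_iff hcc]
    linear_combination bil M c (realVec x) ^ 2 * hdd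
  rw [e, Complex.neg_re, sq, Complex.mul_re, bil_re, bil_im]
  simp only [reVec_realVec, imVec_realVec, mulVec_zero, dotProduct_zero, sub_zero, zero_add]
  set a := reVec (k • c)
  set b := imVec (k • c)
  have hbb := hM.nonneg ha hab
  have haa : a ⬝ᵥ (M *ᵥ a) < 0 := ha
  -- the component of `x` along `a` is handled directly, the one orthogonal to `a` by the
  -- Cauchy–Schwarz inequality and `bᵀMb < 1/2`
  set p := a ⬝ᵥ (M *ᵥ x) / a ⬝ᵥ (M *ᵥ a) with hp
  obtain ⟨y, hy⟩ : ∃ y, y = x - p • a := ⟨_, rfl⟩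
  have hxy : x = p • a + y := by rw [hy]; abel
  have hay : a ⬝ᵥ (M *ᵥ y) = 0 := by
    rw [hy, mulVec_sub, mulVec_smul, dotProduct_sub, dotProduct_smul, smul_eq_mul, hp,
      div_mul_cancel₀ _ haa.ne, sub_self]
  have hcs := hM.cauchy_schwarz ha hab hay
  have hyy := hM.nonneg ha hay
  have q1 : x ⬝ᵥ (M *ᵥ x) = p ^ 2 * (a ⬝ᵥ (M *ᵥ a)) + y ⬝ᵥ (M *ᵥ y) := by
    rw [hxy]
    simp only [mulVec_add, mulVec_smul, dotProduct_add, dotProduct_smul, add_dotProduct,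
      smul_dotProduct, smul_eq_mul, hay, dotProduct_mulVec_symm hM.1 y a]
    ring
  have q2 : a ⬝ᵥ (M *ᵥ x) = p * (a ⬝ᵥ (M *ᵥ a)) := by rw [hp, div_mul_cancel₀ _ haa.ne]
  have q3 : b ⬝ᵥ (M *ᵥ x) = b ⬝ᵥ (M *ᵥ y) := by
    rw [hxy]
    simp [mulVec_add, mulVec_smul, dotProduct_mulVec_symm hM.1 b a, hab]
  rw [q1, q2, q3]
  have hA : 0 < a ⬝ᵥ (M *ᵥ a) * (1 + 2 * (a ⬝ᵥ (M *ᵥ a))) := by nlinarith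
  by_cases hp0 : p = 0
  · have hy0 : y ≠ 0 := by rintro rfl; apply hx; rw [hxy, hp0]; simp
    have := hM.2 a y ha hay hy0
    rw [hp0]
    nlinarith
  · have := mul_pos (pow_pos (abs_pos.2 hp0) 2) hA
    rw [sq_abs] at this
    nlinarith

/-- A complex vector orthogonal, for the Hermitian form `x̄ᵀ M y`, to a negative one is
positive. -/
lemma hermitian_pos (hM : Lorentzian M) (hv : v ∈ negReal M) {c x : Fin g → ℂ}
    (hc : c ∈ negRegion M) (hcx : bil M (star c) x = 0) (hx : x ≠ 0) :
    0 < (bil M (star x) x).re := by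
  obtain ⟨k, hk0, hdd, ha, hab, r1, hdn⟩ := hM.exists_normalized hv hc
  have hdx : bil M (star (k • c)) x = 0 := by rw [star_smul, bil_smul_left, hcx, mul_zero]
  have h1 := congrArg Complex.re hdx
  have h2 := congrArg Complex.im hdx
  simp only [bil_re, bil_im, reVec_star, imVec_star, neg_dotProduct, Complex.zero_re,
    Complex.zero_im] at h1 h2
  rw [bil_star_self_re]
  set a := reVec (k • c)
  set b := imVec (k • c)
  have hbb := hM.nonneg ha hab
  have haa : a ⬝ᵥ (M *ᵥ a) < 0 := ha
  -- the real and imaginary parts of `x` are split along `a` and `a^⊥`; the two orthogonality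
  -- relations express the components along `a` by products of `b` with the ones in `a^⊥`, which
  -- the Cauchy–Schwarz inequality bounds because `bᵀMb < -aᵀMa`
  have decomp : ∀ x : Fin g → ℝ, ∃ (p : ℝ) (y : Fin g → ℝ), x = p • a + y ∧
      a ⬝ᵥ (M *ᵥ x) = p * (a ⬝ᵥ (M *ᵥ a)) ∧ b ⬝ᵥ (M *ᵥ x) = b ⬝ᵥ (M *ᵥ y) ∧
      x ⬝ᵥ (M *ᵥ x) = p ^ 2 * (a ⬝ᵥ (M *ᵥ a)) + y ⬝ᵥ (M *ᵥ y) ∧ a ⬝ᵥ (M *ᵥ y) = 0 := by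
    intro x
    obtain ⟨p, hp⟩ : ∃ p, p * (a ⬝ᵥ (M *ᵥ a)) = a ⬝ᵥ (M *ᵥ x) :=
      ⟨_, div_mul_cancel₀ _ haa.ne⟩
    obtain ⟨y, hy⟩ : ∃ y, y = x - p • a := ⟨_, rfl⟩
    have hxy : x = p • a + y := by rw [hy]; abel
    have hay : a ⬝ᵥ (M *ᵥ y) = 0 := by
      rw [hy, mulVec_sub, mulVec_smul, dotProduct_sub, dotProduct_smul, smul_eq_mul, hp, sub_self]
    refine ⟨p, y, hxy, hp.symm, ?_, ?_, hay⟩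
    · rw [hxy]
      simp [mulVec_add, mulVec_smul, dotProduct_mulVec_symm hM.1 b a, hab]
    · rw [hxy]
      simp only [mulVec_add, mulVec_smul, dotProduct_add, dotProduct_smul, add_dotProduct,
        smul_dotProduct, smul_eq_mul, hay, dotProduct_mulVec_symm hM.1 y a]
      ring
  obtain ⟨p, y, hy, e1, e2, e3, hay⟩ := decomp (reVec x)
  obtain ⟨q, z, hz, f1, f2, f3, haz⟩ := decomp (imVec x)
  have c1 := hM.cauchy_schwarz ha hab hay
  have c2 := hM.cauchy_schwarz ha hab haz
  have hyy := hM.nonneg ha hay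
  have hzz := hM.nonneg ha haz
  rw [e1, f2] at h1
  rw [e2, f1] at h2
  rw [e3, f3]
  rw [show b ⬝ᵥ (M *ᵥ y) = q * (a ⬝ᵥ (M *ᵥ a)) by linarith] at c1
  rw [show b ⬝ᵥ (M *ᵥ z) = -(p * (a ⬝ᵥ (M *ᵥ a))) by linarith] at c2
  obtain ⟨A, hA⟩ : ∃ A, A = -(a ⬝ᵥ (M *ᵥ a)) := ⟨_, rfl⟩
  rw [show a ⬝ᵥ (M *ᵥ a) = -A by linarith] at haa hdn c1 c2 ⊢
  have hApos : 0 < A := by linarith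
  by_contra! hneg
  have hsum : y ⬝ᵥ (M *ᵥ y) + z ⬝ᵥ (M *ᵥ z) ≤ A * (p ^ 2 + q ^ 2) := by nlinarith
  have hS : y ⬝ᵥ (M *ᵥ y) + z ⬝ᵥ (M *ᵥ z) = 0 := by
    by_contra hne
    have hpos : 0 < y ⬝ᵥ (M *ᵥ y) + z ⬝ᵥ (M *ᵥ z) :=
      lt_of_le_of_ne (by linarith) (Ne.symm hne)
    nlinarith [mul_le_mul_of_nonneg_left hsum hApos.le]
  have hy0 : y = 0 := by
    by_contra h
    linarith [hM.2 a y ha hay h]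
  have hz0 : z = 0 := by
    by_contra h
    linarith [hM.2 a z ha haz h]
  simp only [hy0, hz0, mulVec_zero, dotProduct_zero, mul_zero] at c1 c2
  have hq : q = 0 := by
    by_contra h
    have := mul_pos (pow_pos (abs_pos.2 h) 2) (pow_pos hApos 2)
    rw [sq_abs] at this
    nlinarith
  have hp : p = 0 := by
    by_contra h
    have := mul_pos (pow_pos (abs_pos.2 h) 2) (pow_pos hApos 2)
    rw [sq_abs] at this
    nlinarith
  apply hx
  ext i
  rw [hp, hy0] at hy
  rw [hq, hz0] at hz
  exact Complex.ext (by simpa [reVec] using congrFun hy i) (by simpa [imVec] using congrFun hz i)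

end Lorentzian

end

/-! ### The branches of `√(-½ cᵀMc)` and the argument `α(c)` -/

section

variable {g : ℕ} {M : Matrix (Fin g) (Fin g) ℝ} {v : Fin g → ℝ}

/-- The argument `cᵀ M x / √(-½ cᵀ M c)` of the incomplete Gaussian transform, for a real
vector `x`. -/
noncomputable def alpha (M : Matrix (Fin g) (Fin g) ℝ) (v : Fin g → ℝ) (c : Fin g → ℂ)
    (x : Fin g → ℝ) : ℂ :=
  bil M c (realVec x) / sqrtHalfNeg M v c

/-- The derivative of `alpha` along the affine line through `c` in the direction `u`. -/
noncomputable def alphaDeriv (M : Matrix (Fin g) (Fin g) ℝ) (v : Fin g → ℝ) (c u : Fin g → ℂ)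
    (x : Fin g → ℝ) : ℂ :=
  (bil M c (realVec x) * bil M u c - bil M u (realVec x) * bil M c c) /
    (2 * sqrtHalfNeg M v c ^ 3)

lemma sqrt_neg_self_ne_zero (hv : v ∈ negReal M) :
    ((Real.sqrt (-(v ⬝ᵥ (M *ᵥ v))) : ℝ) : ℂ) ≠ 0 := by
  have hv' : v ⬝ᵥ (M *ᵥ v) < 0 := hv
  exact_mod_cast (Real.sqrt_pos.2 (by linarith)).ne'

lemma sqrt_two_sq : ((Real.sqrt 2 : ℝ) : ℂ) ^ 2 = 2 := by
  rw [← Complex.ofReal_pow, Real.sq_sqrt (by norm_num)]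
  norm_num

lemma csqrt_sq (a : ℂ) : Complex.sqrt a ^ 2 = a := by
  unfold Complex.sqrt
  exact_mod_cast Complex.cpow_nat_inv_pow a (n := 2) (by norm_num)

lemma sqrtNeg_sq (hM : Lorentzian M) (hv : v ∈ negReal M) {c : Fin g → ℂ}
    (hc : c ∈ negRegion M) : sqrtNeg M v c ^ 2 = -bil M c c := by
  have hv' : v ⬝ᵥ (M *ᵥ v) < 0 := hv
  have h1 := hM.bil_ne_zero hv hc
  have h2 := sqrt_neg_self_ne_zero hv
  have h3 : ((Real.sqrt (-(v ⬝ᵥ (M *ᵥ v))) : ℝ) : ℂ) ^ 2 = -((v ⬝ᵥ (M *ᵥ v) : ℝ) : ℂ) := by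
    rw [← Complex.ofReal_pow, Real.sq_sqrt (by linarith)]
    norm_num
  unfold sqrtNeg
  rw [mul_pow, csqrt_sq, div_pow, h3, bil_realVec M v v]
  have h4 : ((v ⬝ᵥ (M *ᵥ v) : ℝ) : ℂ) ≠ 0 := by exact_mod_cast hv'.ne
  field_simp

lemma sqrtHalfNeg_sq (hM : Lorentzian M) (hv : v ∈ negReal M) {c : Fin g → ℂ}
    (hc : c ∈ negRegion M) : sqrtHalfNeg M v c ^ 2 = -(1 / 2) * bil M c c := by
  unfold sqrtHalfNeg
  rw [mul_pow, sqrtNeg_sq hM hv hc, div_pow, sqrt_two_sq]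
  ring

lemma sqrtHalfNeg_ne_zero (hM : Lorentzian M) (hv : v ∈ negReal M) {c : Fin g → ℂ}
    (hc : c ∈ negRegion M) : sqrtHalfNeg M v c ≠ 0 := by
  intro h
  have := sqrtHalfNeg_sq hM hv hc
  rw [h] at this
  exact hM.bil_self_ne_zero hv hc (by simpa using this.symm)

lemma sqrtNeg_smul {k : ℂ} (hk : k ≠ 0) (c : Fin g → ℂ) :
    sqrtNeg M v (k • c) = k * sqrtNeg M v c := by
  unfold sqrtNeg
  simp only [bil_smul_left, bil_smul_right]
  rw [show k * (k * bil M c c) * bil M (realVec v) (realVec v) / (k * bil M (realVec v) c) ^ 2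
    = bil M c c * bil M (realVec v) (realVec v) / bil M (realVec v) c ^ 2 by field_simp]
  ring

lemma alpha_smul {k : ℂ} (hk : k ≠ 0) (c : Fin g → ℂ) : alpha M v (k • c) = alpha M v c := by
  ext x
  unfold alpha sqrtHalfNeg
  rw [bil_smul_left, sqrtNeg_smul hk]
  rw [show 1 / ((Real.sqrt 2 : ℝ) : ℂ) * (k * sqrtNeg M v c) =
    k * (1 / ((Real.sqrt 2 : ℝ) : ℂ) * sqrtNeg M v c) by ring, mul_div_mul_left _ _ hk]

lemma continuousOn_sqrtHalfNeg (hM : Lorentzian M) (hv : v ∈ negReal M) :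
    ContinuousOn (sqrtHalfNeg M v) (negRegion M) := by
  have hb : Continuous fun c : Fin g → ℂ => bil M (realVec v) c := by
    exact (continuous_bil M).comp (continuous_const.prodMk continuous_id)
  have hb' : Continuous fun c : Fin g → ℂ => bil M c c := by
    exact (continuous_bil M).comp (continuous_id.prodMk continuous_id)
  unfold sqrtHalfNeg sqrtNeg
  refine continuousOn_const.mul (ContinuousOn.mul ?_ ?_)
  · exact (hb.neg.continuousOn).div_const _
  · intro c hc
    refine ContinuousAt.comp_continuousWithinAt (g := Complex.sqrt)
      (Complex.continuousAt_sqrt (Or.inl (hM.ratio_re_pos hv hc).le)) ?_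
    exact ((hb'.mul continuous_const).continuousWithinAt).div
      ((hb.pow 2).continuousWithinAt) (pow_ne_zero 2 (hM.bil_ne_zero hv hc))

lemma continuousOn_alpha (hM : Lorentzian M) (hv : v ∈ negReal M) :
    ContinuousOn (fun p : (Fin g → ℂ) × (Fin g → ℝ) => alpha M v p.1 p.2)
      (negRegion M ×ˢ Set.univ) := by
  unfold alpha
  refine ContinuousOn.div ?_ ?_ ?_
  · have hr : Continuous (realVec : (Fin g → ℝ) → (Fin g → ℂ)) := by
      unfold realVec; fun_prop
    exact ((continuous_bil M).comp
      (continuous_fst.prodMk (hr.comp continuous_snd))).continuousOn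
  · exact (continuousOn_sqrtHalfNeg hM hv).comp continuousOn_fst fun p hp => hp.1
  · exact fun p hp => sqrtHalfNeg_ne_zero hM hv hp.1

lemma hasDerivAt_bil_line_left (a u y : Fin g → ℂ) (t : ℝ) :
    HasDerivAt (fun s : ℝ => bil M (a + (s : ℂ) • u) y) (bil M u y) t := by
  have : (fun s : ℝ => bil M (a + (s : ℂ) • u) y) = fun s : ℝ => bil M a y + s * bil M u y := by
    ext s; rw [bil_add_left, bil_smul_left]
  rw [this]
  simpa using ((Complex.ofRealCLM.hasDerivAt (x := t)).mul_const (bil M u y)).const_add (bil M a y)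

lemma hasDerivAt_bil_line_self (hM : M.IsSymm) (a u : Fin g → ℂ) (t : ℝ) :
    HasDerivAt (fun s : ℝ => bil M (a + (s : ℂ) • u) (a + (s : ℂ) • u))
      (2 * bil M u (a + (t : ℂ) • u)) t := by
  have e : (fun s : ℝ => bil M (a + (s : ℂ) • u) (a + (s : ℂ) • u)) =
      fun s : ℝ => bil M a a + (s * (2 * bil M u a) + (s : ℂ) ^ 2 * bil M u u) := by
    ext s
    simp only [bil_add_left, bil_add_right, bil_smul_left, bil_smul_right, bil_symm hM a u]
    ring
  rw [e]
  have h := Complex.ofRealCLM.hasDerivAt (x := t)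
  have h2 := ((h.mul_const (2 * bil M u a)).add ((h.pow 2).mul_const (bil M u u))).const_add
    (bil M a a)
  refine h2.congr_deriv ?_
  rw [bil_add_right, bil_smul_right]
  simp
  ring

/-- The derivative of the square root along a line is determined by the relation
`s² = -½ cᵀMc`. -/
lemma hasDerivAt_sqrtHalfNeg (hM : Lorentzian M) (hv : v ∈ negReal M) {a u : Fin g → ℂ} {t : ℝ}
    (hc : a + (t : ℂ) • u ∈ negRegion M) :
    HasDerivAt (fun s : ℝ => sqrtHalfNeg M v (a + (s : ℂ) • u))
      (-bil M u (a + (t : ℂ) • u) / (2 * sqrtHalfNeg M v (a + (t : ℂ) • u))) t := by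
  have hd : DifferentiableAt ℝ (fun s : ℝ => sqrtHalfNeg M v (a + (s : ℂ) • u)) t := by
    unfold sqrtHalfNeg sqrtNeg
    have hb : DifferentiableAt ℝ (fun s : ℝ => bil M (realVec v) (a + (s : ℂ) • u)) t := by
      simp_rw [bil_symm hM.1 (realVec v)]
      exact (hasDerivAt_bil_line_left _ _ _ t).differentiableAt
    have hb' := (hasDerivAt_bil_line_self hM.1 a u t).differentiableAt
    refine (differentiableAt_const _).mul (DifferentiableAt.mul (hb.neg.div_const _) ?_)
    refine DifferentiableAt.comp t (g := Complex.sqrt)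
      ((Complex.differentiableAt_sqrt (Or.inl (hM.ratio_re_pos hv hc))).restrictScalars ℝ) ?_
    exact (hb'.mul_const _).div (hb.pow 2) (pow_ne_zero 2 (hM.bil_ne_zero hv hc))
  have hs := sqrtHalfNeg_ne_zero hM hv hc
  refine hd.hasDerivAt.congr_deriv ?_
  have hopen : ∀ᶠ s : ℝ in nhds t, a + (s : ℂ) • u ∈ negRegion M := by
    have : IsOpen (negRegion M) := by
      have : Continuous fun c : Fin g → ℂ => (bil M (star c) c).re :=
        Complex.continuous_re.comp ((continuous_bil M).comp (continuous_star.prodMk continuous_id))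
      exact isOpen_lt this continuous_const
    have hcont : Continuous fun s : ℝ => a + (s : ℂ) • u := by fun_prop
    exact hcont.continuousAt.eventually_mem (this.mem_nhds hc)
  have h1 := hd.hasDerivAt.pow 2
  have h2 := (hasDerivAt_bil_line_self hM.1 a u t).const_mul (-(1 / 2) : ℂ)
  have h3 : HasDerivAt ((fun s : ℝ => sqrtHalfNeg M v (a + (s : ℂ) • u)) ^ 2) _ t :=
    h2.congr_of_eventuallyEq (hopen.mono fun s hs => sqrtHalfNeg_sq hM hv hs)
  have := h1.unique h3
  rw [eq_div_iff (by simpa using hs)]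
  simp only [Nat.cast_ofNat, Nat.add_one_sub_one, pow_one] at this
  linear_combination this

lemma hasDerivAt_alpha (hM : Lorentzian M) (hv : v ∈ negReal M) {a u : Fin g → ℂ} {t : ℝ}
    (hc : a + (t : ℂ) • u ∈ negRegion M) (x : Fin g → ℝ) :
    HasDerivAt (fun s : ℝ => alpha M v (a + (s : ℂ) • u) x)
      (alphaDeriv M v (a + (t : ℂ) • u) u x) t := by
  have hs := sqrtHalfNeg_ne_zero hM hv hc
  have h := (hasDerivAt_bil_line_left (M := M) a u (realVec x) t).div
    (hasDerivAt_sqrtHalfNeg hM hv hc) hs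
  refine h.congr_deriv ?_
  unfold alphaDeriv
  have hsq := sqrtHalfNeg_sq hM hv hc
  set s := sqrtHalfNeg M v (a + (t : ℂ) • u)
  set c := a + (t : ℂ) • u
  rw [show bil M c c = -2 * s ^ 2 by rw [hsq]; ring]
  field_simp
  ring

lemma alpha_sq (hM : Lorentzian M) (hv : v ∈ negReal M) {c : Fin g → ℂ}
    (hc : c ∈ negRegion M) (x : Fin g → ℝ) :
    alpha M v c x ^ 2 = -2 * (bil M c (realVec x) ^ 2 / bil M c c) := by
  have := hM.bil_self_ne_zero hv hc
  unfold alpha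
  rw [div_pow, sqrtHalfNeg_sq hM hv hc]
  field_simp

lemma add_alpha_sq_pos (hM : Lorentzian M) (hv : v ∈ negReal M) {c : Fin g → ℂ}
    (hc : c ∈ negRegion M) {x : Fin g → ℝ} (hx : x ≠ 0) :
    0 < x ⬝ᵥ (M *ᵥ x) + (alpha M v c x ^ 2).re := by
  have h := hM.twisted_pos hv hc hx
  rw [alpha_sq hM hv hc]
  simpa [sub_eq_add_neg] using h

/-- For a nonzero `x` with `xᵀMx ≤ 0` the number `α_c(x)²` has positive real part, so `Re α_c(x)`
does not vanish, and it keeps its sign on the connected region `R_M`. -/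
lemma alpha_re_mul_pos (hM : Lorentzian M) (hv : v ∈ negReal M) {c₁ c₂ : Fin g → ℂ}
    (hc₁ : c₁ ∈ negRegion M) (hc₂ : c₂ ∈ negRegion M) {x : Fin g → ℝ} (hx : x ≠ 0)
    (hxx : x ⬝ᵥ (M *ᵥ x) ≤ 0) : 0 < (alpha M v c₁ x).re * (alpha M v c₂ x).re := by
  have ne : ∀ c ∈ negRegion M, (alpha M v c x).re ≠ 0 := by
    intro c hc h
    have := add_alpha_sq_pos hM hv hc hx
    rw [sq, Complex.mul_re, h] at this
    nlinarith [sq_nonneg (alpha M v c x).im]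
  have key : ∀ c ∈ negRegion M, 0 < (alpha M v (realVec v) x).re * (alpha M v c x).re := by
    intro c hc
    obtain ⟨k, u, hk, hu, rfl⟩ := hM.exists_smul_add hv hc
    rw [Lorentzian.smul_mem_negRegion_iff hk] at hc
    rw [alpha_smul hk]
    have hmem := fun t (ht : t ∈ Set.Icc (0 : ℝ) 1) => hM.segment_mem hv hu hc ht
    have hcont : ContinuousOn (fun t : ℝ => (alpha M v (realVec v + (t : ℂ) • u) x).re)
        (Set.Icc 0 1) := by
      refine Complex.continuous_re.comp_continuousOn ((continuousOn_alpha hM hv).comp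
        (f := fun t : ℝ => (realVec v + (t : ℂ) • u, x)) (by fun_prop)
        fun t ht => ⟨hmem t ht, trivial⟩)
    by_contra! hle
    have h0 : (0 : ℝ) ∈ Set.uIcc (alpha M v (realVec v + ((0 : ℝ) : ℂ) • u) x).re
        (alpha M v (realVec v + ((1 : ℝ) : ℂ) • u) x).re := by
      simp only [Complex.ofReal_zero, zero_smul, add_zero, Complex.ofReal_one, one_smul]
      rw [Set.mem_uIcc]
      rcases mul_nonpos_iff.1 hle with h | h
      · exact Or.inr ⟨h.2, h.1⟩
      · exact Or.inl h
    have hsub := intermediate_value_uIcc (a := (0 : ℝ)) (b := 1)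
      (f := fun t : ℝ => (alpha M v (realVec v + (t : ℂ) • u) x).re)
      (by rwa [Set.uIcc_of_le zero_le_one])
    obtain ⟨t, ht, htz⟩ := hsub h0
    rw [Set.uIcc_of_le zero_le_one] at ht
    exact ne _ (hmem t ht) htz
  have h1 := key c₁ hc₁
  have h2 := key c₂ hc₂
  have h3 := mul_pos h1 h2
  have h4 : 0 < (alpha M v (realVec v) x).re ^ 2 := by
    have := ne _ (Lorentzian.realVec_mem_negRegion hv)
    positivity
  by_contra! hle
  nlinarith

end

/-! ### Incomplete Gaussian transforms and homogeneous functions -/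

section

variable {g : ℕ}

lemma isCompact_dotProduct_sphere : IsCompact {x : Fin g → ℝ | x ⬝ᵥ x = 1} := by
  refine Metric.isCompact_of_isClosed_isBounded (isClosed_eq (by fun_prop) continuous_const) ?_
  refine (Metric.isBounded_closedBall (x := (0 : Fin g → ℝ)) (r := 1)).subset fun x hx => ?_
  rw [mem_closedBall_zero_iff, pi_norm_le_iff_of_nonneg zero_le_one]
  intro i
  have hx' : ∑ i, x i * x i = 1 := hx
  have := Finset.single_le_sum (f := fun i => x i * x i) (fun j _ => mul_self_nonneg (x j))
    (Finset.mem_univ i)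
  rw [Real.norm_eq_abs, abs_le_one_iff_mul_self_le_one]
  linarith

lemma dotProduct_self_pos {x : Fin g → ℝ} (hx : x ≠ 0) : 0 < x ⬝ᵥ x :=
  lt_of_le_of_ne (Finset.sum_nonneg fun i _ => mul_self_nonneg (x i))
    (fun h => hx (dotProduct_self_eq_zero.1 h.symm))

lemma dotProduct_self_nonneg' (x : Fin g → ℝ) : 0 ≤ x ⬝ᵥ x :=
  Finset.sum_nonneg fun i _ => mul_self_nonneg (x i)

lemma exists_smul_sphere {x : Fin g → ℝ} (hx : x ≠ 0) :
    ∃ y : Fin g → ℝ, y ⬝ᵥ y = 1 ∧ x = Real.sqrt (x ⬝ᵥ x) • y := by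
  have h := dotProduct_self_pos hx
  have hs := Real.sqrt_pos.2 h
  refine ⟨(Real.sqrt (x ⬝ᵥ x))⁻¹ • x, ?_, ?_⟩
  · rw [smul_dotProduct, dotProduct_smul, smul_eq_mul, smul_eq_mul, ← mul_assoc, ← mul_inv,
      Real.mul_self_sqrt h.le, inv_mul_cancel₀ h.ne']
  · rw [smul_smul, mul_inv_cancel₀ hs.ne', one_smul]

/-- A continuous family, over a compact set, of positive functions that are homogeneous of degree
two is bounded below by a multiple of the Euclidean square norm. -/
lemma exists_pos_mul_le_of_homogeneous {T : Type*} [TopologicalSpace T] {K : Set T}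
    (hK : IsCompact K) {φ : T → (Fin g → ℝ) → ℝ}
    (hcont : ContinuousOn (fun p : T × (Fin g → ℝ) => φ p.1 p.2) (K ×ˢ Set.univ))
    (hhom : ∀ t ∈ K, ∀ (r : ℝ) (x : Fin g → ℝ), φ t (r • x) = r ^ 2 * φ t x)
    (hpos : ∀ t ∈ K, ∀ x : Fin g → ℝ, x ≠ 0 → 0 < φ t x) :
    ∃ δ : ℝ, 0 < δ ∧ ∀ t ∈ K, ∀ x : Fin g → ℝ, δ * (x ⬝ᵥ x) ≤ φ t x := by
  have hcomp := hK.prod (isCompact_dotProduct_sphere (g := g))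
  have hc' := hcont.mono (Set.prod_mono_right (s := K)
    (Set.subset_univ {x : Fin g → ℝ | x ⬝ᵥ x = 1}))
  have key : ∃ δ : ℝ, 0 < δ ∧ ∀ t ∈ K, ∀ x : Fin g → ℝ, x ⬝ᵥ x = 1 → δ ≤ φ t x := by
    by_cases hne : (K ×ˢ {x : Fin g → ℝ | x ⬝ᵥ x = 1}).Nonempty
    · obtain ⟨p, hp, hmin⟩ := hcomp.exists_isMinOn hne hc'
      refine ⟨φ p.1 p.2, hpos _ hp.1 _ ?_, fun t ht x hx => hmin (Set.mk_mem_prod ht hx)⟩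
      rintro h0
      have : p.2 ⬝ᵥ p.2 = 1 := hp.2
      simp [h0] at this
    · exact ⟨1, one_pos, fun t ht x hx => absurd ⟨(t, x), Set.mk_mem_prod ht hx⟩ hne⟩
  obtain ⟨δ, hδ, h⟩ := key
  refine ⟨δ, hδ, fun t ht x => ?_⟩
  by_cases hx : x = 0
  · have := hhom t ht 0 0
    simp only [zero_smul, ne_eq, OfNat.ofNat_ne_zero, not_false_eq_true, zero_pow, zero_mul] at this
    simp [hx, this]
  · obtain ⟨y, hy, hxy⟩ := exists_smul_sphere hx
    have h1 := h t ht y hy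
    have h2 := hhom t ht (Real.sqrt (x ⬝ᵥ x)) y
    rw [← hxy, Real.sq_sqrt (dotProduct_self_nonneg' x)] at h2
    rw [h2]
    nlinarith [dotProduct_self_nonneg' x]

lemma exists_le_mul_of_homogeneous {T : Type*} [TopologicalSpace T] {K : Set T}
    (hK : IsCompact K) {φ : T → (Fin g → ℝ) → ℝ}
    (hcont : ContinuousOn (fun p : T × (Fin g → ℝ) => φ p.1 p.2) (K ×ˢ Set.univ))
    (hhom : ∀ t ∈ K, ∀ (r : ℝ) (x : Fin g → ℝ), φ t (r • x) = r ^ 2 * φ t x) :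
    ∃ R : ℝ, 0 < R ∧ ∀ t ∈ K, ∀ x : Fin g → ℝ, φ t x ≤ R * (x ⬝ᵥ x) := by
  have hcomp := hK.prod (isCompact_dotProduct_sphere (g := g))
  have hc' := hcont.mono (Set.prod_mono_right (s := K)
    (Set.subset_univ {x : Fin g → ℝ | x ⬝ᵥ x = 1}))
  obtain ⟨R, hR⟩ := hcomp.exists_bound_of_continuousOn hc'
  refine ⟨|R| + 1, by positivity, fun t ht x => ?_⟩
  by_cases hx : x = 0
  · have := hhom t ht 0 0
    simp only [zero_smul, ne_eq, OfNat.ofNat_ne_zero, not_false_eq_true, zero_pow, zero_mul] at this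
    simp [hx, this]
  · obtain ⟨y, hy, hxy⟩ := exists_smul_sphere hx
    have h1 := hR (t, y) (Set.mk_mem_prod ht hy)
    have h2 := hhom t ht (Real.sqrt (x ⬝ᵥ x)) y
    rw [← hxy, Real.sq_sqrt (dotProduct_self_nonneg' x)] at h2
    rw [h2, mul_comm]
    refine mul_le_mul_of_nonneg_right ?_ (dotProduct_self_nonneg' x)
    have := le_abs_self (φ t y)
    rw [Real.norm_eq_abs] at h1
    linarith [le_abs_self R]

/-- For entire `f` the incomplete Gaussian transform is a primitive of `f(u) e^{-πu²}`. -/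
lemma hasDerivAt_incGauss {f : ℂ → ℂ} (hf : Differentiable ℂ f) (α : ℂ) :
    HasDerivAt (incGauss f) (f α * Complex.exp (-Real.pi * α ^ 2)) α := by
  set h : ℂ → ℂ := fun u => f u * Complex.exp (-Real.pi * u ^ 2) with hh
  have hd : Differentiable ℂ h := by fun_prop
  obtain ⟨H, hH⟩ := hd.differentiableOn.isExactOn_ball (c := (0 : ℂ)) (r := ‖α‖ + 1)
  have hα : α ∈ Metric.ball (0 : ℂ) (‖α‖ + 1) := by simp
  have e : ∀ β ∈ Metric.ball (0 : ℂ) (‖α‖ + 1), incGauss f β = H β - H 0 := by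
    intro β hβ
    have hseg : ∀ t ∈ Set.uIcc (0 : ℝ) 1,
        HasDerivAt (fun t : ℝ => H (t * β)) (β * h (t * β)) t := by
      intro t ht
      rw [Set.uIcc_of_le zero_le_one] at ht
      have hm : (t : ℂ) * β ∈ Metric.ball (0 : ℂ) (‖α‖ + 1) := by
        rw [mem_ball_zero_iff] at hβ ⊢
        rw [norm_mul, Complex.norm_real, Real.norm_eq_abs, abs_of_nonneg ht.1]
        nlinarith [norm_nonneg β, ht.2]
      have h1 : HasDerivAt (fun t : ℝ => (t : ℂ) * β) β t := by
        simpa using (Complex.ofRealCLM.hasDerivAt (x := t)).mul_const β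
      have := (hH _ hm).comp t h1
      rwa [mul_comm] at this
    have hint := intervalIntegral.integral_eq_sub_of_hasDerivAt hseg
      (Continuous.intervalIntegrable (by
        have := hd.continuous
        fun_prop) _ _)
    simp only [Complex.ofReal_one, one_mul, Complex.ofReal_zero, zero_mul] at hint
    rw [← hint, intervalIntegral.integral_const_mul]
    rfl
  refine ((hH α hα).sub_const (H 0)).congr_of_eventuallyEq ?_
  exact Filter.eventually_of_mem (Metric.isOpen_ball.mem_nhds hα) e

lemma incGauss_ofReal (f : ℂ → ℂ) (a : ℝ) :
    incGauss f a = ∫ u in (0 : ℝ)..a, f u * Complex.exp (-Real.pi * (u : ℂ) ^ 2) := by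
  have := intervalIntegral.smul_integral_comp_mul_right
    (fun u : ℝ => f u * Complex.exp (-Real.pi * (u : ℂ) ^ 2)) (a := 0) (b := 1) a
  simp only [zero_mul, one_mul, Complex.ofReal_mul, Complex.real_smul] at this
  exact this

/-- The incomplete Gaussian transform along a segment, for an entire function or, between real
points, for a function continuous on the real line. -/
lemma hasDerivAt_incGauss_segment {f : ℂ → ℂ} {α β : ℂ}
    (h : Differentiable ℂ f ∨ (Continuous (fun x : ℝ => f x) ∧ α.im = 0 ∧ β.im = 0)) (t : ℝ) :
    HasDerivAt (fun t : ℝ => incGauss f (α + t * (β - α)))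
      (f (α + t * (β - α)) * Complex.exp (-Real.pi * (α + t * (β - α)) ^ 2) * (β - α)) t := by
  rcases h with h | ⟨hf, hα, hβ⟩
  · have h1 : HasDerivAt (fun t : ℝ => α + (t : ℂ) * (β - α)) (β - α) t := by
      simpa using ((Complex.ofRealCLM.hasDerivAt (x := t)).mul_const (β - α)).const_add α
    exact (hasDerivAt_incGauss h _).comp t h1
  · obtain ⟨a, rfl⟩ : ∃ a : ℝ, (a : ℂ) = α := ⟨α.re, Complex.ext (by simp) (by simp [hα])⟩
    obtain ⟨b, rfl⟩ : ∃ b : ℝ, (b : ℂ) = β := ⟨β.re, Complex.ext (by simp) (by simp [hβ])⟩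
    have hc : Continuous fun u : ℝ => f u * Complex.exp (-Real.pi * (u : ℂ) ^ 2) :=
      hf.mul (by fun_prop)
    have h1 : HasDerivAt (fun t : ℝ => a + t * (b - a)) (b - a) t := by
      simpa using ((hasDerivAt_id t).mul_const (b - a)).const_add a
    have h2 := (intervalIntegral.integral_hasDerivAt_right
      (hc.intervalIntegrable 0 (a + t * (b - a)))
      (hc.stronglyMeasurableAtFilter _ _) hc.continuousAt).scomp t h1
    have e : (fun t : ℝ => incGauss f (a + t * (b - a))) =
        (fun y : ℝ => ∫ u in (0 : ℝ)..y, f u * Complex.exp (-Real.pi * (u : ℂ) ^ 2)) ∘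
          (fun t : ℝ => a + t * (b - a)) := by
      ext s
      simp only [Function.comp, ← incGauss_ofReal]
      push_cast
      rfl
    rw [e]
    refine h2.congr_deriv ?_
    simp only [Complex.real_smul]
    push_cast
    ring

lemma norm_exp_neg_pi_sq (w : ℂ) :
    ‖Complex.exp (-Real.pi * w ^ 2)‖ = Real.exp (-Real.pi * (w ^ 2).re) := by
  rw [Complex.norm_exp, ← Complex.ofReal_neg, Complex.re_ofReal_mul]

/-- Integrating along the ray from the origin. -/
lemma norm_incGauss_le {f : ℂ → ℂ} {α : ℂ} {B : ℝ}
    (hB : ∀ t ∈ Set.Icc (0 : ℝ) 1, ‖f (t * α)‖ ≤ B) :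
    ‖incGauss f α‖ ≤ ‖α‖ * (B * Real.exp (Real.pi * max 0 (-(α ^ 2).re))) := by
  unfold incGauss
  rw [norm_mul]
  refine mul_le_mul_of_nonneg_left ?_ (norm_nonneg _)
  have := intervalIntegral.norm_integral_le_of_norm_le_const (a := (0 : ℝ)) (b := 1)
    (f := fun t : ℝ => f (t * α) * Complex.exp (-Real.pi * (t * α) ^ 2))
    (C := B * Real.exp (Real.pi * max 0 (-(α ^ 2).re))) (fun t ht => ?_)
  · simpa using this
  · rw [Set.uIoc_of_le zero_le_one] at ht
    rw [norm_mul, norm_exp_neg_pi_sq]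
    have hB0 := hB t ⟨ht.1.le, ht.2⟩
    refine mul_le_mul hB0 ?_ (Real.exp_pos _).le ((norm_nonneg _).trans hB0)
    rw [Real.exp_le_exp, neg_mul, ← mul_neg]
    refine mul_le_mul_of_nonneg_left ?_ Real.pi_pos.le
    rw [mul_pow, ← Complex.ofReal_pow, Complex.re_ofReal_mul]
    rcases le_or_gt 0 (α ^ 2).re with h | h
    · exact le_max_of_le_left (by nlinarith [sq_nonneg t])
    · refine le_max_of_le_right ?_
      have : t ^ 2 ≤ 1 := by nlinarith [ht.1, ht.2]
      nlinarith

/-- The regions `{Re w² ≥ K, Re w > 0}` with `K ≥ 0` are convex. -/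
lemma le_re_sq_segment {α β : ℂ} {K : ℝ} (hK : 0 ≤ K) (hre : 0 < α.re * β.re)
    (hα : K ≤ (α ^ 2).re) (hβ : K ≤ (β ^ 2).re) {t : ℝ} (ht : t ∈ Set.Icc (0 : ℝ) 1) :
    K ≤ ((α + t * (β - α)) ^ 2).re := by
  simp only [sq, Complex.mul_re] at hα hβ ⊢
  simp only [Complex.add_re, Complex.add_im, Complex.re_ofReal_mul, Complex.im_ofReal_mul,
    Complex.sub_re, Complex.sub_im]
  generalize α.re = p at *
  generalize α.im = q at *
  generalize β.re = r at *
  generalize β.im = s at *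
  -- the reversed Cauchy–Schwarz inequality `p r - q s ≥ K` on the two vectors
  have hcs : K ≤ p * r - q * s := by
    have h1 : (K + q * s) ^ 2 ≤ (p * r) ^ 2 := by
      have : (K + q * s) ^ 2 ≤ (K + q ^ 2) * (K + s ^ 2) := by
        nlinarith [mul_nonneg hK (sq_nonneg (q - s))]
      have h2 : (K + q ^ 2) * (K + s ^ 2) ≤ (p * p) * (r * r) :=
        mul_le_mul (by nlinarith) (by nlinarith) (by positivity) (mul_self_nonneg p)
      nlinarith
    have := abs_le_of_sq_le_sq h1 hre.le
    linarith [le_abs_self (K + q * s)]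
  obtain ⟨u, hu⟩ : ∃ u, u = 1 - t := ⟨_, rfl⟩
  have hu0 : 0 ≤ u := by linarith [ht.2]
  have e : (p + t * (r - p)) * (p + t * (r - p)) - (q + t * (s - q)) * (q + t * (s - q)) =
      u ^ 2 * (p * p - q * q) + 2 * (u * t) * (p * r - q * s) + t ^ 2 * (r * r - s * s) := by
    rw [hu]; ring
  rw [e]
  have h1 : K = u ^ 2 * K + 2 * (u * t) * K + t ^ 2 * K := by rw [hu]; ring
  nlinarith [mul_le_mul_of_nonneg_left hα (sq_nonneg u),
    mul_le_mul_of_nonneg_left hcs (mul_nonneg hu0 ht.1),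
    mul_le_mul_of_nonneg_left hβ (sq_nonneg t)]

/-- Integrating along the segment between two points in the same region `{Re w² ≥ K}`. -/
lemma norm_incGauss_sub_le {f : ℂ → ℂ} {α β : ℂ} {K B : ℝ} (hK : 0 ≤ K)
    (hre : 0 < α.re * β.re) (hα : K ≤ (α ^ 2).re) (hβ : K ≤ (β ^ 2).re)
    (h : Differentiable ℂ f ∨ (Continuous (fun x : ℝ => f x) ∧ α.im = 0 ∧ β.im = 0))
    (hB : ∀ t ∈ Set.Icc (0 : ℝ) 1, ‖f (α + t * (β - α))‖ ≤ B) :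
    ‖incGauss f β - incGauss f α‖ ≤ B * Real.exp (-Real.pi * K) * ‖β - α‖ := by
  have := norm_image_sub_le_of_norm_deriv_le_segment_01' (E := ℂ)
    (f := fun t : ℝ => incGauss f (α + t * (β - α)))
    (f' := fun t : ℝ => f (α + t * (β - α)) * Complex.exp (-Real.pi * (α + t * (β - α)) ^ 2) *
      (β - α)) (C := B * Real.exp (-Real.pi * K) * ‖β - α‖)
    (fun t _ => (hasDerivAt_incGauss_segment h t).hasDerivWithinAt) (fun t ht => ?_)
  · simpa using this
  · have ht' := Set.Ico_subset_Icc_self ht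
    rw [norm_mul, norm_mul, norm_exp_neg_pi_sq]
    refine mul_le_mul_of_nonneg_right ?_ (norm_nonneg _)
    have hB0 := hB t ht'
    refine mul_le_mul hB0 ?_ (Real.exp_pos _).le ((norm_nonneg _).trans hB0)
    rw [Real.exp_le_exp]
    nlinarith [Real.pi_pos, le_re_sq_segment hK hre hα hβ ht']

/-- A continuous function with growth `e^{ε|x|²}` near infinity has it everywhere, up to a
constant. -/
lemma exists_growth_bound {E : Type*} [NormedAddCommGroup E] [ProperSpace E] {f : E → ℂ}
    (hf : Continuous f) {ε : ℝ} (hε : 0 < ε)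
    (h : ∀ᶠ x in Filter.cocompact E, ‖f x‖ ≤ Real.exp (ε * ‖x‖ ^ 2)) :
    ∃ C : ℝ, 0 ≤ C ∧ ∀ x, ‖f x‖ ≤ C * Real.exp (ε * ‖x‖ ^ 2) := by
  rw [Filter.eventually_iff, Filter.mem_cocompact] at h
  obtain ⟨K, hK, hKs⟩ := h
  obtain ⟨C, hC⟩ := hK.exists_bound_of_continuousOn hf.continuousOn
  refine ⟨max C 1, by positivity, fun x => ?_⟩
  have h1 : 1 ≤ Real.exp (ε * ‖x‖ ^ 2) := Real.one_le_exp (by positivity)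
  by_cases hx : x ∈ K
  · exact (hC x hx).trans ((le_max_left C 1).trans (le_mul_of_one_le_right (by positivity) h1))
  · exact (hKs hx : ‖f x‖ ≤ _).trans (le_mul_of_one_le_left (by positivity) (le_max_right C 1))

end

/-! ### Gaussian decay of the summands -/

section

variable {g : ℕ}

/-- The Gaussian `e(½ xᵀ Ω x)` on `ℝ^g`. -/
noncomputable def gauss (Ω : Matrix (Fin g) (Fin g) ℂ) (x : Fin g → ℝ) : ℂ :=
  e (1 / 2 * (realVec x ⬝ᵥ (Ω *ᵥ realVec x)))

/-- The function on `ℝ^g` whose values on a translate of `ℤ^g` are, up to a character, the terms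
of the indefinite theta series. -/
noncomputable def kern (v : Fin g → ℝ) (f : ℂ → ℂ) (c₁ c₂ : Fin g → ℂ)
    (Ω : Matrix (Fin g) (Fin g) ℂ) (x : Fin g → ℝ) : ℂ :=
  (incGauss f (alpha (imPart Ω) v c₂ x) - incGauss f (alpha (imPart Ω) v c₁ x)) * gauss Ω x

lemma e_add (a b : ℂ) : e (a + b) = e a * e b := by
  unfold e; rw [mul_add, Complex.exp_add]

lemma e_int (k : ℤ) : e k = 1 := by
  unfold e
  rw [mul_comm]
  exact Complex.exp_int_mul_two_pi_mul_I k

lemma norm_e (w : ℂ) : ‖e w‖ = Real.exp (-(2 * Real.pi * w.im)) := by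
  unfold e
  rw [Complex.norm_exp]
  congr 1
  have : (2 * Real.pi * Complex.I * w) = ((2 * Real.pi : ℝ) : ℂ) * (Complex.I * w) := by
    push_cast; ring
  rw [this, Complex.re_ofReal_mul, Complex.I_mul_re]
  ring

lemma im_dotProduct_mulVec (Ω : Matrix (Fin g) (Fin g) ℂ) (x y : Fin g → ℝ) :
    (realVec x ⬝ᵥ (Ω *ᵥ realVec y)).im = x ⬝ᵥ (imPart Ω *ᵥ y) := by
  simp [dotProduct, mulVec, realVec, imPart, Complex.im_sum]

lemma norm_gauss (Ω : Matrix (Fin g) (Fin g) ℂ) (x : Fin g → ℝ) :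
    ‖gauss Ω x‖ = Real.exp (-Real.pi * (x ⬝ᵥ (imPart Ω *ᵥ x))) := by
  unfold gauss
  rw [norm_e]
  congr 1
  have : (1 / 2 * (realVec x ⬝ᵥ (Ω *ᵥ realVec x))).im = 1 / 2 * (x ⬝ᵥ (imPart Ω *ᵥ x)) := by
    rw [← im_dotProduct_mulVec, show (1 / 2 : ℂ) = ((1 / 2 : ℝ) : ℂ) by norm_num,
      Complex.im_ofReal_mul]
  rw [this]
  ring

lemma alpha_smul_right (M : Matrix (Fin g) (Fin g) ℝ) (v : Fin g → ℝ) (c : Fin g → ℂ) (r : ℝ)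
    (x : Fin g → ℝ) : alpha M v c (r • x) = r * alpha M v c x := by
  have : realVec (r • x) = (r : ℂ) • realVec x := by ext i; simp [realVec]
  unfold alpha
  rw [this, bil_smul_right, mul_div_assoc]

variable {M : Matrix (Fin g) (Fin g) ℝ} {v : Fin g → ℝ}

lemma alpha_im_eq_zero (hM : Lorentzian M) (hv : v ∈ negReal M) {c : Fin g → ℂ}
    (hc : c ∈ negRegion M) (hreal : ∀ i, (c i).im = 0) (x : Fin g → ℝ) :
    (alpha M v c x).im = 0 := by
  have hcr : c = realVec (reVec c) := by
    ext i
    exact Complex.ext rfl (by simpa [realVec] using hreal i)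
  have hn : reVec c ⬝ᵥ (M *ᵥ reVec c) < 0 := by
    have h : (bil M (star c) c).re < 0 := hc
    rw [bil_star_self_re, show imVec c = 0 from funext hreal] at h
    simpa using h
  have hs := sqrtHalfNeg_sq hM hv hc
  rw [hcr, bil_realVec, ← hcr] at hs
  have him := congrArg Complex.im hs
  have hre := congrArg Complex.re hs
  rw [show (-(1 / 2) : ℂ) = ((-(1 / 2) : ℝ) : ℂ) by norm_num, ← Complex.ofReal_mul, sq] at him hre
  simp only [Complex.mul_im, Complex.mul_re, Complex.ofReal_im, Complex.ofReal_re] at him hre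
  have hsi : (sqrtHalfNeg M v c).im = 0 := by
    have h : (sqrtHalfNeg M v c).re * (sqrtHalfNeg M v c).im = 0 := by linarith
    rcases mul_eq_zero.1 h with h | h
    · rw [h] at hre
      nlinarith [mul_self_nonneg (sqrtHalfNeg M v c).im]
    · exact h
  unfold alpha
  rw [hcr, bil_realVec, ← hcr,
    show sqrtHalfNeg M v c = ((sqrtHalfNeg M v c).re : ℂ) from Complex.ext rfl (by simp [hsi]),
    ← Complex.ofReal_div, Complex.ofReal_im]

/-- The two kinds of admissible functions in a common form: the arguments lie in a real subspace
`S` of `ℂ` (all of `ℂ`, or the real line) on which the growth condition holds. -/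
lemma IsTestFunction.exists_submodule (hM : Lorentzian M) (hv : v ∈ negReal M)
    {c₁ c₂ : Fin g → ℂ} (hc₁ : c₁ ∈ negRegion M) (hc₂ : c₂ ∈ negRegion M) {f : ℂ → ℂ}
    (hf : IsTestFunction f c₁ c₂) :
    ∃ S : Submodule ℝ ℂ, (∀ x, alpha M v c₁ x ∈ S ∧ alpha M v c₂ x ∈ S) ∧
      (∀ ε : ℝ, 0 < ε → ∃ C : ℝ, 0 ≤ C ∧ ∀ ξ ∈ S, ‖f ξ‖ ≤ C * Real.exp (ε * ‖ξ‖ ^ 2)) ∧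
      ∀ α ∈ S, ∀ β ∈ S,
        Differentiable ℂ f ∨ (Continuous (fun x : ℝ => f x) ∧ α.im = 0 ∧ β.im = 0) := by
  rcases hf with ⟨hd, hg⟩ | ⟨h1, h2, hcont, hg⟩
  · refine ⟨⊤, fun x => ⟨trivial, trivial⟩, fun ε hε => ?_, fun α _ β _ => Or.inl hd⟩
    obtain ⟨C, hC0, hC⟩ := exists_growth_bound hd.continuous hε (hg ε hε)
    exact ⟨C, hC0, fun ξ _ => hC ξ⟩
  · refine ⟨LinearMap.ker Complex.imLm, fun x => ⟨alpha_im_eq_zero hM hv hc₁ h1 x,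
      alpha_im_eq_zero hM hv hc₂ h2 x⟩, fun ε hε => ?_, fun α hα β hβ => Or.inr ⟨hcont, hα, hβ⟩⟩
    obtain ⟨C, hC0, hC⟩ := exists_growth_bound hcont hε
      (by simpa [Real.norm_eq_abs, sq_abs] using hg ε hε)
    refine ⟨C, hC0, fun ξ hξ => ?_⟩
    have hξ' : ξ.im = 0 := hξ
    have : ((ξ.re : ℝ) : ℂ) = ξ := Complex.ext rfl (by simp [hξ'])
    have h := hC ξ.re
    rwa [this, ← Complex.norm_real, this] at h

lemma continuous_dotProduct_mulVec (M : Matrix (Fin g) (Fin g) ℝ) :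
    Continuous fun x : Fin g → ℝ => x ⬝ᵥ (M *ᵥ x) := by
  unfold mulVec dotProduct; fun_prop

/-- Gaussian decay of the summands. Where `xᵀMx` is large the two incomplete Gaussian transforms
are estimated separately, along rays; elsewhere `Re α_{c₁}` and `Re α_{c₂}` have the same sign
and the difference is estimated along the segment between the two arguments. -/
lemma exists_norm_kern_le {Ω : Matrix (Fin g) (Fin g) ℂ} (hM : Lorentzian (imPart Ω))
    (hv : v ∈ negReal (imPart Ω)) {c₁ c₂ : Fin g → ℂ} (hc₁ : c₁ ∈ negRegion (imPart Ω))
    (hc₂ : c₂ ∈ negRegion (imPart Ω)) {f : ℂ → ℂ} (hf : IsTestFunction f c₁ c₂) :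
    ∃ C δ : ℝ, 0 < δ ∧ ∀ x, ‖kern v f c₁ c₂ Ω x‖ ≤ C * Real.exp (-δ * (x ⬝ᵥ x)) := by
  obtain ⟨S, hS, hgrow, hcase⟩ := hf.exists_submodule hM hv hc₁ hc₂
  set M := imPart Ω with hMdef
  have hK : IsCompact ({c₁, c₂} : Set (Fin g → ℂ)) := (Set.toFinite _).isCompact
  have hKR : ({c₁, c₂} : Set (Fin g → ℂ)) ⊆ negRegion M := by
    rintro c (rfl | rfl) <;> assumption
  have hα : ContinuousOn (fun p : (Fin g → ℂ) × (Fin g → ℝ) => alpha M v p.1 p.2)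
      (({c₁, c₂} : Set (Fin g → ℂ)) ×ˢ Set.univ) :=
    (continuousOn_alpha hM hv).mono (Set.prod_mono_left hKR)
  have hα' : ∀ c ∈ negRegion M, Continuous (alpha M v c) := fun c hc =>
    continuousOn_univ.1 ((continuousOn_alpha hM hv).comp (f := fun x => (c, x)) (by fun_prop)
      fun x _ => ⟨hc, trivial⟩)
  have hMc := continuous_dotProduct_mulVec M
  have hMhom : ∀ (r : ℝ) (x : Fin g → ℝ), (r • x) ⬝ᵥ (M *ᵥ (r • x)) = r ^ 2 * (x ⬝ᵥ (M *ᵥ x)) := by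
    intro r x
    simp only [mulVec_smul, dotProduct_smul, smul_dotProduct, smul_eq_mul]
    ring
  obtain ⟨δ₁, hδ₁, h₁⟩ := exists_pos_mul_le_of_homogeneous hK
    (φ := fun c x => x ⬝ᵥ (M *ᵥ x) + (alpha M v c x ^ 2).re)
    ((hMc.comp continuous_snd).continuousOn.add
      (Complex.continuous_re.comp_continuousOn (hα.pow 2)))
    (fun c _ r x => by
      rw [hMhom, alpha_smul_right, mul_pow, ← Complex.ofReal_pow, Complex.re_ofReal_mul]; ring)
    (fun c hc x hx => add_alpha_sq_pos hM hv (hKR hc) hx)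
  -- in every direction either `xᵀMx` is positive or the two real parts have the same sign
  obtain ⟨δ₂, hδ₂, h₂⟩ := exists_pos_mul_le_of_homogeneous (isCompact_singleton (x := ()))
    (φ := fun _ x => max (x ⬝ᵥ (M *ᵥ x)) ((alpha M v c₁ x).re * (alpha M v c₂ x).re))
    (((hMc.comp continuous_snd).max
      ((Complex.continuous_re.comp ((hα' _ hc₁).comp continuous_snd)).mul
      (Complex.continuous_re.comp ((hα' _ hc₂).comp continuous_snd)))).continuousOn)
    (fun _ _ r x => by
      rw [hMhom, alpha_smul_right, alpha_smul_right, Complex.re_ofReal_mul, Complex.re_ofReal_mul,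
        mul_max_of_nonneg _ _ (sq_nonneg r)]
      congr 1; ring)
    (fun _ _ x hx => by
      rcases lt_or_ge 0 (x ⬝ᵥ (M *ᵥ x)) with h | h
      · exact lt_max_of_lt_left h
      · exact lt_max_of_lt_right (alpha_re_mul_pos hM hv hc₁ hc₂ hx h))
  obtain ⟨R, hR, h₃⟩ := exists_le_mul_of_homogeneous hK
    (φ := fun c x => ‖alpha M v c x‖ ^ 2) (hα.norm.pow 2)
    (fun c _ r x => by rw [alpha_smul_right, norm_mul, mul_pow, Complex.norm_real,
      Real.norm_eq_abs, sq_abs])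
  set δ := min δ₁ δ₂ with hδdef
  have hδ : 0 < δ := lt_min hδ₁ hδ₂
  -- with this rate of growth `|f|` is at most `C e^{δ|x|²}` on arguments with `|ξ|² ≤ R|x|²`
  obtain ⟨C, hC0, hC⟩ := hgrow (δ / R) (div_pos hδ hR)
  refine ⟨C * (2 * (1 + R / δ)), δ, hδ, fun x => ?_⟩
  obtain ⟨N, hN⟩ : ∃ N, N = x ⬝ᵥ x := ⟨_, rfl⟩
  have hN0 : 0 ≤ N := hN ▸ dotProduct_self_nonneg' x
  have hmem := hS x
  have a₁ := h₁ c₁ (by simp) x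
  have a₂ := h₁ c₂ (by simp) x
  have b := h₂ () rfl x
  have r₁ := h₃ c₁ (by simp) x
  have r₂ := h₃ c₂ (by simp) x
  simp only [← hN] at a₁ a₂ b r₁ r₂ ⊢
  unfold kern
  rw [norm_mul, norm_gauss, ← hMdef]
  set α := alpha M v c₁ x
  set β := alpha M v c₂ x
  obtain ⟨q, hq⟩ : ∃ q, q = x ⬝ᵥ (M *ᵥ x) := ⟨_, rfl⟩
  rw [← hq] at a₁ a₂ b ⊢
  have a₁' : δ * N ≤ q + (α ^ 2).re :=
    (mul_le_mul_of_nonneg_right (min_le_left _ _) hN0).trans a₁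
  have a₂' : δ * N ≤ q + (β ^ 2).re :=
    (mul_le_mul_of_nonneg_right (min_le_left _ _) hN0).trans a₂
  have b' : δ * N ≤ max q (α.re * β.re) :=
    (mul_le_mul_of_nonneg_right (min_le_right _ _) hN0).trans b
  set B := C * Real.exp (δ * N) with hB
  have hB0 : 0 ≤ B := by positivity
  have hfB : ∀ ξ ∈ S, ‖ξ‖ ^ 2 ≤ R * N → ‖f ξ‖ ≤ B := by
    intro ξ hξ hle
    refine (hC ξ hξ).trans (mul_le_mul_of_nonneg_left (Real.exp_le_exp.2 ?_) hC0)
    calc δ / R * ‖ξ‖ ^ 2 ≤ δ / R * (R * N) := mul_le_mul_of_nonneg_left hle (div_pos hδ hR).le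
      _ = δ * N := by field_simp
  have hnorm : ∀ ξ : ℂ, ‖ξ‖ ^ 2 ≤ R * N → ‖ξ‖ ≤ 1 + R * N := by
    intro ξ h
    nlinarith [sq_nonneg (‖ξ‖ - 1), norm_nonneg ξ]
  -- as `π > 3`, the factor `e^{-πδN}` absorbs one `e^{δN}` from `B`, another one from `‖α‖ + ‖β‖`,
  -- and still leaves the decay `e^{-δN}`
  suffices h : ‖incGauss f β - incGauss f α‖ * Real.exp (-Real.pi * q) ≤
      (‖α‖ + ‖β‖) * B * Real.exp (-Real.pi * (δ * N)) by
    refine h.trans ?_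
    have e1 : Real.exp (-Real.pi * (δ * N)) ≤ Real.exp (-3 * (δ * N)) := by
      rw [Real.exp_le_exp]
      nlinarith [Real.pi_gt_three, mul_nonneg hδ.le hN0]
    have e2 : 1 + R * N ≤ (1 + R / δ) * Real.exp (δ * N) := by
      have := Real.add_one_le_exp (δ * N)
      have h1 : R * N = R / δ * (δ * N) := by field_simp
      have h2 : 0 < R / δ := div_pos hR hδ
      have h3 : 0 ≤ δ * N := mul_nonneg hδ.le hN0
      nlinarith
    have e3 : Real.exp (-3 * (δ * N)) * Real.exp (δ * N) * Real.exp (δ * N) =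
        Real.exp (-δ * N) := by
      rw [← Real.exp_add, ← Real.exp_add]; congr 1; ring
    calc (‖α‖ + ‖β‖) * B * Real.exp (-Real.pi * (δ * N))
        ≤ (2 * ((1 + R / δ) * Real.exp (δ * N))) * B * Real.exp (-3 * (δ * N)) := by
          have := hnorm α r₁
          have := hnorm β r₂
          gcongr
          linarith
      _ = C * (2 * (1 + R / δ)) *
          (Real.exp (-3 * (δ * N)) * Real.exp (δ * N) * Real.exp (δ * N)) := by rw [hB]; ring
      _ = _ := by rw [e3]
  have ray : ∀ ξ ∈ S, ‖ξ‖ ^ 2 ≤ R * N → δ * N ≤ q + (ξ ^ 2).re → δ * N ≤ q →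
      ‖incGauss f ξ‖ * Real.exp (-Real.pi * q) ≤ ‖ξ‖ * B * Real.exp (-Real.pi * (δ * N)) := by
    intro ξ hξ hle h1 h2
    have h := norm_incGauss_le (f := f) (α := ξ) (B := B) fun t ht => by
      refine hfB _ ?_ ?_
      · have := S.smul_mem t hξ
        rwa [Complex.real_smul] at this
      · rw [norm_mul, mul_pow, Complex.norm_real, Real.norm_eq_abs, sq_abs]
        refine le_trans ?_ hle
        have : t ^ 2 ≤ 1 := by nlinarith [ht.1, ht.2]
        nlinarith [sq_nonneg ‖ξ‖]
    calc ‖incGauss f ξ‖ * Real.exp (-Real.pi * q)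
        ≤ ‖ξ‖ * (B * Real.exp (Real.pi * max 0 (-(ξ ^ 2).re))) * Real.exp (-Real.pi * q) := by
          gcongr
      _ = ‖ξ‖ * B * Real.exp (Real.pi * max 0 (-(ξ ^ 2).re) + -Real.pi * q) := by
          rw [Real.exp_add]; ring
      _ ≤ _ := by
          refine mul_le_mul_of_nonneg_left (Real.exp_le_exp.2 ?_) (by positivity)
          have : max 0 (-(ξ ^ 2).re) ≤ q - δ * N := max_le (by linarith) (by linarith)
          nlinarith [Real.pi_pos]
  -- for `δN ≤ q` the two transforms are estimated separately, otherwise along a segment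
  by_cases hA : δ * N ≤ q
  · have i1 := ray α hmem.1 r₁ a₁' hA
    have i2 := ray β hmem.2 r₂ a₂' hA
    calc ‖incGauss f β - incGauss f α‖ * Real.exp (-Real.pi * q)
        ≤ (‖incGauss f β‖ + ‖incGauss f α‖) * Real.exp (-Real.pi * q) := by
          gcongr; exact norm_sub_le _ _
      _ ≤ _ := by linarith
  · have hqlt : q < δ * N := not_le.1 hA
    have hre : 0 < α.re * β.re := by
      rcases le_max_iff.1 b' with h | h
      · exact absurd h hA
      · refine lt_of_lt_of_le ?_ h
        refine lt_of_le_of_ne (mul_nonneg hδ.le hN0) fun h0 => ?_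
        have hx0 : x = 0 := by
          rcases mul_eq_zero.1 h0.symm with h | h
          · exact absurd h hδ.ne'
          · exact dotProduct_self_eq_zero.1 (hN ▸ h)
        rw [hx0] at hq
        simp only [mulVec_zero, dotProduct_zero] at hq
        linarith
    have hK0 : 0 ≤ δ * N - q := by linarith
    have h := norm_incGauss_sub_le (f := f) (B := B) hK0 hre (by linarith) (by linarith)
      (hcase α hmem.1 β hmem.2) fun t ht => by
        refine hfB _ ?_ ?_
        · have := S.add_mem hmem.1 (S.smul_mem t (S.sub_mem hmem.2 hmem.1))
          rwa [Complex.real_smul] at this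
        · have hs : ∀ ξ : ℂ, ‖ξ‖ ^ 2 ≤ R * N ↔ ‖ξ‖ ≤ Real.sqrt (R * N) := fun ξ => by
            rw [Real.le_sqrt (norm_nonneg _) (by positivity)]
          rw [hs] at r₁ r₂ ⊢
          have hcv := (convex_closedBall (0 : ℂ) (Real.sqrt (R * N)))
            (mem_closedBall_zero_iff.2 r₁) (mem_closedBall_zero_iff.2 r₂)
            (sub_nonneg.2 ht.2) ht.1 (by ring)
          rw [mem_closedBall_zero_iff, Complex.real_smul, Complex.real_smul] at hcv
          refine le_of_eq_of_le ?_ hcv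
          congr 1
          push_cast
          ring
    calc ‖incGauss f β - incGauss f α‖ * Real.exp (-Real.pi * q)
        ≤ (B * Real.exp (-Real.pi * (δ * N - q)) * ‖β - α‖) * Real.exp (-Real.pi * q) := by gcongr
      _ = ‖β - α‖ * B * Real.exp (-Real.pi * (δ * N)) := by
          rw [show -Real.pi * (δ * N) = -Real.pi * (δ * N - q) + -Real.pi * q by ring,
            Real.exp_add]
          ring
      _ ≤ _ := by
          gcongr
          rw [add_comm]
          exact norm_sub_le _ _

end

/-! ### Convergence, congruences and translations -/

section

variable {g : ℕ}

/-- An integer vector regarded as a real vector. -/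
def intReal (n : Fin g → ℤ) : Fin g → ℝ := fun i => (n i : ℝ)

lemma realVec_intReal (n : Fin g → ℤ) : realVec (intReal n) = intVec n := by
  ext i; simp [realVec, intReal, intVec]

lemma realVec_add (x y : Fin g → ℝ) : realVec (x + y) = realVec x + realVec y := by
  ext i; simp [realVec]

lemma realMat_mulVec_realVec (M : Matrix (Fin g) (Fin g) ℝ) (x : Fin g → ℝ) :
    realMat M *ᵥ realVec x = realVec (M *ᵥ x) := by
  ext i; simp [realMat, mulVec, dotProduct, realVec]

lemma summable_prod_apply {h : ℤ → ℝ} (h0 : ∀ k, 0 ≤ h k) (hs : Summable h) :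
    ∀ g : ℕ, Summable fun n : Fin g → ℤ => ∏ i, h (n i)
  | 0 => (hasSum_fintype _).summable
  | g + 1 => by
    rw [← (Fin.consEquiv fun _ : Fin (g + 1) => ℤ).summable_iff]
    have := hs.mul_of_nonneg (summable_prod_apply h0 hs g) h0
      fun n => Finset.prod_nonneg fun i _ => h0 (n i)
    refine this.congr fun p => ?_
    simp [Fin.prod_univ_succ, Fin.consEquiv]

lemma summable_exp_neg_mul_sq {δ : ℝ} (hδ : 0 < δ) :
    Summable fun k : ℤ => Real.exp (-δ * (k : ℝ) ^ 2) := by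
  have hn : Summable fun k : ℕ => Real.exp (-δ * (k : ℝ) ^ 2) := by
    refine Summable.of_nonneg_of_le (fun _ => (Real.exp_pos _).le) (fun k => ?_)
      (Real.summable_exp_nat_mul_iff.2 (neg_lt_zero.2 hδ))
    rw [Real.exp_le_exp]
    have : (k : ℝ) ≤ (k : ℝ) ^ 2 := by exact_mod_cast Nat.le_self_pow (by norm_num) k
    nlinarith
  exact Summable.of_nat_of_neg (by simpa using hn) (by simpa using hn)

lemma summable_exp_neg_dotProduct (g : ℕ) {δ : ℝ} (hδ : 0 < δ) :
    Summable fun n : Fin g → ℤ => Real.exp (-δ * (intReal n ⬝ᵥ intReal n)) := by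
  refine (summable_prod_apply (fun _ => (Real.exp_pos _).le) (summable_exp_neg_mul_sq hδ) g).congr
    fun n => ?_
  rw [← Real.exp_sum, dotProduct, Finset.mul_sum]
  congr 1
  exact Finset.sum_congr rfl fun i _ => by rw [intReal]; ring

lemma dotProduct_add_self_ge (x y : Fin g → ℝ) :
    1 / 2 * (x ⬝ᵥ x) - y ⬝ᵥ y ≤ (x + y) ⬝ᵥ (x + y) := by
  unfold dotProduct
  rw [Finset.mul_sum, ← Finset.sum_sub_distrib]
  refine Finset.sum_le_sum fun i _ => ?_
  simp only [Pi.add_apply]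
  nlinarith [sq_nonneg (x i + 2 * y i)]

/-- A function with Gaussian decay is dominated on the translates of `ℤ^g` by vectors of bounded
length by one summable family. -/
lemma norm_translate_le {F : (Fin g → ℝ) → ℂ} {C δ : ℝ} (hδ : 0 < δ)
    (hF : ∀ x, ‖F x‖ ≤ C * Real.exp (-δ * (x ⬝ᵥ x))) {r : ℝ} {y : Fin g → ℝ} (hy : y ⬝ᵥ y ≤ r)
    (n : Fin g → ℤ) :
    ‖F (intReal n + y)‖ ≤ C * Real.exp (δ * r) *
      Real.exp (-(δ / 2) * (intReal n ⬝ᵥ intReal n)) := by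
  have hC : 0 ≤ C := by
    have := (norm_nonneg _).trans (hF 0)
    simpa using this
  refine (hF _).trans ?_
  rw [mul_assoc, ← Real.exp_add]
  refine mul_le_mul_of_nonneg_left (Real.exp_le_exp.2 ?_) hC
  nlinarith [dotProduct_add_self_ge (intReal n) y]

lemma summable_translate {F : (Fin g → ℝ) → ℂ} {C δ : ℝ} (hδ : 0 < δ)
    (hF : ∀ x, ‖F x‖ ≤ C * Real.exp (-δ * (x ⬝ᵥ x))) (y : Fin g → ℝ) :
    Summable fun n : Fin g → ℤ => F (intReal n + y) :=
  .of_norm_bounded ((summable_exp_neg_dotProduct g (half_pos hδ)).mul_left _)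
    (norm_translate_le hδ hF le_rfl)

lemma Lorentzian.exists_realVec_add {Ω : Matrix (Fin g) (Fin g) ℂ} {v : Fin g → ℝ}
    (hM : Lorentzian (imPart Ω)) (hv : v ∈ negReal (imPart Ω)) (z : Fin g → ℂ) :
    ∃ ζ b : Fin g → ℝ, z = realVec ζ + Ω *ᵥ realVec b := by
  have hdet := hM.det_ne_zero hv
  obtain ⟨b, hb⟩ : ∃ b, imPart Ω *ᵥ b = imVec z :=
    ⟨(imPart Ω)⁻¹ *ᵥ imVec z, by
      rw [mulVec_mulVec, mul_nonsing_inv _ (isUnit_iff_ne_zero.2 hdet), one_mulVec]⟩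
  refine ⟨reVec (z - Ω *ᵥ realVec b), b, ?_⟩
  ext i
  have him : ((Ω *ᵥ realVec b) i).im = (z i).im := by
    have := congrFun hb i
    rw [show (z i).im = imVec z i from rfl, ← this]
    simp [mulVec, dotProduct, realVec, imPart]
  apply Complex.ext
  · simp [realVec, reVec]
  · simp [realVec, him]

lemma realVec_dot_add (Ω : Matrix (Fin g) (Fin g) ℂ) (hΩ : Ω.IsSymm) (x y : Fin g → ℂ) :
    (x + y) ⬝ᵥ (Ω *ᵥ (x + y)) = x ⬝ᵥ (Ω *ᵥ x) + 2 * (x ⬝ᵥ (Ω *ᵥ y)) + y ⬝ᵥ (Ω *ᵥ y) := by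
  rw [mulVec_add, add_dotProduct, dotProduct_add, dotProduct_add, dotProduct_mulVec_symm hΩ y x]
  ring

/-- With `z = ζ + Ωb` for real `ζ`, `b`, completing the square turns the terms of the theta series
into the values of `kern` on `ℤ^g + b`, twisted by the character of `ζ`. -/
lemma thetaTerm_eq_kern {Ω : Matrix (Fin g) (Fin g) ℂ} (hΩ : Ω.IsSymm) (v : Fin g → ℝ)
    (f : ℂ → ℂ) (c₁ c₂ : Fin g → ℂ) (ζ b : Fin g → ℝ) (n : Fin g → ℤ) :
    thetaTerm v f c₁ c₂ (realVec ζ + Ω *ᵥ realVec b) Ω n =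
      e (-(1 / 2 * (realVec b ⬝ᵥ (Ω *ᵥ realVec b)))) * e (intVec n ⬝ᵥ realVec ζ) *
        kern v f c₁ c₂ Ω (intReal n + b) := by
  have harg : ∀ c, thetaArg v c (realVec ζ + Ω *ᵥ realVec b) Ω n =
      alpha (imPart Ω) v c (intReal n + b) := by
    intro c
    unfold thetaArg alpha bil
    rw [realMat_mulVec_realVec]
    congr 3
    ext i
    have : (Ω *ᵥ intVec n + (realVec ζ + Ω *ᵥ realVec b)) =
        realVec ζ + Ω *ᵥ realVec (intReal n + b) := by
      rw [realVec_add, mulVec_add, realVec_intReal]; abel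
    rw [this]
    simp [realVec, mulVec, dotProduct, imPart]
  unfold thetaTerm kern
  rw [harg, harg]
  rw [mul_comm (e _ * e _), mul_assoc]
  congr 1
  unfold gauss
  rw [← e_add, ← e_add, realVec_add, realVec_dot_add Ω hΩ, realVec_intReal, dotProduct_add]
  congr 1
  ring

lemma summable_thetaTerm {Ω : Matrix (Fin g) (Fin g) ℂ} (hΩ : Ω.IsSymm)
    (hM : Lorentzian (imPart Ω)) {v : Fin g → ℝ} (hv : v ∈ negReal (imPart Ω))
    {c₁ c₂ : Fin g → ℂ} (hc₁ : c₁ ∈ negRegion (imPart Ω)) (hc₂ : c₂ ∈ negRegion (imPart Ω))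
    {f : ℂ → ℂ} (hf : IsTestFunction f c₁ c₂) (z : Fin g → ℂ) :
    Summable (thetaTerm v f c₁ c₂ z Ω) := by
  obtain ⟨ζ, b, rfl⟩ := hM.exists_realVec_add hv z
  obtain ⟨C, δ, hδ, hb⟩ := exists_norm_kern_le hM hv hc₁ hc₂ hf
  refine .of_norm ?_
  refine (((summable_translate hδ hb b).norm).mul_left
    ‖e (-(1 / 2 * (realVec b ⬝ᵥ (Ω *ᵥ realVec b))))‖).congr fun n => ?_
  rw [thetaTerm_eq_kern hΩ, norm_mul, norm_mul, norm_e (intVec n ⬝ᵥ realVec ζ)]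
  have : (intVec n ⬝ᵥ realVec ζ).im = 0 := by simp [dotProduct, intVec, realVec]
  simp [this]

lemma mulVec_realVec_map (A : Matrix (Fin g) (Fin g) ℤ) (v : Fin g → ℝ) :
    realVec (A.map (fun a : ℤ => (a : ℝ)) *ᵥ v) = intMat A *ᵥ realVec v := by
  ext i; simp [realVec, intMat, mulVec, dotProduct]

lemma intMat_mulVec_intVec (A : Matrix (Fin g) (Fin g) ℤ) (n : Fin g → ℤ) :
    intMat A *ᵥ intVec n = intVec (A *ᵥ n) := by
  ext i; simp [intMat, intVec, mulVec, dotProduct]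

lemma intMat_mul (A B : Matrix (Fin g) (Fin g) ℤ) : intMat (A * B) = intMat A * intMat B :=
  Matrix.map_mul (f := Int.castRingHom ℂ)

lemma intMat_one : intMat (1 : Matrix (Fin g) (Fin g) ℤ) = 1 := by
  unfold intMat
  rw [Matrix.map_one] <;> simp

lemma dotProduct_congruence {R : Type*} [CommRing R] (A N : Matrix (Fin g) (Fin g) R)
    (x y : Fin g → R) : x ⬝ᵥ ((Aᵀ * N * A) *ᵥ y) = (A *ᵥ x) ⬝ᵥ (N *ᵥ (A *ᵥ y)) := by
  rw [← mulVec_mulVec, ← mulVec_mulVec, dotProduct_mulVec, vecMul_transpose]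

lemma imPart_intMat_congruence (A : Matrix (Fin g) (Fin g) ℤ) (Ω : Matrix (Fin g) (Fin g) ℂ) :
    imPart ((intMat A)ᵀ * Ω * intMat A) =
      (A.map (fun a : ℤ => (a : ℝ)))ᵀ * imPart Ω * A.map (fun a : ℤ => (a : ℝ)) := by
  ext i j
  simp [imPart, intMat, Matrix.mul_apply, Finset.sum_mul, Complex.im_sum]

lemma realMat_map_int (A : Matrix (Fin g) (Fin g) ℤ) :
    realMat (A.map (fun a : ℤ => (a : ℝ))) = intMat A := by
  ext i j; simp [realMat, intMat]

lemma bil_congruence (A : Matrix (Fin g) (Fin g) ℤ) (Ω : Matrix (Fin g) (Fin g) ℂ)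
    (x y : Fin g → ℂ) : bil (imPart ((intMat A)ᵀ * Ω * intMat A)) x y =
      bil (imPart Ω) (intMat A *ᵥ x) (intMat A *ᵥ y) := by
  unfold bil
  rw [imPart_intMat_congruence, ← dotProduct_congruence]
  congr 2
  rw [← realMat_map_int]
  unfold realMat
  refine (Matrix.map_mul (f := Complex.ofRealHom)).trans ?_
  rw [Matrix.map_mul (f := Complex.ofRealHom)]
  rfl

lemma sqrtHalfNeg_congruence (A : Matrix (Fin g) (Fin g) ℤ) (Ω : Matrix (Fin g) (Fin g) ℂ)
    (v : Fin g → ℝ) (c : Fin g → ℂ) :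
    sqrtHalfNeg (imPart ((intMat A)ᵀ * Ω * intMat A)) v c =
      sqrtHalfNeg (imPart Ω) (A.map (fun a : ℤ => (a : ℝ)) *ᵥ v) (intMat A *ᵥ c) := by
  unfold sqrtHalfNeg sqrtNeg
  simp only [bil_congruence, mulVec_realVec_map]
  rw [imPart_intMat_congruence, dotProduct_congruence]

/-- The substitution `n ↦ An` carries one theta series into the other, term by term. -/
lemma thetaTerm_congruence {A A' : Matrix (Fin g) (Fin g) ℤ} (hA : A' * A = 1)
    (Ω : Matrix (Fin g) (Fin g) ℂ) (v : Fin g → ℝ) (f : ℂ → ℂ) (c₁ c₂ z : Fin g → ℂ)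
    (n : Fin g → ℤ) :
    thetaTerm v f c₁ c₂ z ((intMat A)ᵀ * Ω * intMat A) n =
      thetaTerm (A.map (fun a : ℤ => (a : ℝ)) *ᵥ v) f (intMat A *ᵥ c₁) (intMat A *ᵥ c₂)
        ((intMat A')ᵀ *ᵥ z) Ω (A *ᵥ n) := by
  have hAt : (intMat A)ᵀ * (intMat A')ᵀ = 1 := by
    rw [← transpose_mul, ← intMat_mul, hA, intMat_one, transpose_one]
  have hz : z = (intMat A)ᵀ *ᵥ ((intMat A')ᵀ *ᵥ z) := by rw [mulVec_mulVec, hAt, one_mulVec]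
  have hdot : ∀ x y : Fin g → ℂ, x ⬝ᵥ ((intMat A)ᵀ *ᵥ y) = (intMat A *ᵥ x) ⬝ᵥ y := fun x y => by
    rw [dotProduct_mulVec, vecMul_transpose]
  have harg : ∀ c, thetaArg v c z ((intMat A)ᵀ * Ω * intMat A) n =
      thetaArg (A.map (fun a : ℤ => (a : ℝ)) *ᵥ v) (intMat A *ᵥ c) ((intMat A')ᵀ *ᵥ z) Ω
        (A *ᵥ n) := by
    intro c
    unfold thetaArg
    rw [sqrtHalfNeg_congruence]
    congr 1
    rw [← hdot]
    congr 1
    set w := (intMat A')ᵀ *ᵥ z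
    rw [← mulVec_mulVec, ← mulVec_mulVec, intMat_mulVec_intVec, hz, ← mulVec_add]
    ext i
    simp [realVec, mulVec, dotProduct, intMat]
  unfold thetaTerm
  rw [harg, harg]
  congr 2
  rw [dotProduct_congruence, intMat_mulVec_intVec]
  congr 1
  conv_lhs => rw [hz]
  rw [hdot, intMat_mulVec_intVec]

lemma imPart_add_intMat (Ω : Matrix (Fin g) (Fin g) ℂ) (B : Matrix (Fin g) (Fin g) ℤ) :
    imPart (Ω + (2 : ℂ) • intMat B) = imPart Ω := by
  ext i j; simp [imPart, intMat]

/-- A translation `Ω ↦ Ω + 2B` changes the exponent of the term of index `n` by the integer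
`nᵀBn`. -/
lemma thetaTerm_add_intMat (Ω : Matrix (Fin g) (Fin g) ℂ) (B : Matrix (Fin g) (Fin g) ℤ)
    (v : Fin g → ℝ) (f : ℂ → ℂ) (c₁ c₂ z : Fin g → ℂ) (n : Fin g → ℤ) :
    thetaTerm v f c₁ c₂ z (Ω + (2 : ℂ) • intMat B) n = thetaTerm v f c₁ c₂ z Ω n := by
  have harg : ∀ c, thetaArg v c z (Ω + (2 : ℂ) • intMat B) n = thetaArg v c z Ω n := by
    intro c
    unfold thetaArg
    rw [imPart_add_intMat]
    congr 3
    ext i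
    simp only [add_mulVec, smul_mulVec, intMat_mulVec_intVec]
    simp [intVec]
  unfold thetaTerm
  rw [harg, harg]
  congr 1
  have h : intVec n ⬝ᵥ intVec (B *ᵥ n) = ((n ⬝ᵥ (B *ᵥ n) : ℤ) : ℂ) := by
    simp [dotProduct, intVec]
  rw [add_mulVec, smul_mulVec, intMat_mulVec_intVec, dotProduct_add, dotProduct_smul, h,
    smul_eq_mul, show 1 / 2 * (intVec n ⬝ᵥ (Ω *ᵥ intVec n) + 2 * ((n ⬝ᵥ (B *ᵥ n) : ℤ) : ℂ)) +
      intVec n ⬝ᵥ z = ((n ⬝ᵥ (B *ᵥ n) : ℤ) : ℂ) +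
      (1 / 2 * (intVec n ⬝ᵥ (Ω *ᵥ intVec n)) + intVec n ⬝ᵥ z) by ring, e_add, e_int, one_mul]

/-- Matrix-vector multiplication by an invertible integer matrix as a permutation of `ℤ^g`. -/
def mulVecEquiv (A : GL (Fin g) ℤ) : (Fin g → ℤ) ≃ (Fin g → ℤ) where
  toFun n := A.val *ᵥ n
  invFun n := (A⁻¹).val *ᵥ n
  left_inv n := by
    dsimp only
    rw [mulVec_mulVec, ← Units.val_mul, inv_mul_cancel, Units.val_one, one_mulVec]
  right_inv n := by
    dsimp only
    rw [mulVec_mulVec, ← Units.val_mul, mul_inv_cancel, Units.val_one, one_mulVec]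

theorem theta_congruence {Ω : Matrix (Fin g) (Fin g) ℂ} (hΩ : Ω.IsSymm)
    (hM : Lorentzian (imPart Ω)) (A : GL (Fin g) ℤ) {v : Fin g → ℝ} {c₁ c₂ : Fin g → ℂ}
    {f : ℂ → ℂ} (hv : v ∈ negReal (imPart ((intMat A.val)ᵀ * Ω * intMat A.val)))
    (hc₁ : c₁ ∈ negRegion (imPart ((intMat A.val)ᵀ * Ω * intMat A.val)))
    (hc₂ : c₂ ∈ negRegion (imPart ((intMat A.val)ᵀ * Ω * intMat A.val)))
    (hf : IsTestFunction f c₁ c₂) (z : Fin g → ℂ) :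
      Summable (thetaTerm v f c₁ c₂ z ((intMat A.val)ᵀ * Ω * intMat A.val)) ∧
      Summable (thetaTerm (A.val.map (fun a : ℤ => (a : ℝ)) *ᵥ v) f
        (intMat A.val *ᵥ c₁) (intMat A.val *ᵥ c₂) ((intMat (A⁻¹).val)ᵀ *ᵥ z) Ω) ∧
      theta v f c₁ c₂ z ((intMat A.val)ᵀ * Ω * intMat A.val) =
        theta (A.val.map (fun a : ℤ => (a : ℝ)) *ᵥ v) f
          (intMat A.val *ᵥ c₁) (intMat A.val *ᵥ c₂) ((intMat (A⁻¹).val)ᵀ *ᵥ z) Ω := by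
  have hA : (A⁻¹).val * A.val = 1 := by rw [← Units.val_mul, inv_mul_cancel, Units.val_one]
  have hterm := thetaTerm_congruence hA Ω v f c₁ c₂ z
  have hv' : A.val.map (fun a : ℤ => (a : ℝ)) *ᵥ v ∈ negReal (imPart Ω) := by
    have h : v ⬝ᵥ (_ *ᵥ v) < 0 := hv
    rwa [imPart_intMat_congruence, dotProduct_congruence] at h
  have hc : ∀ c ∈ negRegion (imPart ((intMat A.val)ᵀ * Ω * intMat A.val)),
      intMat A.val *ᵥ c ∈ negRegion (imPart Ω) := by
    intro c hc
    have h : (bil _ (star c) c).re < 0 := hc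
    rw [bil_congruence] at h
    have e : intMat A.val *ᵥ star c = star (intMat A.val *ᵥ c) := by
      ext i; simp [intMat, mulVec, dotProduct]
    rwa [e] at h
  have hf' : IsTestFunction f (intMat A.val *ᵥ c₁) (intMat A.val *ᵥ c₂) := by
    have him : ∀ c : Fin g → ℂ, (∀ i, (c i).im = 0) → ∀ i, ((intMat A.val *ᵥ c) i).im = 0 := by
      intro c hc i
      simp [intMat, mulVec, dotProduct, hc]
    rcases hf with h | ⟨h1, h2, h⟩
    · exact Or.inl h
    · exact Or.inr ⟨him _ h1, him _ h2, h⟩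
  have hsum := summable_thetaTerm hΩ hM hv' (hc _ hc₁) (hc _ hc₂) hf' ((intMat (A⁻¹).val)ᵀ *ᵥ z)
  refine ⟨?_, hsum, ?_⟩
  · exact ((mulVecEquiv A).summable_iff.2 hsum).congr fun n => (hterm n).symm
  · unfold theta
    rw [tsum_congr hterm]
    exact (mulVecEquiv A).tsum_eq (thetaTerm (A.val.map (fun a : ℤ => (a : ℝ)) *ᵥ v) f
      (intMat A.val *ᵥ c₁) (intMat A.val *ᵥ c₂) ((intMat (A⁻¹).val)ᵀ *ᵥ z) Ω)

end

/-! ### Poisson summation -/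

section

variable {g : ℕ}

lemma integrable_exp_neg_dotProduct {δ : ℝ} (hδ : 0 < δ) :
    Integrable fun x : Fin g → ℝ => Real.exp (-δ * (x ⬝ᵥ x)) := by
  have := Integrable.fintype_prod (f := fun (_ : Fin g) (y : ℝ) => Real.exp (-δ * y ^ 2))
    (μ := fun _ => volume) fun _ => integrable_exp_neg_mul_sq hδ
  refine this.congr (Filter.Eventually.of_forall fun x => ?_)
  simp only
  rw [← Real.exp_sum, dotProduct, Finset.mul_sum]
  congr 1
  exact Finset.sum_congr rfl fun i _ => by ring

lemma integrable_of_decay {F : (Fin g → ℝ) → ℂ} (hc : Continuous F) {C δ : ℝ} (hδ : 0 < δ)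
    (hF : ∀ x, ‖F x‖ ≤ C * Real.exp (-δ * (x ⬝ᵥ x))) : Integrable F :=
  ((integrable_exp_neg_dotProduct hδ).const_mul C).mono' hc.aestronglyMeasurable
    (Filter.Eventually.of_forall hF)

/-- The half-open unit cube with corner `a`. -/
def cube (a : Fin g → ℝ) : Set (Fin g → ℝ) := {x | ∀ i, x i ∈ Set.Ioc (a i) (a i + 1)}

lemma measurableSet_cube (a : Fin g → ℝ) : MeasurableSet (cube a) :=
  MeasurableSet.univ_pi' fun _ => measurableSet_Ioc

lemma pairwise_disjoint_cube :
    Pairwise (Function.onFun Disjoint fun n : Fin g → ℤ => cube (intReal n)) := by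
  intro m n hmn
  rw [Function.onFun, Set.disjoint_left]
  intro x hm hn
  apply hmn
  ext i
  have h1 := hm i
  have h2 := hn i
  simp only [intReal, Set.mem_Ioc] at h1 h2
  have h3 : (m i : ℝ) < n i + 1 := by linarith
  have h4 : (n i : ℝ) < m i + 1 := by linarith
  norm_cast at h3 h4
  omega

lemma iUnion_cube : ⋃ n : Fin g → ℤ, cube (intReal n) = Set.univ := by
  refine Set.eq_univ_of_forall fun x => Set.mem_iUnion.2 ⟨fun i => ⌈x i⌉ - 1, fun i => ?_⟩
  simp only [intReal, Set.mem_Ioc]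
  push_cast
  exact ⟨by linarith [Int.ceil_lt_add_one (x i)], by linarith [Int.le_ceil (x i)]⟩

lemma setIntegral_cube_translate {E : Type*} [NormedAddCommGroup E] [NormedSpace ℝ E]
    (G : (Fin g → ℝ) → E) (n : Fin g → ℤ) :
    ∫ x in cube (0 : Fin g → ℝ), G (intReal n + x) = ∫ x in cube (intReal n), G x := by
  have h := (measurePreserving_add_left (volume : Measure (Fin g → ℝ))
    (intReal n)).setIntegral_preimage_emb (measurableEmbedding_addLeft (intReal n)) G
    (cube (intReal n))
  rw [← h]
  congr 2
  ext x
  refine forall_congr' fun i => ?_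
  simp only [Pi.zero_apply, zero_add, Pi.add_apply, Set.mem_Ioc]
  constructor <;> rintro ⟨h1, h2⟩ <;> constructor <;> linarith

lemma hasSum_setIntegral_cube {E : Type*} [NormedAddCommGroup E] [NormedSpace ℝ E]
    {G : (Fin g → ℝ) → E} (hG : Integrable G) :
    HasSum (fun n : Fin g → ℤ => ∫ x in cube (0 : Fin g → ℝ), G (intReal n + x)) (∫ x, G x) := by
  have h := hasSum_integral_iUnion (fun n : Fin g → ℤ => measurableSet_cube (intReal n))
    pairwise_disjoint_cube (f := G) (μ := volume) hG.integrableOn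
  rw [iUnion_cube, setIntegral_univ] at h
  simpa only [setIntegral_cube_translate] using h

lemma integral_cube_tsum {G : (Fin g → ℝ) → ℂ} (hG : Integrable G) :
    ∫ x in cube (0 : Fin g → ℝ), ∑' n : Fin g → ℤ, G (intReal n + x) = ∫ x, G x := by
  rw [← integral_tsum_of_summable_integral_norm]
  · exact (hasSum_setIntegral_cube hG).tsum_eq
  · intro n
    exact (hG.comp_add_left (intReal n)).integrableOn
  · exact (hasSum_setIntegral_cube hG.norm).summable

/-- The projection of `ℝ^g` onto the torus `(ℝ/ℤ)^g`. -/
def toTorus (x : Fin g → ℝ) : UnitAddTorus (Fin g) := fun i => (x i : UnitAddCircle)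

lemma isOpenQuotientMap_toTorus : IsOpenQuotientMap (toTorus (g := g)) :=
  IsOpenQuotientMap.piMap fun _ => QuotientAddGroup.isOpenQuotientMap_mk

lemma exists_of_toTorus_eq {x y : Fin g → ℝ} (h : toTorus x = toTorus y) :
    ∃ n : Fin g → ℤ, y = intReal n + x := by
  have : ∀ i, ∃ k : ℤ, y i = k + x i := by
    intro i
    obtain ⟨k, hk⟩ := AddSubgroup.mem_zmultiples_iff.1 (QuotientAddGroup.eq.1 (congrFun h i))
    exact ⟨k, by simp at hk; linarith⟩
  choose n hn using this
  exact ⟨n, funext hn⟩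

lemma mFourier_toTorus (m : Fin g → ℤ) (x : Fin g → ℝ) :
    UnitAddTorus.mFourier m (toTorus x) = e (intVec m ⬝ᵥ realVec x) := by
  simp only [UnitAddTorus.mFourier, ContinuousMap.coe_mk, toTorus, fourier_coe_apply, e,
    ← Complex.exp_sum]
  congr 1
  simp only [dotProduct, Finset.mul_sum, intVec, realVec]
  refine Finset.sum_congr rfl fun i _ => ?_
  push_cast
  ring

lemma continuous_tsum_translate {F : (Fin g → ℝ) → ℂ} (hc : Continuous F) {C δ : ℝ} (hδ : 0 < δ)
    (hF : ∀ x, ‖F x‖ ≤ C * Real.exp (-δ * (x ⬝ᵥ x))) :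
    Continuous fun x => ∑' n : Fin g → ℤ, F (intReal n + x) := by
  rw [continuous_iff_continuousAt]
  intro x
  have hopen : IsOpen {y : Fin g → ℝ | y ⬝ᵥ y < x ⬝ᵥ x + 1} :=
    isOpen_lt (by fun_prop) continuous_const
  refine ContinuousOn.continuousAt (s := {y : Fin g → ℝ | y ⬝ᵥ y < x ⬝ᵥ x + 1}) ?_
    (hopen.mem_nhds (show x ⬝ᵥ x < x ⬝ᵥ x + 1 by linarith))
  refine continuousOn_tsum (fun n => (hc.comp (by fun_prop)).continuousOn)
    ((summable_exp_neg_dotProduct g (half_pos hδ)).mul_left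
      (C * Real.exp (δ * (x ⬝ᵥ x + 1)))) fun n y hy => ?_
  exact norm_translate_le hδ hF (le_of_lt hy) n

lemma norm_e_real {w : ℂ} (h : w.im = 0) : ‖e w‖ = 1 := by rw [norm_e, h]; simp

lemma im_intVec_dot (m : Fin g → ℤ) (x : Fin g → ℝ) : (intVec m ⬝ᵥ realVec x).im = 0 := by
  simp [dotProduct, intVec, realVec]

lemma continuous_e : Continuous e := by unfold e; fun_prop

lemma continuous_realVec : Continuous (realVec : (Fin g → ℝ) → (Fin g → ℂ)) := by
  unfold realVec; fun_prop

/-- The **Poisson summation formula** on `ℝ^g` for a continuous function with Gaussian decay whose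
Fourier transform is summable over `ℤ^g`. -/
theorem tsum_eq_tsum_fourier {F : (Fin g → ℝ) → ℂ} (hc : Continuous F) {C δ : ℝ} (hδ : 0 < δ)
    (hF : ∀ x, ‖F x‖ ≤ C * Real.exp (-δ * (x ⬝ᵥ x)))
    (hsum : Summable fun m : Fin g → ℤ => ∫ x, F x * e (intVec m ⬝ᵥ realVec x)) :
    ∑' n : Fin g → ℤ, F (intReal n) =
      ∑' m : Fin g → ℤ, ∫ x, F x * e (intVec m ⬝ᵥ realVec x) := by
  set P : (Fin g → ℝ) → ℂ := fun x => ∑' n : Fin g → ℤ, F (intReal n + x) with hP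
  have hPc : Continuous P := continuous_tsum_translate hc hδ hF
  have hper : ∀ (k : Fin g → ℤ) x, P (intReal k + x) = P x := by
    intro k x
    rw [hP]
    simp only
    rw [← (Equiv.addRight k).tsum_eq fun n : Fin g → ℤ => F (intReal n + x)]
    refine tsum_congr fun n => ?_
    congr 1
    ext i
    simp [intReal, add_assoc]
  -- the periodization descends to the torus
  obtain ⟨f, hf⟩ : ∃ f : C(UnitAddTorus (Fin g), ℂ), ∀ x, f (toTorus x) = P x := by
    obtain ⟨s, hs⟩ := isOpenQuotientMap_toTorus (g := g).surjective.hasRightInverse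
    have hfs : ∀ x, P (s (toTorus x)) = P x := fun x => by
      obtain ⟨n, hn⟩ := exists_of_toTorus_eq (hs (toTorus x)).symm
      rw [hn, hper]
    refine ⟨⟨fun t => P (s t), ?_⟩, hfs⟩
    rw [(isOpenQuotientMap_toTorus (g := g)).isQuotientMap.continuous_iff]
    exact hPc.congr fun x => (hfs x).symm
  have hcoeff : ∀ m : Fin g → ℤ, UnitAddTorus.mFourierCoeff f m =
      ∫ x, F x * e (intVec (-m) ⬝ᵥ realVec x) := by
    intro m
    rw [UnitAddTorus.mFourierCoeff_eq_integral _ _ 0]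
    have hdec : ∀ x, ‖F x * e (intVec (-m) ⬝ᵥ realVec x)‖ ≤ C * Real.exp (-δ * (x ⬝ᵥ x)) := by
      intro x
      rw [norm_mul, norm_e_real (im_intVec_dot _ _), mul_one]
      exact hF x
    have hcont : Continuous fun x => F x * e (intVec (-m) ⬝ᵥ realVec x) :=
      hc.mul (continuous_e.comp (by have := continuous_realVec (g := g); fun_prop))
    rw [← integral_cube_tsum (integrable_of_decay hcont hδ hdec)]
    refine setIntegral_congr_fun (measurableSet_cube 0) fun x _ => ?_
    change UnitAddTorus.mFourier (-m) (toTorus x) • f (toTorus x) = _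
    rw [hf, mFourier_toTorus, hP, smul_eq_mul, ← tsum_mul_left]
    refine tsum_congr fun n => ?_
    have : intVec (-m) ⬝ᵥ intVec n = (((-m) ⬝ᵥ n : ℤ) : ℂ) := by simp [dotProduct, intVec]
    rw [realVec_add, dotProduct_add, realVec_intReal, this, e_add, e_int, one_mul, mul_comm]
  have hneg := (Equiv.neg (Fin g → ℤ)).summable_iff.2 hsum
  have hsum' : Summable (UnitAddTorus.mFourierCoeff f) := hneg.congr fun m => (hcoeff m).symm
  have h := (UnitAddTorus.hasSum_mFourier_series_apply_of_summable hsum' (toTorus 0)).tsum_eq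
  have h0 : f (toTorus 0) = ∑' n : Fin g → ℤ, F (intReal n) := by rw [hf]; simp [hP]
  rw [← h0, ← h, ← (Equiv.neg (Fin g → ℤ)).tsum_eq fun m : Fin g → ℤ =>
    ∫ x, F x * e (intVec m ⬝ᵥ realVec x)]
  refine tsum_congr fun m => ?_
  have hz : realVec (0 : Fin g → ℝ) = 0 := by ext i; simp [realVec]
  rw [hcoeff, mFourier_toTorus, hz, dotProduct_zero]
  simp [e]

end

/-! ### Gaussian integrals -/

section

variable {g : ℕ}

open scoped MatrixOrder in
/-- A symmetric complex matrix with positive definite imaginary part is carried to a diagonal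
matrix with diagonal entries `d_i + i` by a real congruence. -/
lemma exists_diagonal_congruence {Ω : Matrix (Fin g) (Fin g) ℂ} (hΩ : Ω.IsSymm)
    (hpos : ∀ x : Fin g → ℝ, x ≠ 0 → 0 < x ⬝ᵥ (imPart Ω *ᵥ x)) :
    ∃ (P : Matrix (Fin g) (Fin g) ℝ) (d : Fin g → ℝ), P.det ≠ 0 ∧
      (realMat P)ᵀ * Ω * realMat P = diagonal fun i => (d i : ℂ) + Complex.I := by
  set X : Matrix (Fin g) (Fin g) ℝ := Ω.map Complex.re with hX
  set N := imPart Ω with hN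
  have hXs : Xᵀ = X := by rw [hX, ← transpose_map, hΩ.eq]
  have hNs : Nᵀ = N := by rw [hN, imPart, ← transpose_map, hΩ.eq]
  have hNp : N.PosSemidef := by
    refine PosSemidef.of_dotProduct_mulVec_nonneg (by simpa [IsHermitian] using hNs) fun x => ?_
    by_cases hx : x = 0
    · simp [hx]
    · simpa using (hpos x hx).le
  -- `B⁻¹` carries `Im Ω` to the identity matrix; then the spectral theorem diagonalizes
  -- the real part
  obtain ⟨B, hB⟩ := CStarAlgebra.nonneg_iff_eq_star_mul_self.mp hNp.nonneg
  have hBt : N = Bᵀ * B := by rw [hB]; rfl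
  have hBdet : B.det ≠ 0 := by
    intro h
    obtain ⟨x, hx, hBx⟩ := Matrix.exists_mulVec_eq_zero_iff.2 h
    have := hpos x hx
    rw [hBt, ← mulVec_mulVec, hBx] at this
    simp at this
  have hBu : IsUnit B.det := isUnit_iff_ne_zero.2 hBdet
  have hA : (B⁻¹ᵀ * X * B⁻¹).IsHermitian := by
    simp [IsHermitian, Matrix.mul_assoc, hXs]
  set U : Matrix (Fin g) (Fin g) ℝ := hA.eigenvectorUnitary.val with hU
  have hUU : Uᵀ * U = 1 := (Unitary.mem_iff.1 hA.eigenvectorUnitary.2).1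
  have hspec : Uᵀ * (B⁻¹ᵀ * X * B⁻¹) * U = diagonal hA.eigenvalues := by
    have := hA.conjStarAlgAut_star_eigenvectorUnitary
    rw [Unitary.conjStarAlgAut_apply] at this
    simp only [star_star, Unitary.coe_star] at this
    exact this
  have hP : (B⁻¹ * U)ᵀ * N * (B⁻¹ * U) = 1 := by
    have h1 : B⁻¹ᵀ * Bᵀ = 1 := by
      rw [← transpose_mul, mul_nonsing_inv _ hBu, transpose_one]
    calc (B⁻¹ * U)ᵀ * N * (B⁻¹ * U) = Uᵀ * (B⁻¹ᵀ * Bᵀ) * (B * B⁻¹) * U := by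
          rw [hBt, transpose_mul]; simp only [Matrix.mul_assoc]
      _ = 1 := by rw [h1, mul_nonsing_inv _ hBu, Matrix.mul_one, Matrix.mul_one, hUU]
  have hPX : (B⁻¹ * U)ᵀ * X * (B⁻¹ * U) = diagonal hA.eigenvalues := by
    rw [← hspec, transpose_mul]; simp only [Matrix.mul_assoc]
  refine ⟨B⁻¹ * U, hA.eigenvalues, ?_, ?_⟩
  · intro h
    have := congrArg Matrix.det hP
    rw [det_mul, h] at this
    simp at this
  · have hdec : Ω = realMat X + Complex.I • realMat N := by
      ext i j
      simp only [realMat, hX, hN, imPart, Matrix.add_apply, Matrix.smul_apply, map_apply,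
        smul_eq_mul]
      rw [mul_comm, Complex.re_add_im]
    have hmul : ∀ A B : Matrix (Fin g) (Fin g) ℝ, realMat A * realMat B = realMat (A * B) :=
      fun A B => (Matrix.map_mul (f := Complex.ofRealHom)).symm
    have htr : ∀ A : Matrix (Fin g) (Fin g) ℝ, (realMat A)ᵀ = realMat Aᵀ := fun A => rfl
    rw [hdec, Matrix.mul_add, Matrix.add_mul, Matrix.mul_smul, Matrix.smul_mul, htr, hmul, hmul,
      hmul, hmul, hPX, hP]
    ext i j
    by_cases h : i = j
    · subst h; simp [realMat]
    · simp [realMat, h]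

lemma integral_comp_mulVec {P : Matrix (Fin g) (Fin g) ℝ} (hP : P.det ≠ 0)
    {F : (Fin g → ℝ) → ℂ} (hF : Continuous F) :
    ∫ x, F x = (|P.det| : ℝ) * ∫ y, F (P *ᵥ y) := by
  have h := integral_map (μ := (volume : Measure (Fin g → ℝ))) (φ := toLin' P) (f := F)
    (LinearMap.continuous_on_pi _).measurable.aemeasurable hF.aestronglyMeasurable
  rw [Real.map_matrix_volume_pi_eq_smul_volume_pi hP, integral_smul_measure] at h
  simp only [toLin'_apply] at h
  rw [← h, ENNReal.toReal_ofReal (abs_nonneg _), Complex.real_smul, ← mul_assoc,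
    ← Complex.ofReal_mul, abs_inv, mul_inv_cancel₀ (abs_ne_zero.2 hP)]
  simp

lemma continuous_gauss (Ω : Matrix (Fin g) (Fin g) ℂ) : Continuous (gauss Ω) := by
  unfold gauss
  have : Continuous fun x : Fin g → ℝ => realVec x ⬝ᵥ (Ω *ᵥ realVec x) := by
    unfold realVec mulVec dotProduct; fun_prop
  exact continuous_e.comp (continuous_const.mul this)

lemma exists_norm_gauss_le {Ω : Matrix (Fin g) (Fin g) ℂ}
    (hpos : ∀ x : Fin g → ℝ, x ≠ 0 → 0 < x ⬝ᵥ (imPart Ω *ᵥ x)) :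
    ∃ δ : ℝ, 0 < δ ∧ ∀ x, ‖gauss Ω x‖ ≤ 1 * Real.exp (-δ * (x ⬝ᵥ x)) := by
  obtain ⟨δ, hδ, h⟩ := exists_pos_mul_le_of_homogeneous (isCompact_singleton (x := ()))
    (φ := fun _ x => x ⬝ᵥ (imPart Ω *ᵥ x))
    ((continuous_dotProduct_mulVec _).comp continuous_snd).continuousOn
    (fun _ _ r x => by simp only [mulVec_smul, dotProduct_smul, smul_dotProduct, smul_eq_mul]; ring)
    (fun _ _ x hx => hpos x hx)
  refine ⟨δ, hδ, fun x => ?_⟩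
  rw [norm_gauss, one_mul, Real.exp_le_exp]
  nlinarith [h () rfl x, Real.pi_gt_three, mul_nonneg hδ.le (dotProduct_self_nonneg' x)]

lemma continuous_e_dot (ξ : Fin g → ℝ) :
    Continuous fun x : Fin g → ℝ => e (realVec ξ ⬝ᵥ realVec x) :=
  continuous_e.comp (by unfold realVec dotProduct; fun_prop)

/-- The Gaussian integral in diagonal coordinates. -/
lemma integral_gauss_diagonal {Ω : Matrix (Fin g) (Fin g) ℂ} {P : Matrix (Fin g) (Fin g) ℝ}
    {d : Fin g → ℝ} (hP : P.det ≠ 0)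
    (hd : (realMat P)ᵀ * Ω * realMat P = diagonal fun i => (d i : ℂ) + Complex.I)
    (ξ : Fin g → ℝ) :
    ∫ x, gauss Ω x * e (realVec ξ ⬝ᵥ realVec x) =
      ((|P.det| : ℝ) * ∏ i, (1 / (-Complex.I * (d i + Complex.I))) ^ (1 / 2 : ℂ)) *
        e (-(1 / 2) * ∑ i, ((realMat P)ᵀ *ᵥ realVec ξ) i ^ 2 / (d i + Complex.I)) := by
  have hb : ∀ i, 0 < (-(Real.pi : ℂ) * Complex.I * (d i + Complex.I)).re := by
    intro i
    have : -(Real.pi : ℂ) * Complex.I * (d i + Complex.I) =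
        (Real.pi : ℂ) - (Real.pi * d i : ℝ) * Complex.I := by
      push_cast
      linear_combination -(Real.pi : ℂ) * Complex.I_mul_I
    rw [this]
    simp [Real.pi_pos]
  have hne : ∀ i, (d i : ℂ) + Complex.I ≠ 0 := by
    intro i h
    have := congrArg Complex.im h
    simp at this
  have hpi : (Real.pi : ℂ) ≠ 0 := by exact_mod_cast Real.pi_ne_zero
  set η := (realMat P)ᵀ *ᵥ realVec ξ with hη
  rw [integral_comp_mulVec hP (F := fun x => gauss Ω x * e (realVec ξ ⬝ᵥ realVec x))
    ((continuous_gauss Ω).mul (continuous_e_dot ξ)), mul_assoc]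
  congr 1
  have h := GaussianFourier.integral_cexp_neg_sum_mul_add hb fun i => 2 * Real.pi * Complex.I * η i
  rw [Finset.prod_mul_distrib, ← Complex.exp_sum] at h
  have e1 : (fun y : Fin g → ℝ => gauss Ω (P *ᵥ y) * e (realVec ξ ⬝ᵥ realVec (P *ᵥ y))) =
      fun y : Fin g → ℝ => Complex.exp
        (-∑ i, -(Real.pi : ℂ) * Complex.I * (d i + Complex.I) * (y i : ℂ) ^ 2 +
          ∑ i, 2 * Real.pi * Complex.I * η i * y i) := by
    ext y
    unfold gauss
    rw [← realMat_mulVec_realVec, ← dotProduct_congruence, hd, ← e_add]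
    unfold e
    congr 1
    rw [dotProduct_mulVec (realVec ξ), ← mulVec_transpose, ← hη]
    simp only [dotProduct, mulVec_diagonal, realVec, Finset.mul_sum, ← Finset.sum_neg_distrib,
      ← Finset.sum_add_distrib]
    refine Finset.sum_congr rfl fun i _ => ?_
    ring
  rw [e1, h]
  congr 1
  · refine Finset.prod_congr rfl fun i _ => ?_
    congr 1
    have := hne i
    field_simp
  · unfold e
    congr 1
    simp only [Finset.mul_sum]
    refine Finset.sum_congr rfl fun i _ => ?_
    have := hne i
    field_simp
    ring

/-- The square of the Gaussian integral is `1 / det(-iΩ)`. -/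
lemma integral_gauss_sq_mul_det {Ω : Matrix (Fin g) (Fin g) ℂ} (hΩ : Ω.IsSymm)
    (hpos : ∀ x : Fin g → ℝ, x ≠ 0 → 0 < x ⬝ᵥ (imPart Ω *ᵥ x)) :
    (∫ x, gauss Ω x) ^ 2 * ((-Complex.I) ^ g * Ω.det) = 1 := by
  obtain ⟨P, d, hP, hd⟩ := exists_diagonal_congruence hΩ hpos
  have h := integral_gauss_diagonal hP hd 0
  have hz : realVec (0 : Fin g → ℝ) = 0 := by ext i; simp [realVec]
  have he0 : e 0 = 1 := by simp [e]
  simp only [hz, zero_dotProduct, mulVec_zero, Pi.zero_apply, he0, mul_one, ne_eq,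
    OfNat.ofNat_ne_zero, not_false_eq_true, zero_pow, zero_div, Finset.sum_const_zero,
    mul_zero] at h
  have hdet := congrArg Matrix.det hd
  rw [det_mul, det_mul, det_transpose, det_diagonal] at hdet
  have hPdet : (realMat P).det = (P.det : ℂ) := (Complex.ofRealHom.map_det P).symm
  rw [hPdet] at hdet
  rw [h, mul_pow, ← Complex.ofReal_pow, sq_abs, ← Finset.prod_pow]
  have hs : ∀ i, ((1 / (-Complex.I * (d i + Complex.I))) ^ (1 / 2 : ℂ)) ^ 2 =
      1 / (-Complex.I * (d i + Complex.I)) := by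
    intro i
    have := csqrt_sq (1 / (-Complex.I * (d i + Complex.I)))
    unfold Complex.sqrt at this
    rwa [show (2⁻¹ : ℂ) = 1 / 2 by norm_num] at this
  simp only [hs]
  have hne : ∀ i, (d i : ℂ) + Complex.I ≠ 0 := by
    intro i h
    have := congrArg Complex.im h
    simp at this
  have hprod : ∏ i, (d i + Complex.I) ≠ 0 := Finset.prod_ne_zero_iff.2 fun i _ => hne i
  have hI : (-Complex.I) ^ g ≠ 0 := pow_ne_zero _ (neg_ne_zero.2 Complex.I_ne_zero)
  rw [Finset.prod_div_distrib, Finset.prod_mul_distrib, Finset.prod_const, Finset.prod_const,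
    Finset.card_univ, Fintype.card_fin, one_pow]
  push_cast
  rw [mul_div_assoc', div_mul_eq_mul_div, div_eq_one_iff_eq (mul_ne_zero hI hprod), ← hdet]
  ring

lemma det_ne_zero_of_pos {Ω : Matrix (Fin g) (Fin g) ℂ} (hΩ : Ω.IsSymm)
    (hpos : ∀ x : Fin g → ℝ, x ≠ 0 → 0 < x ⬝ᵥ (imPart Ω *ᵥ x)) : Ω.det ≠ 0 := by
  intro h
  have := integral_gauss_sq_mul_det hΩ hpos
  simp [h] at this

/-- The Fourier transform of a Gaussian. -/
lemma integral_gauss_mul_e {Ω : Matrix (Fin g) (Fin g) ℂ} (hΩ : Ω.IsSymm)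
    (hpos : ∀ x : Fin g → ℝ, x ≠ 0 → 0 < x ⬝ᵥ (imPart Ω *ᵥ x)) (ξ : Fin g → ℝ) :
    ∫ x, gauss Ω x * e (realVec ξ ⬝ᵥ realVec x) = (∫ x, gauss Ω x) * gauss (-Ω⁻¹) ξ := by
  obtain ⟨P, d, hP, hd⟩ := exists_diagonal_congruence hΩ hpos
  have h := integral_gauss_diagonal hP hd 0
  have hz : realVec (0 : Fin g → ℝ) = 0 := by ext i; simp [realVec]
  have he0 : e 0 = 1 := by simp [e]
  simp only [hz, zero_dotProduct, mulVec_zero, Pi.zero_apply, he0, mul_one, ne_eq,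
    OfNat.ofNat_ne_zero, not_false_eq_true, zero_pow, zero_div, Finset.sum_const_zero,
    mul_zero] at h
  rw [integral_gauss_diagonal hP hd ξ, ← h]
  congr 1
  have hne : ∀ i, (d i : ℂ) + Complex.I ≠ 0 := by
    intro i h
    have := congrArg Complex.im h
    simp at this
  have hPdet : (realMat P).det = (P.det : ℂ) := (Complex.ofRealHom.map_det P).symm
  have hPu : IsUnit (realMat P)ᵀ.det := by
    rw [det_transpose, hPdet, isUnit_iff_ne_zero]
    exact_mod_cast hP
  have hinv : Ω⁻¹ = realMat P * (diagonal fun i => ((d i : ℂ) + Complex.I)⁻¹) * (realMat P)ᵀ := by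
    refine Matrix.inv_eq_right_inv ?_
    have h1 : Ω * realMat P =
        (realMat P)ᵀ⁻¹ * diagonal fun i => (d i : ℂ) + Complex.I := by
      rw [← hd, Matrix.mul_assoc, nonsing_inv_mul_cancel_left _ _ hPu]
    have h2 : (diagonal fun i => (d i : ℂ) + Complex.I) *
        (diagonal fun i => ((d i : ℂ) + Complex.I)⁻¹) = 1 := by
      rw [diagonal_mul_diagonal, ← diagonal_one]
      congr 1
      ext i
      exact mul_inv_cancel₀ (hne i)
    rw [← Matrix.mul_assoc, ← Matrix.mul_assoc, h1, Matrix.mul_assoc (realMat P)ᵀ⁻¹, h2,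
      Matrix.mul_one, nonsing_inv_mul _ hPu]
  unfold gauss
  congr 1
  have hc := dotProduct_congruence (realMat P)ᵀ
    (diagonal fun i => ((d i : ℂ) + Complex.I)⁻¹) (realVec ξ) (realVec ξ)
  rw [transpose_transpose, ← hinv] at hc
  rw [neg_mulVec, dotProduct_neg, hc]
  simp only [dotProduct, mulVec_diagonal]
  rw [mul_neg, neg_mul]
  congr 2
  refine Finset.sum_congr rfl fun i _ => ?_
  rw [div_eq_mul_inv]
  ring

end

/-! ### Gaussians times linear forms -/

section

variable {g : ℕ}

/-- A factor of linear growth costs half of the exponent of a Gaussian bound. -/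
lemma mul_decay {a b R C δ N : ℝ} (hδ : 0 < δ) (hR : 0 < R) (hC : 0 ≤ C) (hN : 0 ≤ N)
    (ha : a ^ 2 ≤ R * N) (ha0 : 0 ≤ a) (hb : b ≤ C * Real.exp (-δ * N)) :
    a * b ≤ (1 + 2 * R / δ) * C * Real.exp (-(δ / 2) * N) := by
  have h1 : a ≤ 1 + R * N := by nlinarith [sq_nonneg (a - 1)]
  have h2 : 1 + R * N ≤ (1 + 2 * R / δ) * Real.exp (δ / 2 * N) := by
    have := Real.add_one_le_exp (δ / 2 * N)
    have h3 : R * N = 2 * R / δ * (δ / 2 * N) := by field_simp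
    have h4 : 0 < 2 * R / δ := by positivity
    have h5 : 0 ≤ δ / 2 * N := by positivity
    nlinarith
  have e3 : Real.exp (δ / 2 * N) * Real.exp (-δ * N) = Real.exp (-(δ / 2) * N) := by
    rw [← Real.exp_add]; congr 1; ring
  calc a * b ≤ a * (C * Real.exp (-δ * N)) := mul_le_mul_of_nonneg_left hb ha0
    _ ≤ ((1 + 2 * R / δ) * Real.exp (δ / 2 * N)) * (C * Real.exp (-δ * N)) :=
        mul_le_mul_of_nonneg_right (h1.trans h2) (by positivity)
    _ = (1 + 2 * R / δ) * C * (Real.exp (δ / 2 * N) * Real.exp (-δ * N)) := by ring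
    _ = _ := by rw [e3]

lemma continuous_dot_realVec (l : Fin g → ℂ) :
    Continuous fun x : Fin g → ℝ => l ⬝ᵥ realVec x := by
  unfold dotProduct realVec; fun_prop

lemma exists_norm_dot_sq_le (l : Fin g → ℂ) :
    ∃ R : ℝ, 0 < R ∧ ∀ x : Fin g → ℝ, ‖l ⬝ᵥ realVec x‖ ^ 2 ≤ R * (x ⬝ᵥ x) := by
  obtain ⟨R, hR, h⟩ := exists_le_mul_of_homogeneous (isCompact_singleton (x := ()))
    (φ := fun _ (x : Fin g → ℝ) => ‖l ⬝ᵥ realVec x‖ ^ 2)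
    (((continuous_dot_realVec l).comp continuous_snd).norm.pow 2).continuousOn
    (fun _ _ r x => by
      have : realVec (r • x) = (r : ℂ) • realVec x := by ext i; simp [realVec]
      rw [this, dotProduct_smul, smul_eq_mul, norm_mul, mul_pow, Complex.norm_real,
        Real.norm_eq_abs, sq_abs])
  exact ⟨R, hR, fun x => h () rfl x⟩

lemma im_realVec_dot (ξ x : Fin g → ℝ) : (realVec ξ ⬝ᵥ realVec x).im = 0 := by
  simp [dotProduct, realVec]

lemma integrable_gauss_mul_e {Ω : Matrix (Fin g) (Fin g) ℂ}
    (hpos : ∀ x : Fin g → ℝ, x ≠ 0 → 0 < x ⬝ᵥ (imPart Ω *ᵥ x)) (ξ : Fin g → ℝ) :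
    Integrable fun x => gauss Ω x * e (realVec ξ ⬝ᵥ realVec x) := by
  obtain ⟨δ, hδ, h⟩ := exists_norm_gauss_le hpos
  refine integrable_of_decay ((continuous_gauss Ω).mul (continuous_e_dot ξ)) hδ (C := 1)
    fun x => ?_
  rw [norm_mul, norm_e_real (im_realVec_dot _ _), mul_one]
  exact h x

lemma integrable_dot_mul_gauss_mul_e {Ω : Matrix (Fin g) (Fin g) ℂ}
    (hpos : ∀ x : Fin g → ℝ, x ≠ 0 → 0 < x ⬝ᵥ (imPart Ω *ᵥ x))
    (l : Fin g → ℂ) (ξ : Fin g → ℝ) :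
    Integrable fun x => (l ⬝ᵥ realVec x) * (gauss Ω x * e (realVec ξ ⬝ᵥ realVec x)) := by
  obtain ⟨δ, hδ, h⟩ := exists_norm_gauss_le hpos
  obtain ⟨R, hR, hl⟩ := exists_norm_dot_sq_le l
  refine integrable_of_decay ((continuous_dot_realVec l).mul
    ((continuous_gauss Ω).mul (continuous_e_dot ξ))) (half_pos hδ)
    (C := (1 + 2 * R / δ) * 1) fun x => ?_
  rw [norm_mul, norm_mul, norm_e_real (im_realVec_dot _ _), mul_one]
  exact mul_decay hδ hR zero_le_one (dotProduct_self_nonneg' x) (hl x) (norm_nonneg _) (h x)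

lemma hasLineDerivAt_gauss_mul_e {Ω : Matrix (Fin g) (Fin g) ℂ} (hΩ : Ω.IsSymm)
    (ξ x w : Fin g → ℝ) :
    HasLineDerivAt ℝ (fun x => gauss Ω x * e (realVec ξ ⬝ᵥ realVec x))
      (2 * Real.pi * Complex.I * ((realVec w ⬝ᵥ (Ω *ᵥ realVec x) + realVec ξ ⬝ᵥ realVec w) *
        (gauss Ω x * e (realVec ξ ⬝ᵥ realVec x)))) x w := by
  unfold HasLineDerivAt
  have e1 : (fun t : ℝ => gauss Ω (x + t • w) * e (realVec ξ ⬝ᵥ realVec (x + t • w))) =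
      fun t : ℝ => Complex.exp (2 * Real.pi * Complex.I *
        (1 / 2 * (realVec x ⬝ᵥ (Ω *ᵥ realVec x)) + realVec ξ ⬝ᵥ realVec x +
          ((t : ℂ) * (realVec w ⬝ᵥ (Ω *ᵥ realVec x) + realVec ξ ⬝ᵥ realVec w) +
          (t : ℂ) ^ 2 * (1 / 2 * (realVec w ⬝ᵥ (Ω *ᵥ realVec w)))))) := by
    ext t
    have : realVec (x + t • w) = realVec x + (t : ℂ) • realVec w := by
      ext i; simp [realVec]
    unfold gauss
    rw [← e_add, this, realVec_dot_add Ω hΩ]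
    unfold e
    congr 2
    simp only [mulVec_smul, dotProduct_smul, smul_dotProduct, dotProduct_add, smul_eq_mul,
      dotProduct_mulVec_symm hΩ (realVec x) (realVec w)]
    ring
  rw [e1]
  have h := Complex.ofRealCLM.hasDerivAt (x := (0 : ℝ))
  have h2 := ((((h.mul_const (realVec w ⬝ᵥ (Ω *ᵥ realVec x) + realVec ξ ⬝ᵥ realVec w)).add
    ((h.pow 2).mul_const (1 / 2 * (realVec w ⬝ᵥ (Ω *ᵥ realVec w))))).const_add
    (1 / 2 * (realVec x ⬝ᵥ (Ω *ᵥ realVec x)) + realVec ξ ⬝ᵥ realVec x)).const_mul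
    (2 * Real.pi * Complex.I)).cexp
  refine h2.congr_deriv ?_
  unfold gauss
  rw [← e_add]
  unfold e
  simp
  ring

/-- The integral of a derivative of `e(½ xᵀΩx + ξᵀx)` in the direction `w` vanishes. -/
lemma integral_lineDeriv_gauss {Ω : Matrix (Fin g) (Fin g) ℂ} (hΩ : Ω.IsSymm)
    (hpos : ∀ x : Fin g → ℝ, x ≠ 0 → 0 < x ⬝ᵥ (imPart Ω *ᵥ x)) (ξ w : Fin g → ℝ) :
    ∫ x, (realVec w ⬝ᵥ (Ω *ᵥ realVec x)) * (gauss Ω x * e (realVec ξ ⬝ᵥ realVec x)) =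
      -(realVec ξ ⬝ᵥ realVec w) * ∫ x, gauss Ω x * e (realVec ξ ⬝ᵥ realVec x) := by
  have hd : ∀ x, realVec w ⬝ᵥ (Ω *ᵥ realVec x) = (Ω *ᵥ realVec w) ⬝ᵥ realVec x := fun x => by
    rw [dotProduct_mulVec, ← mulVec_transpose, hΩ.eq]
  have i1 := integrable_gauss_mul_e hpos ξ
  have i2 : Integrable fun x => (realVec w ⬝ᵥ (Ω *ᵥ realVec x)) *
      (gauss Ω x * e (realVec ξ ⬝ᵥ realVec x)) := by
    simp only [hd]
    exact integrable_dot_mul_gauss_mul_e hpos _ ξ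
  have i3 : Integrable fun x => 2 * Real.pi * Complex.I * ((realVec w ⬝ᵥ (Ω *ᵥ realVec x) +
      realVec ξ ⬝ᵥ realVec w) * (gauss Ω x * e (realVec ξ ⬝ᵥ realVec x))) := by
    refine Integrable.const_mul ?_ _
    simp only [add_mul]
    exact i2.add (i1.const_mul _)
  have h := integral_bilinear_hasLineDerivAt_right_eq_neg_left_of_integrable
    (μ := (volume : Measure (Fin g → ℝ))) (B := ContinuousLinearMap.mul ℝ ℂ)
    (f := fun _ => (1 : ℂ)) (f' := fun _ => 0) (v := w)
    (g := fun x => gauss Ω x * e (realVec ξ ⬝ᵥ realVec x))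
    (by simp) (by simpa using i3) (by simpa using i1)
    (fun x _ => by simpa [HasLineDerivAt] using hasDerivAt_const (0 : ℝ) (1 : ℂ))
    (fun x _ => hasLineDerivAt_gauss_mul_e hΩ ξ x w)
  simp only [ContinuousLinearMap.mul_apply', one_mul, zero_mul, integral_zero, neg_zero] at h
  rw [integral_const_mul] at h
  have hne : (2 * Real.pi * Complex.I : ℂ) ≠ 0 := Complex.two_pi_I_ne_zero
  have h' := (mul_eq_zero.1 h).resolve_left hne
  simp only [add_mul] at h'
  rw [integral_add i2 (i1.const_mul _), integral_const_mul] at h'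
  linear_combination h'

/-- The Fourier transform of a Gaussian times a linear form. -/
lemma integral_dot_mul_gauss_mul_e {Ω : Matrix (Fin g) (Fin g) ℂ} (hΩ : Ω.IsSymm)
    (hpos : ∀ x : Fin g → ℝ, x ≠ 0 → 0 < x ⬝ᵥ (imPart Ω *ᵥ x)) (l : Fin g → ℂ) (ξ : Fin g → ℝ) :
    ∫ x, (l ⬝ᵥ realVec x) * (gauss Ω x * e (realVec ξ ⬝ᵥ realVec x)) =
      (l ⬝ᵥ (-Ω⁻¹ *ᵥ realVec ξ)) * ((∫ x, gauss Ω x) * gauss (-Ω⁻¹) ξ) := by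
  rw [← integral_gauss_mul_e hΩ hpos]
  set G : (Fin g → ℝ) → ℂ := fun x => gauss Ω x * e (realVec ξ ⬝ᵥ realVec x)
  have hu : IsUnit Ω.det := isUnit_iff_ne_zero.2 (det_ne_zero_of_pos hΩ hpos)
  set w := Ω⁻¹ *ᵥ l with hw
  have hdec : w = realVec (reVec w) + Complex.I • realVec (imVec w) := by
    ext i
    simp only [realVec, reVec, imVec, Pi.add_apply, Pi.smul_apply, smul_eq_mul]
    rw [mul_comm, Complex.re_add_im]
  have hl : ∀ x : Fin g → ℂ, l ⬝ᵥ x = realVec (reVec w) ⬝ᵥ (Ω *ᵥ x) +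
      Complex.I * (realVec (imVec w) ⬝ᵥ (Ω *ᵥ x)) := by
    intro x
    have : l = Ω *ᵥ w := by rw [hw, mulVec_mulVec, mul_nonsing_inv _ hu, one_mulVec]
    rw [this, dotProduct_comm, ← dotProduct_mulVec_symm hΩ]
    conv_lhs => rw [dotProduct_mulVec_symm hΩ, dotProduct_mulVec_symm hΩ, hdec]
    rw [add_dotProduct, smul_dotProduct, smul_eq_mul]
  have hd : ∀ w x, realVec w ⬝ᵥ (Ω *ᵥ realVec x) = (Ω *ᵥ realVec w) ⬝ᵥ realVec x := fun w x => by
    rw [dotProduct_mulVec, ← mulVec_transpose, hΩ.eq]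
  have i2 : ∀ w : Fin g → ℝ, Integrable fun x => (realVec w ⬝ᵥ (Ω *ᵥ realVec x)) * G x := by
    intro w
    simp only [hd]
    exact integrable_dot_mul_gauss_mul_e hpos _ ξ
  have h1 := integral_lineDeriv_gauss hΩ hpos ξ (reVec w)
  have h2 := integral_lineDeriv_gauss hΩ hpos ξ (imVec w)
  simp only [hl, add_mul, mul_assoc]
  rw [integral_add (i2 _) ((i2 _).const_mul _), integral_const_mul]
  change _ + _ * ∫ x, _ * G x = _
  rw [h1, h2]
  have h3 : ∀ y : Fin g → ℂ, y ⬝ᵥ (Ω *ᵥ (-Ω⁻¹ *ᵥ realVec ξ)) = -(realVec ξ ⬝ᵥ y) := by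
    intro y
    rw [mulVec_mulVec, Matrix.mul_neg, mul_nonsing_inv _ hu, neg_mulVec, one_mulVec,
      dotProduct_neg, dotProduct_comm]
  rw [h3, h3]

end

/-! ### Twists and the duality between `Ω` and `-Ω⁻¹` -/

section

variable {g : ℕ}

/-- The matrix `Ω - (2i / cᵀMc) M c cᵀ M`, with `M = Im Ω`; for `c ∈ R_M` its imaginary part is
positive definite. -/
noncomputable def twist (Ω : Matrix (Fin g) (Fin g) ℂ) (c : Fin g → ℂ) :
    Matrix (Fin g) (Fin g) ℂ :=
  Ω - (2 * Complex.I / bil (imPart Ω) c c) •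
    (realMat (imPart Ω) * vecMulVec c c * realMat (imPart Ω))

lemma imPart_isSymm {Ω : Matrix (Fin g) (Fin g) ℂ} (hΩ : Ω.IsSymm) : (imPart Ω).IsSymm := by
  unfold Matrix.IsSymm imPart
  rw [← transpose_map, hΩ.eq]

lemma twist_eq {Ω : Matrix (Fin g) (Fin g) ℂ} (hΩ : Ω.IsSymm) (c : Fin g → ℂ) :
    twist Ω c = Ω - (2 * Complex.I / bil (imPart Ω) c c) •
      vecMulVec (realMat (imPart Ω) *ᵥ c) (realMat (imPart Ω) *ᵥ c) := by
  unfold twist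
  rw [mul_vecMulVec, vecMulVec_mul, ← mulVec_transpose,
    (realMat_isSymm (imPart_isSymm hΩ)).eq]

lemma vecMulVec_mulVec' (a b x : Fin g → ℂ) : vecMulVec a b *ᵥ x = (b ⬝ᵥ x) • a := by
  rw [vecMulVec_mulVec]
  ext i
  simp [mul_comm]

lemma twist_isSymm {Ω : Matrix (Fin g) (Fin g) ℂ} (hΩ : Ω.IsSymm) (c : Fin g → ℂ) :
    (twist Ω c).IsSymm := by
  rw [twist_eq hΩ]
  unfold Matrix.IsSymm
  rw [transpose_sub, transpose_smul, transpose_vecMulVec, hΩ.eq]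

lemma realMat_mulVec_dot {M : Matrix (Fin g) (Fin g) ℝ} (hM : M.IsSymm) (c x : Fin g → ℂ) :
    (realMat M *ᵥ c) ⬝ᵥ x = bil M c x := by
  rw [dotProduct_comm]
  exact (bil_symm hM x c)

lemma dot_twist {Ω : Matrix (Fin g) (Fin g) ℂ} (hΩ : Ω.IsSymm) (c x : Fin g → ℂ) :
    x ⬝ᵥ (twist Ω c *ᵥ x) =
      x ⬝ᵥ (Ω *ᵥ x) - 2 * Complex.I / bil (imPart Ω) c c * bil (imPart Ω) c x ^ 2 := by
  rw [twist_eq hΩ, sub_mulVec, smul_mulVec, vecMulVec_mulVec', dotProduct_sub, dotProduct_smul,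
    dotProduct_smul, dotProduct_comm x (realMat _ *ᵥ c), realMat_mulVec_dot (imPart_isSymm hΩ)]
  simp only [smul_eq_mul]
  ring

/-- The Gaussian factor `e^{-πα²}` of the derivative of the incomplete Gaussian transform turns
`e(½ xᵀΩx)` into the Gaussian of `twist Ω c`. -/
lemma exp_alpha_mul_gauss {Ω : Matrix (Fin g) (Fin g) ℂ} (hΩ : Ω.IsSymm)
    (hM : Lorentzian (imPart Ω)) {v : Fin g → ℝ} (hv : v ∈ negReal (imPart Ω)) {c : Fin g → ℂ}
    (hc : c ∈ negRegion (imPart Ω)) (x : Fin g → ℝ) :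
    Complex.exp (-Real.pi * alpha (imPart Ω) v c x ^ 2) * gauss Ω x = gauss (twist Ω c) x := by
  unfold gauss e
  rw [← Complex.exp_add, dot_twist hΩ, alpha_sq hM hv hc]
  congr 1
  have := hM.bil_self_ne_zero hv hc
  field_simp
  linear_combination (2 * bil (imPart Ω) c (realVec x) ^ 2) * Complex.I_sq

lemma twist_im_pos {Ω : Matrix (Fin g) (Fin g) ℂ} (hΩ : Ω.IsSymm)
    (hM : Lorentzian (imPart Ω)) {v : Fin g → ℝ} (hv : v ∈ negReal (imPart Ω)) {c : Fin g → ℂ}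
    (hc : c ∈ negRegion (imPart Ω)) (x : Fin g → ℝ) (hx : x ≠ 0) :
    0 < x ⬝ᵥ (imPart (twist Ω c) *ᵥ x) := by
  rw [← im_dotProduct_mulVec, dot_twist hΩ, Complex.sub_im, im_dotProduct_mulVec]
  have h := hM.twisted_pos hv hc hx
  have e1 : 2 * Complex.I / bil (imPart Ω) c c * bil (imPart Ω) c (realVec x) ^ 2 =
      ((2 : ℝ) : ℂ) * (Complex.I * (bil (imPart Ω) c (realVec x) ^ 2 / bil (imPart Ω) c c)) := by
    push_cast; ring
  rw [e1, Complex.im_ofReal_mul, Complex.I_mul_im]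
  exact h

/-- Two rank one modifications of matrices `W`, `Ω` with `WΩ = -1` whose product is again `-1`. -/
lemma rank_one_mul_rank_one {W Ω : Matrix (Fin g) (Fin g) ℂ} (hΩ : Ω.IsSymm) (hWΩ : W * Ω = -1)
    {m k : Fin g → ℂ} {a b : ℂ} (ha : a ≠ 0) (hb : b ≠ 0) (hk : k = -(Ω *ᵥ m))
    (hmk : m ⬝ᵥ k = Complex.I * (b - a) / 2) :
    (W - (2 * Complex.I / a) • vecMulVec m m) * (Ω - (2 * Complex.I / b) • vecMulVec k k) = -1 := by
  have h1 : W * vecMulVec k k = vecMulVec m k := by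
    rw [mul_vecMulVec, hk, mulVec_neg, mulVec_mulVec, hWΩ, neg_mulVec, one_mulVec, neg_neg]
  have h2 : vecMulVec m m * Ω = -vecMulVec m k := by
    rw [vecMulVec_mul, ← mulVec_transpose, hΩ.eq, hk, vecMulVec_neg, neg_neg]
  have h3 : vecMulVec m m * vecMulVec k k = (m ⬝ᵥ k) • vecMulVec m k := by
    rw [vecMulVec_mul_vecMulVec, vecMulVec_smul]
  rw [Matrix.sub_mul, Matrix.mul_sub, Matrix.mul_sub, Matrix.smul_mul, Matrix.smul_mul,
    Matrix.mul_smul, Matrix.mul_smul, h1, h2, h3, hWΩ, hmk]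
  have : (2 * Complex.I / b) + -(2 * Complex.I / a) -
      (2 * Complex.I / a) * ((2 * Complex.I / b) * (Complex.I * (b - a) / 2)) = 0 := by
    field_simp
    linear_combination 2 * Complex.I * (a - b) * Complex.I_sq
  ext i j
  simp only [Matrix.sub_apply, Matrix.neg_apply, Matrix.smul_apply, smul_eq_mul]
  linear_combination (-vecMulVec m k i j) * this

section duality

variable {Ω : Matrix (Fin g) (Fin g) ℂ}

lemma conjMat_mul (A B : Matrix (Fin g) (Fin g) ℂ) : conjMat (A * B) = conjMat A * conjMat B :=
  Matrix.map_mul (f := starRingEnd ℂ)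

lemma conjMat_neg_inv (hu : IsUnit Ω.det) : conjMat (-Ω⁻¹) = -(conjMat Ω)⁻¹ := by
  have h : conjMat Ω * conjMat Ω⁻¹ = 1 := by
    rw [← conjMat_mul, mul_nonsing_inv _ hu]
    ext i j
    by_cases h : i = j
    · subst h; simp [conjMat]
    · simp [conjMat, h]
  rw [Matrix.inv_eq_right_inv h]
  ext i j
  simp [conjMat]

lemma two_I_smul_realMat_imPart (Ω : Matrix (Fin g) (Fin g) ℂ) :
    (2 * Complex.I) • realMat (imPart Ω) = Ω - conjMat Ω := by
  ext i j
  simp only [realMat, imPart, conjMat, Matrix.smul_apply, Matrix.sub_apply, map_apply, smul_eq_mul]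
  rw [Complex.sub_conj]
  push_cast
  ring

lemma isSymm_neg_inv (hΩ : Ω.IsSymm) : (-Ω⁻¹).IsSymm := by
  unfold Matrix.IsSymm
  rw [transpose_neg, transpose_nonsing_inv, hΩ.eq]

/-- `Im(Ω) W̄ = -Ω Im(W)` for `W = -Ω⁻¹`. -/
lemma realMat_mul_conjMat (hu : IsUnit Ω.det) :
    realMat (imPart Ω) * conjMat (-Ω⁻¹) = -(Ω * realMat (imPart (-Ω⁻¹))) := by
  have h1 := two_I_smul_realMat_imPart Ω
  have h2 := two_I_smul_realMat_imPart (-Ω⁻¹)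
  have h3 : conjMat Ω * conjMat (-Ω⁻¹) = -1 := by
    rw [← conjMat_mul, Matrix.mul_neg, mul_nonsing_inv _ hu]
    ext i j
    by_cases h : i = j
    · subst h; simp [conjMat]
    · simp [conjMat, h]
  have hI : (2 * Complex.I) ≠ 0 := by simp
  apply smul_right_injective _ hI
  simp only
  rw [← Matrix.smul_mul, h1, smul_neg, ← Matrix.mul_smul, h2, Matrix.sub_mul, Matrix.mul_sub, h3,
    Matrix.mul_neg, mul_nonsing_inv _ hu]
  abel

lemma mulVec_conj (hu : IsUnit Ω.det) (c : Fin g → ℂ) :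
    realMat (imPart Ω) *ᵥ (conjMat (-Ω⁻¹) *ᵥ c) = -(Ω *ᵥ (realMat (imPart (-Ω⁻¹)) *ᵥ c)) := by
  rw [mulVec_mulVec, realMat_mul_conjMat hu, neg_mulVec, mulVec_mulVec]

/-- `(Wa)ᵀ Im(Ω) (W̄b) = aᵀ Im(W) b` for `W = -Ω⁻¹`. -/
lemma bil_mulVec_conj (hΩ : Ω.IsSymm) (hu : IsUnit Ω.det) (a b : Fin g → ℂ) :
    bil (imPart Ω) (-Ω⁻¹ *ᵥ a) (conjMat (-Ω⁻¹) *ᵥ b) = bil (imPart (-Ω⁻¹)) a b := by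
  unfold bil
  rw [mulVec_conj hu, dotProduct_comm, ← dotProduct_mulVec_symm (isSymm_neg_inv hΩ) a,
    mulVec_neg, mulVec_mulVec, Matrix.neg_mul, nonsing_inv_mul _ hu, neg_mulVec, one_mulVec,
    neg_neg]

lemma star_conjMat_mulVec (A : Matrix (Fin g) (Fin g) ℂ) (c : Fin g → ℂ) :
    star (conjMat A *ᵥ c) = A *ᵥ star c := by
  ext i
  simp [conjMat, mulVec, dotProduct]

lemma conj_mem_negRegion (hΩ : Ω.IsSymm) (hu : IsUnit Ω.det) {c : Fin g → ℂ}
    (hc : c ∈ negRegion (imPart (-Ω⁻¹))) : conjMat (-Ω⁻¹) *ᵥ c ∈ negRegion (imPart Ω) := by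
  change (bil _ _ _).re < 0
  rw [star_conjMat_mulVec, bil_mulVec_conj hΩ hu]
  exact hc

/-- `Im(-Ω⁻¹)` is again Lorentzian, being Hermitian congruent to `Im Ω`. -/
lemma Lorentzian.neg_inv (hΩ : Ω.IsSymm) (hu : IsUnit Ω.det) (hM : Lorentzian (imPart Ω))
    {v : Fin g → ℝ} (hv : v ∈ negReal (imPart Ω)) : Lorentzian (imPart (-Ω⁻¹)) := by
  refine ⟨imPart_isSymm (isSymm_neg_inv hΩ), fun w x hw hwx hx => ?_⟩
  have hwc := conj_mem_negRegion hΩ hu (c := realVec w) (Lorentzian.realVec_mem_negRegion hw)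
  have hstar : ∀ y : Fin g → ℝ, star (realVec y) = realVec y := fun y => by
    ext i; simp [realVec]
  have h := hM.hermitian_pos hv hwc (x := conjMat (-Ω⁻¹) *ᵥ realVec x) (by
    rw [star_conjMat_mulVec, bil_mulVec_conj hΩ hu, hstar, bil_realVec, hwx]; simp) ?_
  · rw [star_conjMat_mulVec, bil_mulVec_conj hΩ hu, hstar, bil_realVec] at h
    simpa using h
  · intro h0
    have h1 : -Ω⁻¹ *ᵥ realVec x = 0 := by
      have := star_conjMat_mulVec (-Ω⁻¹) (realVec x)
      rw [h0, hstar] at this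
      simpa using this.symm
    have h2 : realVec x = 0 := by
      have : Ω *ᵥ (-Ω⁻¹ *ᵥ realVec x) = 0 := by rw [h1, mulVec_zero]
      rw [mulVec_mulVec, Matrix.mul_neg, mul_nonsing_inv _ hu, neg_mulVec, one_mulVec] at this
      simpa using this
    exact hx (by rw [← reVec_realVec x, h2]; ext i; simp [reVec])

/-- The pairing of `Im(W) u` with `Im(Ω) W̄c`, for `W = -Ω⁻¹`; it follows from
`2i Im W = W - W̄`. -/
lemma dot_conj (hΩ : Ω.IsSymm) (hu : IsUnit Ω.det) (c u : Fin g → ℂ) :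
    (realMat (imPart (-Ω⁻¹)) *ᵥ u) ⬝ᵥ (realMat (imPart Ω) *ᵥ (conjMat (-Ω⁻¹) *ᵥ c)) =
      Complex.I * (bil (imPart Ω) (conjMat (-Ω⁻¹) *ᵥ u) (conjMat (-Ω⁻¹) *ᵥ c) -
        bil (imPart (-Ω⁻¹)) u c) / 2 := by
  have h2 := two_I_smul_realMat_imPart (-Ω⁻¹)
  set k := realMat (imPart Ω) *ᵥ (conjMat (-Ω⁻¹) *ᵥ c) with hk
  have hWk : -Ω⁻¹ *ᵥ k = realMat (imPart (-Ω⁻¹)) *ᵥ c := by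
    rw [hk, mulVec_conj hu, mulVec_neg, mulVec_mulVec, Matrix.neg_mul, nonsing_inv_mul _ hu,
      neg_mulVec, one_mulVec, neg_neg]
  have h3 : (2 * Complex.I) * ((realMat (imPart (-Ω⁻¹)) *ᵥ u) ⬝ᵥ k) =
      bil (imPart (-Ω⁻¹)) u c - bil (imPart Ω) (conjMat (-Ω⁻¹) *ᵥ u) (conjMat (-Ω⁻¹) *ᵥ c) := by
    rw [← smul_eq_mul, ← smul_dotProduct, ← smul_mulVec, h2, sub_mulVec, sub_dotProduct]
    congr 1
    rw [dotProduct_comm, dotProduct_mulVec_symm (isSymm_neg_inv hΩ), hWk]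
    rfl
  linear_combination (-Complex.I / 2) * h3 +
    ((realMat (imPart (-Ω⁻¹)) *ᵥ u) ⬝ᵥ k) * Complex.I_sq

/-- The twists of `-Ω⁻¹` and of `Ω` along corresponding vectors are again negative inverses of
each other. -/
lemma twist_neg_inv (hΩ : Ω.IsSymm) (hu : IsUnit Ω.det) {c : Fin g → ℂ}
    (ha : bil (imPart (-Ω⁻¹)) c c ≠ 0)
    (hb : bil (imPart Ω) (conjMat (-Ω⁻¹) *ᵥ c) (conjMat (-Ω⁻¹) *ᵥ c) ≠ 0) :
    -(twist (-Ω⁻¹) c)⁻¹ = twist Ω (conjMat (-Ω⁻¹) *ᵥ c) := by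
  have h := rank_one_mul_rank_one (W := -Ω⁻¹) hΩ
    (by rw [Matrix.neg_mul, nonsing_inv_mul _ hu]) ha hb (mulVec_conj hu c) (dot_conj hΩ hu c c)
  rw [← twist_eq (isSymm_neg_inv hΩ), ← twist_eq hΩ] at h
  rw [neg_eq_iff_eq_neg]
  refine Matrix.inv_eq_right_inv ?_
  rw [Matrix.mul_neg, h, neg_neg]

/-- The determinant of a rank one modification. -/
lemma det_sub_smul_vecMulVec {W : Matrix (Fin g) (Fin g) ℂ} {m k : Fin g → ℂ} (hm : m = W *ᵥ k)
    (r : ℂ) : (W - r • vecMulVec m m).det = W.det * (1 - r * (m ⬝ᵥ k)) := by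
  have h1 : W - r • vecMulVec m m =
      W * (1 + replicateCol Unit (-(r • k)) * replicateRow Unit m) := by
    rw [Matrix.mul_add, Matrix.mul_one, ← vecMulVec_eq, mul_vecMulVec, mulVec_neg, mulVec_smul,
      ← hm, neg_vecMulVec, smul_vecMulVec, sub_eq_add_neg]
  rw [h1, det_mul, det_one_add_replicateCol_mul_replicateRow, dotProduct_neg, dotProduct_smul,
    smul_eq_mul, sub_eq_add_neg]

lemma det_twist (hΩ : Ω.IsSymm) (hu : IsUnit Ω.det) {c : Fin g → ℂ}
    (ha : bil (imPart (-Ω⁻¹)) c c ≠ 0) :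
    (twist (-Ω⁻¹) c).det = (-Ω⁻¹).det *
      (bil (imPart Ω) (conjMat (-Ω⁻¹) *ᵥ c) (conjMat (-Ω⁻¹) *ᵥ c) / bil (imPart (-Ω⁻¹)) c c) := by
  have hWk : realMat (imPart (-Ω⁻¹)) *ᵥ c =
      -Ω⁻¹ *ᵥ (realMat (imPart Ω) *ᵥ (conjMat (-Ω⁻¹) *ᵥ c)) := by
    rw [mulVec_conj hu, mulVec_neg, mulVec_mulVec, Matrix.neg_mul, nonsing_inv_mul _ hu,
      neg_mulVec, one_mulVec, neg_neg]
  rw [twist_eq (isSymm_neg_inv hΩ), det_sub_smul_vecMulVec hWk, dot_conj hΩ hu]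
  congr 1
  field_simp
  linear_combination (bil (imPart (-Ω⁻¹)) c c - bil (imPart Ω) (conjMat (-Ω⁻¹) *ᵥ c)
    (conjMat (-Ω⁻¹) *ᵥ c)) * Complex.I_sq

/-- The linear form in the numerator of `alphaDeriv`. -/
noncomputable def alphaForm (M : Matrix (Fin g) (Fin g) ℝ) (c u : Fin g → ℂ) : Fin g → ℂ :=
  bil M u c • (realMat M *ᵥ c) - bil M c c • (realMat M *ᵥ u)

lemma alphaDeriv_eq {M : Matrix (Fin g) (Fin g) ℝ} (hM : M.IsSymm) (v : Fin g → ℝ)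
    (c u : Fin g → ℂ) (x : Fin g → ℝ) :
    alphaDeriv M v c u x = (alphaForm M c u ⬝ᵥ realVec x) / (2 * sqrtHalfNeg M v c ^ 3) := by
  unfold alphaDeriv alphaForm
  rw [sub_dotProduct, smul_dotProduct, smul_dotProduct, realMat_mulVec_dot hM,
    realMat_mulVec_dot hM, smul_eq_mul, smul_eq_mul]
  ring

/-- The twist of `Ω` carries the linear form for `-Ω⁻¹` to a multiple of the one for `Ω`. -/
lemma twist_mulVec_alphaForm (hΩ : Ω.IsSymm) (hu : IsUnit Ω.det) (c u : Fin g → ℂ)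
    (hb : bil (imPart Ω) (conjMat (-Ω⁻¹) *ᵥ c) (conjMat (-Ω⁻¹) *ᵥ c) ≠ 0) :
    twist Ω (conjMat (-Ω⁻¹) *ᵥ c) *ᵥ alphaForm (imPart (-Ω⁻¹)) c u =
      -(bil (imPart (-Ω⁻¹)) c c /
        bil (imPart Ω) (conjMat (-Ω⁻¹) *ᵥ c) (conjMat (-Ω⁻¹) *ᵥ c)) •
        alphaForm (imPart Ω) (conjMat (-Ω⁻¹) *ᵥ c) (conjMat (-Ω⁻¹) *ᵥ u) := by
  have hm : ∀ y, Ω *ᵥ (realMat (imPart (-Ω⁻¹)) *ᵥ y) =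
      -(realMat (imPart Ω) *ᵥ (conjMat (-Ω⁻¹) *ᵥ y)) := fun y => by rw [mulVec_conj hu, neg_neg]
  have hd := dot_conj hΩ hu c
  rw [twist_eq hΩ]
  unfold alphaForm
  rw [sub_mulVec, smul_mulVec, vecMulVec_mulVec', mulVec_sub, mulVec_smul, mulVec_smul, hm, hm,
    dotProduct_sub, dotProduct_smul, dotProduct_smul,
    dotProduct_comm _ (realMat (imPart (-Ω⁻¹)) *ᵥ c),
    dotProduct_comm _ (realMat (imPart (-Ω⁻¹)) *ᵥ u), hd, hd]
  ext i
  simp only [Pi.sub_apply, Pi.smul_apply, Pi.neg_apply, smul_eq_mul]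
  field_simp
  generalize (realMat (imPart Ω) *ᵥ (conjMat (-Ω⁻¹) *ᵥ c)) i = kc
  generalize (realMat (imPart Ω) *ᵥ (conjMat (-Ω⁻¹) *ᵥ u)) i = ku
  generalize bil (imPart Ω) (conjMat (-Ω⁻¹) *ᵥ c) (conjMat (-Ω⁻¹) *ᵥ c) = b at *
  generalize bil (imPart Ω) (conjMat (-Ω⁻¹) *ᵥ u) (conjMat (-Ω⁻¹) *ᵥ c) = b'
  generalize bil (imPart (-Ω⁻¹)) c c = a
  generalize bil (imPart (-Ω⁻¹)) u c = a'
  ring_nf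
  simp only [Complex.I_sq]
  ring

end duality

end

/-! ### The square root of `det(iΩ⁻¹)` -/

section

variable {g : ℕ} {Ω : Matrix (Fin g) (Fin g) ℂ} {v w : Fin g → ℝ}

lemma continuousOn_gauss_twist (hΩ : Ω.IsSymm) (hM : Lorentzian (imPart Ω))
    (hv : v ∈ negReal (imPart Ω)) :
    ContinuousOn (fun p : (Fin g → ℂ) × (Fin g → ℝ) => gauss (twist Ω p.1) p.2)
      (negRegion (imPart Ω) ×ˢ Set.univ) := by
  unfold gauss
  simp only [dot_twist hΩ]
  have h1 : Continuous fun p : (Fin g → ℂ) × (Fin g → ℝ) => bil (imPart Ω) p.1 p.1 :=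
    (continuous_bil _).comp (continuous_fst.prodMk continuous_fst)
  have h2 : Continuous fun p : (Fin g → ℂ) × (Fin g → ℝ) => bil (imPart Ω) p.1 (realVec p.2) :=
    (continuous_bil _).comp (continuous_fst.prodMk (continuous_realVec.comp continuous_snd))
  have h3 : Continuous fun p : (Fin g → ℂ) × (Fin g → ℝ) =>
      realVec p.2 ⬝ᵥ (Ω *ᵥ realVec p.2) := by
    unfold realVec mulVec dotProduct; fun_prop
  refine continuous_e.comp_continuousOn (continuousOn_const.mul (h3.continuousOn.sub
    (ContinuousOn.mul (continuousOn_const.div h1.continuousOn fun p hp => ?_)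
      (h2.pow 2).continuousOn)))
  exact hM.bil_self_ne_zero hv hp.1

/-- The Gaussians of the twists of `Ω` decay uniformly over compact subsets of `R_{Im Ω}`. -/
lemma exists_norm_gauss_twist_le (hΩ : Ω.IsSymm) (hM : Lorentzian (imPart Ω))
    (hv : v ∈ negReal (imPart Ω)) {K : Set (Fin g → ℂ)} (hK : IsCompact K)
    (hKR : K ⊆ negRegion (imPart Ω)) :
    ∃ δ : ℝ, 0 < δ ∧ ∀ c ∈ K, ∀ x, ‖gauss (twist Ω c) x‖ ≤ 1 * Real.exp (-δ * (x ⬝ᵥ x)) := by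
  have hform : ∀ c x, x ⬝ᵥ (imPart (twist Ω c) *ᵥ x) =
      x ⬝ᵥ (imPart Ω *ᵥ x) -
        (2 * Complex.I / bil (imPart Ω) c c * bil (imPart Ω) c (realVec x) ^ 2).im := fun c x => by
    rw [← im_dotProduct_mulVec, dot_twist hΩ, Complex.sub_im, im_dotProduct_mulVec]
  have h1 : Continuous fun p : (Fin g → ℂ) × (Fin g → ℝ) => bil (imPart Ω) p.1 p.1 :=
    (continuous_bil _).comp (continuous_fst.prodMk continuous_fst)
  have h2 : Continuous fun p : (Fin g → ℂ) × (Fin g → ℝ) => bil (imPart Ω) p.1 (realVec p.2) :=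
    (continuous_bil _).comp (continuous_fst.prodMk (continuous_realVec.comp continuous_snd))
  have hφ : ContinuousOn (fun p : (Fin g → ℂ) × (Fin g → ℝ) =>
      p.2 ⬝ᵥ (imPart (twist Ω p.1) *ᵥ p.2)) (K ×ˢ Set.univ) := by
    simp only [hform]
    refine (((continuous_dotProduct_mulVec _).comp continuous_snd).continuousOn).sub
      (Complex.continuous_im.comp_continuousOn (ContinuousOn.mul
        (continuousOn_const.div h1.continuousOn fun p hp => ?_) (h2.pow 2).continuousOn))
    exact hM.bil_self_ne_zero hv (hKR hp.1)
  obtain ⟨δ, hδ, h⟩ := exists_pos_mul_le_of_homogeneous hK hφ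
    (fun _ _ r x => by simp only [mulVec_smul, dotProduct_smul, smul_dotProduct, smul_eq_mul]; ring)
    (fun c hc x hx => twist_im_pos hΩ hM hv (hKR hc) x hx)
  refine ⟨δ, hδ, fun c hc x => ?_⟩
  rw [norm_gauss, one_mul, Real.exp_le_exp]
  have h3 := h c hc x
  have h4 : 0 ≤ x ⬝ᵥ (imPart (twist Ω c) *ᵥ x) :=
    (mul_nonneg hδ.le (dotProduct_self_nonneg' x)).trans h3
  nlinarith [Real.pi_gt_three]

lemma continuousOn_integral_gauss_twist (hΩ : Ω.IsSymm) (hM : Lorentzian (imPart Ω))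
    (hv : v ∈ negReal (imPart Ω)) {K : Set (Fin g → ℂ)} (hK : IsCompact K)
    (hKR : K ⊆ negRegion (imPart Ω)) :
    ContinuousOn (fun c => ∫ x, gauss (twist Ω c) x) K := by
  obtain ⟨δ, hδ, h⟩ := exists_norm_gauss_twist_le hΩ hM hv hK hKR
  refine continuousOn_of_dominated (bound := fun x => 1 * Real.exp (-δ * (x ⬝ᵥ x)))
    (fun c _ => (continuous_gauss _).aestronglyMeasurable)
    (fun c hc => Filter.Eventually.of_forall (h c hc))
    ((integrable_exp_neg_dotProduct hδ).const_mul _) (Filter.Eventually.of_forall fun x => ?_)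
  have hpair : Continuous fun c : Fin g → ℂ => (c, x) := by fun_prop
  exact (continuousOn_gauss_twist hΩ hM hv).comp (f := fun c => (c, x)) hpair.continuousOn
    fun c hc => Set.mk_mem_prod (hKR hc) (Set.mem_univ x)

/-- The inverse of `√det(iΩ⁻¹)`, formed with the auxiliary vector `c ∈ R_{Im(-Ω⁻¹)}`. -/
noncomputable def invSqrtDet (w v : Fin g → ℝ) (Ω : Matrix (Fin g) (Fin g) ℂ)
    (c : Fin g → ℂ) : ℂ :=
  sqrtHalfNeg (imPart Ω) v (conjMat (-Ω⁻¹) *ᵥ c) / sqrtHalfNeg (imPart (-Ω⁻¹)) w c *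
    ∫ x, gauss (twist (-Ω⁻¹) c) x

lemma neg_inv_neg_inv (hu : IsUnit Ω.det) : -(-Ω⁻¹)⁻¹ = Ω := by
  rw [neg_eq_iff_eq_neg]
  refine Matrix.inv_eq_right_inv ?_
  rw [neg_mul_neg, nonsing_inv_mul _ hu]

lemma inv_sqrtDet (hu : IsUnit Ω.det) (c : Fin g → ℂ) :
    (sqrtDet w v (-Ω⁻¹) c)⁻¹ = invSqrtDet w v Ω c := by
  unfold sqrtDet invSqrtDet sqrtHalfNeg
  rw [neg_inv_neg_inv hu, mul_div_mul_left _ _ (by simp)]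
  change (_ * (∫ x, gauss (twist (-Ω⁻¹) c) x)⁻¹ / _)⁻¹ = _
  rw [inv_div, div_mul_eq_div_div, div_inv_eq_mul]

lemma invSqrtDet_sq (hΩ : Ω.IsSymm) (hu : IsUnit Ω.det) (hM : Lorentzian (imPart Ω))
    (hv : v ∈ negReal (imPart Ω)) (hw : w ∈ negReal (imPart (-Ω⁻¹))) {c : Fin g → ℂ}
    (hc : c ∈ negRegion (imPart (-Ω⁻¹))) :
    invSqrtDet w v Ω c ^ 2 * ((-Complex.I) ^ g * (-Ω⁻¹).det) = 1 := by
  have hM' := Lorentzian.neg_inv hΩ hu hM hv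
  have hc' := conj_mem_negRegion hΩ hu hc
  have ha := hM'.bil_self_ne_zero hw hc
  have h := integral_gauss_sq_mul_det (twist_isSymm (isSymm_neg_inv hΩ) c)
    (twist_im_pos (isSymm_neg_inv hΩ) hM' hw hc)
  rw [det_twist hΩ hu ha] at h
  unfold invSqrtDet
  rw [mul_pow, div_pow, sqrtHalfNeg_sq hM hv hc', sqrtHalfNeg_sq hM' hw hc, ← h]
  field_simp

/-- The inverse square root does not depend on the auxiliary vector: its square is constant, it is
continuous along segments from `w`, and it does not change when the vector is rescaled. -/
lemma invSqrtDet_eq (hΩ : Ω.IsSymm) (hu : IsUnit Ω.det) (hM : Lorentzian (imPart Ω))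
    (hv : v ∈ negReal (imPart Ω)) (hw : w ∈ negReal (imPart (-Ω⁻¹))) {c : Fin g → ℂ}
    (hc : c ∈ negRegion (imPart (-Ω⁻¹))) :
    invSqrtDet w v Ω c = invSqrtDet w v Ω (realVec w) := by
  have hM' := Lorentzian.neg_inv hΩ hu hM hv
  obtain ⟨k, u, hk, hwu, rfl⟩ := hM'.exists_smul_add hw hc
  rw [Lorentzian.smul_mem_negRegion_iff hk] at hc
  have hscale : invSqrtDet w v Ω (k • (realVec w + u)) = invSqrtDet w v Ω (realVec w + u) := by
    have htw : twist (-Ω⁻¹) (k • (realVec w + u)) = twist (-Ω⁻¹) (realVec w + u) := by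
      have := hM'.bil_self_ne_zero hw hc
      rw [twist_eq (isSymm_neg_inv hΩ), twist_eq (isSymm_neg_inv hΩ), mulVec_smul,
        smul_vecMulVec, vecMulVec_smul, smul_smul, smul_smul, bil_smul_left, bil_smul_right]
      congr 2
      field_simp
    unfold invSqrtDet sqrtHalfNeg
    rw [htw, mulVec_smul, sqrtNeg_smul hk, sqrtNeg_smul hk, mul_left_comm, mul_left_comm _ k,
      mul_div_mul_left _ _ hk]
  rw [hscale]
  set K := (fun t : ℝ => realVec w + (t : ℂ) • u) '' Set.Icc (0 : ℝ) 1 with hKdef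
  have hcont : Continuous fun t : ℝ => realVec w + (t : ℂ) • u := by fun_prop
  have hK : IsCompact K := isCompact_Icc.image hcont
  have hKR : K ⊆ negRegion (imPart (-Ω⁻¹)) := by
    rintro _ ⟨t, ht, rfl⟩
    exact hM'.segment_mem hw hwu hc ht
  have hconj : Continuous fun c : Fin g → ℂ => conjMat (-Ω⁻¹) *ᵥ c := by fun_prop
  have hKc : ContinuousOn (invSqrtDet w v Ω) K := by
    unfold invSqrtDet
    refine ContinuousOn.mul (ContinuousOn.div ?_ ((continuousOn_sqrtHalfNeg hM' hw).mono hKR)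
      fun c hc => sqrtHalfNeg_ne_zero hM' hw (hKR hc))
      (continuousOn_integral_gauss_twist (isSymm_neg_inv hΩ) hM' hw hK hKR)
    exact (continuousOn_sqrtHalfNeg hM hv).comp hconj.continuousOn
      fun c hc => conj_mem_negRegion hΩ hu (hKR hc)
  have hw0 : realVec w ∈ K := ⟨0, by simp, by simp⟩
  have hw1 : realVec w + u ∈ K := ⟨1, by simp, by simp⟩
  have hsq : ∀ c ∈ K, invSqrtDet w v Ω c ^ 2 = ((-Complex.I) ^ g * (-Ω⁻¹).det)⁻¹ := fun c hc =>
    eq_inv_of_mul_eq_one_left (invSqrtDet_sq hΩ hu hM hv hw (hKR hc))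
  refine (isPreconnected_Icc.image _ hcont.continuousOn).eq_of_sq_eq hKc
    (continuousOn_const (c := invSqrtDet w v Ω (realVec w))) (fun c hc => ?_) (fun _ h0 => ?_)
    hw0 rfl hw1
  · simp only [Pi.pow_apply]
    rw [hsq c hc, hsq _ hw0]
  · have := invSqrtDet_sq hΩ hu hM hv hw (Lorentzian.realVec_mem_negRegion hw)
    rw [h0] at this
    simp at this

end

/-! ### The Fourier transform of the kernel -/

section

variable {g : ℕ} {Ω : Matrix (Fin g) (Fin g) ℂ} {v w : Fin g → ℝ}

/-- The Fourier transform of the derivative of `kern` in the parameter `c` is, up to the constant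
`invSqrtDet`, the derivative of the corresponding function for `Ω`. -/
lemma integral_alphaDeriv_mul_gauss_mul_e (hΩ : Ω.IsSymm) (hu : IsUnit Ω.det)
    (hM : Lorentzian (imPart Ω)) (hv : v ∈ negReal (imPart Ω))
    (hw : w ∈ negReal (imPart (-Ω⁻¹))) {c : Fin g → ℂ} (hc : c ∈ negRegion (imPart (-Ω⁻¹)))
    (u : Fin g → ℂ) (ξ : Fin g → ℝ) :
    ∫ x, alphaDeriv (imPart (-Ω⁻¹)) w c u x * gauss (twist (-Ω⁻¹) c) x *
        e (realVec ξ ⬝ᵥ realVec x) =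
      -invSqrtDet w v Ω c * (alphaDeriv (imPart Ω) v (conjMat (-Ω⁻¹) *ᵥ c) (conjMat (-Ω⁻¹) *ᵥ u) ξ *
        gauss (twist Ω (conjMat (-Ω⁻¹) *ᵥ c)) ξ) := by
  have hM' := Lorentzian.neg_inv hΩ hu hM hv
  have hc' := conj_mem_negRegion hΩ hu hc
  have ha := hM'.bil_self_ne_zero hw hc
  have hb := hM.bil_self_ne_zero hv hc'
  have hW := isSymm_neg_inv hΩ
  have hs := sqrtHalfNeg_sq hM' hw hc
  have hs' := sqrtHalfNeg_sq hM hv hc'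
  have hs0 := sqrtHalfNeg_ne_zero hM' hw hc
  have hs0' := sqrtHalfNeg_ne_zero hM hv hc'
  have h := integral_dot_mul_gauss_mul_e (twist_isSymm hW c) (twist_im_pos hW hM' hw hc)
    (alphaForm (imPart (-Ω⁻¹)) c u) ξ
  rw [twist_neg_inv hΩ hu ha hb, dotProduct_mulVec_symm (twist_isSymm hΩ _),
    twist_mulVec_alphaForm hΩ hu c u hb, dotProduct_smul, smul_eq_mul,
    dotProduct_comm (realVec ξ)] at h
  have e1 : ∀ x, alphaDeriv (imPart (-Ω⁻¹)) w c u x * gauss (twist (-Ω⁻¹) c) x *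
        e (realVec ξ ⬝ᵥ realVec x) = (2 * sqrtHalfNeg (imPart (-Ω⁻¹)) w c ^ 3)⁻¹ *
      ((alphaForm (imPart (-Ω⁻¹)) c u ⬝ᵥ realVec x) *
        (gauss (twist (-Ω⁻¹) c) x * e (realVec ξ ⬝ᵥ realVec x))) := fun x => by
    rw [alphaDeriv_eq hM'.1]
    ring
  simp only [e1]
  rw [integral_const_mul, h, alphaDeriv_eq hM.1]
  unfold invSqrtDet
  -- the quotient of the values of the two forms is the quotient of the squares of the two roots
  rw [show bil (imPart (-Ω⁻¹)) c c = -2 * sqrtHalfNeg (imPart (-Ω⁻¹)) w c ^ 2 by rw [hs]; ring,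
    show bil (imPart Ω) (conjMat (-Ω⁻¹) *ᵥ c) (conjMat (-Ω⁻¹) *ᵥ c) =
      -2 * sqrtHalfNeg (imPart Ω) v (conjMat (-Ω⁻¹) *ᵥ c) ^ 2 by rw [hs']; ring]
  field_simp

lemma continuousOn_alphaDeriv {M : Matrix (Fin g) (Fin g) ℝ} (hM : Lorentzian M)
    (hv : v ∈ negReal M) (u : Fin g → ℂ) :
    ContinuousOn (fun p : (Fin g → ℂ) × (Fin g → ℝ) => alphaDeriv M v p.1 u p.2)
      (negRegion M ×ˢ Set.univ) := by
  have hr : Continuous fun p : (Fin g → ℂ) × (Fin g → ℝ) => realVec p.2 :=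
    continuous_realVec.comp continuous_snd
  have h1 : Continuous fun p : (Fin g → ℂ) × (Fin g → ℝ) => bil M p.1 (realVec p.2) :=
    (continuous_bil M).comp (continuous_fst.prodMk hr)
  have h2 : Continuous fun p : (Fin g → ℂ) × (Fin g → ℝ) => bil M u p.1 :=
    (continuous_bil M).comp (continuous_const.prodMk continuous_fst)
  have h3 : Continuous fun p : (Fin g → ℂ) × (Fin g → ℝ) => bil M u (realVec p.2) :=
    (continuous_bil M).comp (continuous_const.prodMk hr)
  have h4 : Continuous fun p : (Fin g → ℂ) × (Fin g → ℝ) => bil M p.1 p.1 :=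
    (continuous_bil M).comp (continuous_fst.prodMk continuous_fst)
  have h5 : ContinuousOn (fun p : (Fin g → ℂ) × (Fin g → ℝ) => sqrtHalfNeg M v p.1)
      (negRegion M ×ˢ Set.univ) :=
    (continuousOn_sqrtHalfNeg hM hv).comp continuousOn_fst fun p hp => hp.1
  unfold alphaDeriv
  refine ContinuousOn.div ((h1.mul h2).sub (h3.mul h4)).continuousOn
    (continuousOn_const.mul (h5.pow 3)) fun p hp => ?_
  exact mul_ne_zero two_ne_zero (pow_ne_zero 3 (sqrtHalfNeg_ne_zero hM hv hp.1))

lemma continuousOn_alphaDeriv_mul_gauss (hΩ : Ω.IsSymm) (hM : Lorentzian (imPart Ω))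
    (hv : v ∈ negReal (imPart Ω)) {a u : Fin g → ℂ}
    (hseg : ∀ t ∈ Set.Icc (0 : ℝ) 1, a + (t : ℂ) • u ∈ negRegion (imPart Ω)) :
    ContinuousOn (fun p : ℝ × (Fin g → ℝ) => alphaDeriv (imPart Ω) v (a + (p.1 : ℂ) • u) u p.2 *
      gauss (twist Ω (a + (p.1 : ℂ) • u)) p.2) (Set.Icc 0 1 ×ˢ Set.univ) := by
  have hpath : Continuous fun p : ℝ × (Fin g → ℝ) => (a + (p.1 : ℂ) • u, p.2) := by fun_prop
  exact ((continuousOn_alphaDeriv hM hv u).mul (continuousOn_gauss_twist hΩ hM hv)).comp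
    (f := fun p : ℝ × (Fin g → ℝ) => (a + (p.1 : ℂ) • u, p.2)) hpath.continuousOn
    fun p hp => Set.mk_mem_prod (hseg p.1 hp.1) (Set.mem_univ _)

/-- `kern` is the integral of its derivative along a segment of parameters. -/
lemma kern_eq_integral (hΩ : Ω.IsSymm) (hM : Lorentzian (imPart Ω))
    (hv : v ∈ negReal (imPart Ω)) {a u : Fin g → ℂ}
    (hseg : ∀ t ∈ Set.Icc (0 : ℝ) 1, a + (t : ℂ) • u ∈ negRegion (imPart Ω)) (x : Fin g → ℝ) :
    kern v (fun _ => 1) a (a + u) Ω x =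
      ∫ t in (0 : ℝ)..1, alphaDeriv (imPart Ω) v (a + (t : ℂ) • u) u x *
        gauss (twist Ω (a + (t : ℂ) • u)) x := by
  have hc : ContinuousOn (fun t : ℝ => alphaDeriv (imPart Ω) v (a + (t : ℂ) • u) u x *
      gauss (twist Ω (a + (t : ℂ) • u)) x) (Set.uIcc 0 1) := by
    rw [Set.uIcc_of_le zero_le_one]
    have hpair : Continuous fun t : ℝ => (t, x) := by fun_prop
    exact (continuousOn_alphaDeriv_mul_gauss hΩ hM hv hseg).comp (f := fun t : ℝ => (t, x))
      hpair.continuousOn fun t ht => Set.mk_mem_prod ht (Set.mem_univ _)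
  have hd : ∀ t ∈ Set.uIcc (0 : ℝ) 1, HasDerivAt
      (fun t : ℝ => incGauss (fun _ => 1) (alpha (imPart Ω) v (a + (t : ℂ) • u) x) * gauss Ω x)
      (alphaDeriv (imPart Ω) v (a + (t : ℂ) • u) u x *
        gauss (twist Ω (a + (t : ℂ) • u)) x) t := by
    intro t ht
    rw [Set.uIcc_of_le zero_le_one] at ht
    have h1 := hasDerivAt_alpha hM hv (hseg t ht) x
    have h2 := (hasDerivAt_incGauss (f := fun _ => 1) (differentiable_const _)
      (alpha (imPart Ω) v (a + (t : ℂ) • u) x)).comp t h1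
    refine (h2.mul_const (gauss Ω x)).congr_deriv ?_
    rw [← exp_alpha_mul_gauss hΩ hM hv (hseg t ht)]
    ring
  rw [intervalIntegral.integral_eq_sub_of_hasDerivAt hd hc.intervalIntegrable]
  unfold kern
  simp [sub_mul]

/-- The derivative of `kern` decays uniformly along a segment. -/
lemma exists_norm_alphaDeriv_mul_gauss_le (hΩ : Ω.IsSymm) (hM : Lorentzian (imPart Ω))
    (hv : v ∈ negReal (imPart Ω)) {a u : Fin g → ℂ}
    (hseg : ∀ t ∈ Set.Icc (0 : ℝ) 1, a + (t : ℂ) • u ∈ negRegion (imPart Ω)) :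
    ∃ C δ : ℝ, 0 < δ ∧ ∀ t ∈ Set.Icc (0 : ℝ) 1, ∀ x,
      ‖alphaDeriv (imPart Ω) v (a + (t : ℂ) • u) u x *
        gauss (twist Ω (a + (t : ℂ) • u)) x‖ ≤ C * Real.exp (-δ * (x ⬝ᵥ x)) := by
  have hcont : Continuous fun t : ℝ => a + (t : ℂ) • u := by fun_prop
  have hK := isCompact_Icc (a := (0 : ℝ)) (b := 1) |>.image hcont
  have hKR : (fun t : ℝ => a + (t : ℂ) • u) '' Set.Icc (0 : ℝ) 1 ⊆ negRegion (imPart Ω) := by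
    rintro _ ⟨t, ht, rfl⟩
    exact hseg t ht
  obtain ⟨δ, hδ, hg⟩ := exists_norm_gauss_twist_le hΩ hM hv hK hKR
  obtain ⟨R, hR, ha⟩ := exists_le_mul_of_homogeneous hK
    (φ := fun c x => ‖alphaDeriv (imPart Ω) v c u x‖ ^ 2)
    (((continuousOn_alphaDeriv hM hv u).mono (Set.prod_mono_left hKR)).norm.pow 2)
    (fun c _ r x => by
      have : realVec (r • x) = (r : ℂ) • realVec x := by ext i; simp [realVec]
      rw [alphaDeriv_eq hM.1, alphaDeriv_eq hM.1, this, dotProduct_smul, smul_eq_mul, mul_div_assoc,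
        norm_mul, mul_pow, Complex.norm_real, Real.norm_eq_abs, sq_abs])
  refine ⟨(1 + 2 * R / δ) * 1, δ / 2, half_pos hδ, fun t ht x => ?_⟩
  have htK : a + (t : ℂ) • u ∈ (fun t : ℝ => a + (t : ℂ) • u) '' Set.Icc (0 : ℝ) 1 := ⟨t, ht, rfl⟩
  rw [norm_mul]
  exact mul_decay hδ hR zero_le_one (dotProduct_self_nonneg' x) (ha _ htK x) (norm_nonneg _)
    (hg _ htK x)

lemma integrable_alphaDeriv_mul_gauss_mul_e (hΩ : Ω.IsSymm) (hM : Lorentzian (imPart Ω))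
    (hv : v ∈ negReal (imPart Ω)) {a u : Fin g → ℂ}
    (hseg : ∀ t ∈ Set.Icc (0 : ℝ) 1, a + (t : ℂ) • u ∈ negRegion (imPart Ω)) (ξ : Fin g → ℝ) :
    Integrable (fun p : ℝ × (Fin g → ℝ) => alphaDeriv (imPart Ω) v (a + (p.1 : ℂ) • u) u p.2 *
      gauss (twist Ω (a + (p.1 : ℂ) • u)) p.2 * e (realVec ξ ⬝ᵥ realVec p.2))
      ((volume.restrict (Set.Ioc 0 1)).prod volume) := by
  obtain ⟨C, δ, hδ, hb⟩ := exists_norm_alphaDeriv_mul_gauss_le hΩ hM hv hseg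
  have hint : Integrable (fun p : ℝ × (Fin g → ℝ) => C * Real.exp (-δ * (p.2 ⬝ᵥ p.2)))
      ((volume.restrict (Set.Ioc 0 1)).prod volume) :=
    ((integrable_exp_neg_dotProduct hδ).const_mul C).comp_snd _
  have hmeas : (volume.restrict (Set.Ioc (0 : ℝ) 1)).prod (volume : Measure (Fin g → ℝ)) =
      (volume.prod volume).restrict (Set.Ioc 0 1 ×ˢ Set.univ) := by
    rw [← Measure.prod_restrict, Measure.restrict_univ]
  refine hint.mono' ?_ ?_
  · rw [hmeas]
    refine ContinuousOn.aestronglyMeasurable ?_ (measurableSet_Ioc.prod MeasurableSet.univ)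
    exact ((continuousOn_alphaDeriv_mul_gauss hΩ hM hv hseg).mono
      (Set.prod_mono_left Set.Ioc_subset_Icc_self)).mul
      ((continuous_e_dot ξ).comp continuous_snd).continuousOn
  · rw [hmeas]
    refine (ae_restrict_iff' (measurableSet_Ioc.prod MeasurableSet.univ)).2
      (Filter.Eventually.of_forall fun p hp => ?_)
    rw [norm_mul, norm_e_real (im_realVec_dot _ _), mul_one]
    exact hb p.1 (Set.Ioc_subset_Icc_self hp.1) p.2

/-- The Fourier transform of `kern` for two parameters on a segment. -/
lemma integral_kern_segment (hΩ : Ω.IsSymm) (hu : IsUnit Ω.det)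
    (hM : Lorentzian (imPart Ω)) (hv : v ∈ negReal (imPart Ω))
    (hw : w ∈ negReal (imPart (-Ω⁻¹))) {a u : Fin g → ℂ}
    (hseg : ∀ t ∈ Set.Icc (0 : ℝ) 1, a + (t : ℂ) • u ∈ negRegion (imPart (-Ω⁻¹)))
    (ξ : Fin g → ℝ) :
    ∫ x, kern w (fun _ => 1) a (a + u) (-Ω⁻¹) x * e (realVec ξ ⬝ᵥ realVec x) =
      -invSqrtDet w v Ω (realVec w) * kern v (fun _ => 1) (conjMat (-Ω⁻¹) *ᵥ a)
        (conjMat (-Ω⁻¹) *ᵥ (a + u)) Ω ξ := by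
  have hM' := Lorentzian.neg_inv hΩ hu hM hv
  have hW := isSymm_neg_inv hΩ
  have hline : ∀ t : ℝ, conjMat (-Ω⁻¹) *ᵥ (a + (t : ℂ) • u) =
      conjMat (-Ω⁻¹) *ᵥ a + (t : ℂ) • (conjMat (-Ω⁻¹) *ᵥ u) := fun t => by
    rw [mulVec_add, mulVec_smul]
  rw [mulVec_add, kern_eq_integral hΩ hM hv (a := conjMat (-Ω⁻¹) *ᵥ a)
    (u := conjMat (-Ω⁻¹) *ᵥ u) fun t ht => by
      rw [← hline]; exact conj_mem_negRegion hΩ hu (hseg t ht)]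
  simp only [kern_eq_integral hW hM' hw hseg, intervalIntegral.integral_of_le zero_le_one,
    ← integral_mul_const]
  rw [← integral_integral_swap (integrable_alphaDeriv_mul_gauss_mul_e hW hM' hw hseg ξ),
    ← integral_const_mul]
  refine setIntegral_congr_fun measurableSet_Ioc fun t ht => ?_
  have hc := hseg t (Set.Ioc_subset_Icc_self ht)
  rw [integral_alphaDeriv_mul_gauss_mul_e hΩ hu hM hv hw hc, invSqrtDet_eq hΩ hu hM hv hw hc, hline]

lemma continuous_kern {f : ℂ → ℂ} (hf : Differentiable ℂ f) (v : Fin g → ℝ) (c₁ c₂ : Fin g → ℂ)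
    (Ω : Matrix (Fin g) (Fin g) ℂ) : Continuous (kern v f c₁ c₂ Ω) := by
  have hi : Continuous (incGauss f) :=
    continuous_iff_continuousAt.2 fun α => (hasDerivAt_incGauss hf α).continuousAt
  have ha : ∀ c, Continuous (alpha (imPart Ω) v c) := fun c => by
    unfold alpha
    exact ((continuous_bil _).comp (continuous_const.prodMk continuous_realVec)).div_const _
  unfold kern
  exact ((hi.comp (ha c₂)).sub (hi.comp (ha c₁))).mul (continuous_gauss Ω)

lemma isTestFunction_one (c₁ c₂ : Fin g → ℂ) : IsTestFunction (fun _ => 1) c₁ c₂ := by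
  refine Or.inl ⟨differentiable_const _, fun ε hε => Filter.Eventually.of_forall fun ξ => ?_⟩
  rw [norm_one]
  exact Real.one_le_exp (by positivity)

lemma integrable_kern_mul_e (hM : Lorentzian (imPart Ω)) (hv : v ∈ negReal (imPart Ω))
    {c₁ c₂ : Fin g → ℂ} (hc₁ : c₁ ∈ negRegion (imPart Ω)) (hc₂ : c₂ ∈ negRegion (imPart Ω))
    (ξ : Fin g → ℝ) :
    Integrable fun x => kern v (fun _ => 1) c₁ c₂ Ω x * e (realVec ξ ⬝ᵥ realVec x) := by
  obtain ⟨C, δ, hδ, h⟩ := exists_norm_kern_le hM hv hc₁ hc₂ (isTestFunction_one c₁ c₂)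
  refine integrable_of_decay
    ((continuous_kern (differentiable_const _) v c₁ c₂ Ω).mul (continuous_e_dot ξ)) hδ
    (C := C) fun x => ?_
  rw [norm_mul, norm_e_real (im_realVec_dot _ _), mul_one]
  exact h x

/-- The functional equation of `kern` under the Fourier transform. -/
theorem integral_kern_mul_e (hΩ : Ω.IsSymm) (hu : IsUnit Ω.det)
    (hM : Lorentzian (imPart Ω)) (hv : v ∈ negReal (imPart Ω))
    (hw : w ∈ negReal (imPart (-Ω⁻¹))) {c₁ c₂ : Fin g → ℂ}
    (hc₁ : c₁ ∈ negRegion (imPart (-Ω⁻¹))) (hc₂ : c₂ ∈ negRegion (imPart (-Ω⁻¹)))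
    (ξ : Fin g → ℝ) :
    ∫ x, kern w (fun _ => 1) c₁ c₂ (-Ω⁻¹) x * e (realVec ξ ⬝ᵥ realVec x) =
      -invSqrtDet w v Ω (realVec w) * kern v (fun _ => 1) (conjMat (-Ω⁻¹) *ᵥ c₁)
        (conjMat (-Ω⁻¹) *ᵥ c₂) Ω ξ := by
  have hM' := Lorentzian.neg_inv hΩ hu hM hv
  have hw' := Lorentzian.realVec_mem_negRegion hw
  -- a parameter enters only up to scaling, so it may be joined to `w` by a segment
  have key : ∀ c ∈ negRegion (imPart (-Ω⁻¹)),
      ∫ x, kern w (fun _ => 1) (realVec w) c (-Ω⁻¹) x * e (realVec ξ ⬝ᵥ realVec x) =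
        -invSqrtDet w v Ω (realVec w) * kern v (fun _ => 1) (conjMat (-Ω⁻¹) *ᵥ realVec w)
          (conjMat (-Ω⁻¹) *ᵥ c) Ω ξ := by
    intro c hc
    obtain ⟨k, u, hk, hwu, rfl⟩ := hM'.exists_smul_add hw hc
    rw [Lorentzian.smul_mem_negRegion_iff hk] at hc
    have h := integral_kern_segment hΩ hu hM hv hw
      (fun t ht => hM'.segment_mem hw hwu hc ht) ξ
    rw [mulVec_smul]
    unfold kern at h ⊢
    rw [alpha_smul hk, alpha_smul hk]
    exact h
  have hcocycle : ∀ (v : Fin g → ℝ) (Ω : Matrix (Fin g) (Fin g) ℂ) (c₀ c₁ c₂ : Fin g → ℂ) x,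
      kern v (fun _ => 1) c₁ c₂ Ω x =
        kern v (fun _ => 1) c₀ c₂ Ω x - kern v (fun _ => 1) c₀ c₁ Ω x := fun v Ω c₀ c₁ c₂ x => by
    unfold kern; ring
  rw [hcocycle v Ω (conjMat (-Ω⁻¹) *ᵥ realVec w), mul_sub, ← key c₁ hc₁, ← key c₂ hc₂,
    ← integral_sub (integrable_kern_mul_e hM' hw hw' hc₂ ξ)
      (integrable_kern_mul_e hM' hw hw' hc₁ ξ)]
  refine integral_congr_ae (Filter.Eventually.of_forall fun x => ?_)
  simp only
  rw [hcocycle w (-Ω⁻¹) (realVec w), sub_mul]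

end

/-! ### Inversion -/

section

variable {g : ℕ} {Ω : Matrix (Fin g) (Fin g) ℂ} {v w : Fin g → ℝ}

/-- The inversion formula: Poisson summation for the translates and modulates of `kern`. -/
theorem theta_neg_inv (hΩ : Ω.IsSymm) (hu : IsUnit Ω.det)
    (hM : Lorentzian (imPart Ω)) (hv : v ∈ negReal (imPart Ω))
    (hw : w ∈ negReal (imPart (-Ω⁻¹))) {c₁ c₂ : Fin g → ℂ}
    (hc₁ : c₁ ∈ negRegion (imPart (-Ω⁻¹))) (hc₂ : c₂ ∈ negRegion (imPart (-Ω⁻¹)))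
    (z : Fin g → ℂ) :
    theta w (fun _ => 1) c₁ c₂ z (-Ω⁻¹) =
      -(e (1 / 2 * (z ⬝ᵥ (Ω *ᵥ z))) * invSqrtDet w v Ω (realVec w)) *
        theta v (fun _ => 1) (conjMat (-Ω⁻¹) *ᵥ c₁) (conjMat (-Ω⁻¹) *ᵥ c₂) (Ω *ᵥ z) Ω := by
  have hM' := Lorentzian.neg_inv hΩ hu hM hv
  have hW := isSymm_neg_inv hΩ
  obtain ⟨ζ, b, hz⟩ := hM'.exists_realVec_add hw z
  have hΩW : ∀ y : Fin g → ℂ, Ω *ᵥ (-Ω⁻¹ *ᵥ y) = -y := fun y => by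
    rw [mulVec_mulVec, Matrix.mul_neg, mul_nonsing_inv _ hu, neg_mulVec, one_mulVec]
  -- passing to `Ωz` exchanges the roles of translation and modulation
  have hΩz : Ω *ᵥ z = realVec (-b) + Ω *ᵥ realVec ζ := by
    rw [hz, mulVec_add, hΩW, add_comm]
    congr 1
    ext i; simp [realVec]
  have hzz : z ⬝ᵥ (Ω *ᵥ z) = realVec ζ ⬝ᵥ (Ω *ᵥ realVec ζ) - 2 * (realVec b ⬝ᵥ realVec ζ) -
      realVec b ⬝ᵥ (-Ω⁻¹ *ᵥ realVec b) := by
    rw [hz, realVec_dot_add Ω hΩ, hΩW, dotProduct_neg, dotProduct_neg,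
      dotProduct_comm (realVec ζ) (realVec b), dotProduct_comm (-Ω⁻¹ *ᵥ realVec b)]
    ring
  set F : (Fin g → ℝ) → ℂ := fun x =>
    e (realVec ζ ⬝ᵥ realVec x) * kern w (fun _ => 1) c₁ c₂ (-Ω⁻¹) (x + b) with hF
  have hFhat : ∀ m : Fin g → ℤ, ∫ x, F x * e (intVec m ⬝ᵥ realVec x) =
      e (-(realVec b ⬝ᵥ (realVec ζ + intVec m))) * (-invSqrtDet w v Ω (realVec w) *
        kern v (fun _ => 1) (conjMat (-Ω⁻¹) *ᵥ c₁) (conjMat (-Ω⁻¹) *ᵥ c₂) Ω (intReal m + ζ)) := by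
    intro m
    rw [← integral_kern_mul_e hΩ hu hM hv hw hc₁ hc₂, ← integral_const_mul,
      ← integral_add_right_eq_self (fun x => e (-(realVec b ⬝ᵥ (realVec ζ + intVec m))) *
        (kern w (fun _ => 1) c₁ c₂ (-Ω⁻¹) x * e (realVec (intReal m + ζ) ⬝ᵥ realVec x))) b]
    refine integral_congr_ae (Filter.Eventually.of_forall fun x => ?_)
    simp only [hF, realVec_add, realVec_intReal]
    have h1 : e (-(realVec b ⬝ᵥ (realVec ζ + intVec m))) *
        e ((intVec m + realVec ζ) ⬝ᵥ (realVec x + realVec b)) =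
        e (realVec ζ ⬝ᵥ realVec x) * e (intVec m ⬝ᵥ realVec x) := by
      rw [← e_add, ← e_add]
      congr 1
      simp only [add_dotProduct, dotProduct_add, dotProduct_comm (realVec b)]
      ring
    linear_combination (-kern w (fun _ => 1) c₁ c₂ (-Ω⁻¹) (x + b)) * h1
  obtain ⟨C, δ, hδ, hb⟩ := exists_norm_kern_le hM' hw hc₁ hc₂ (isTestFunction_one c₁ c₂)
  have hbF : ∃ C', ∀ x, ‖F x‖ ≤ C' * Real.exp (-(δ / 2) * (x ⬝ᵥ x)) := by
    refine ⟨C * Real.exp (δ * (b ⬝ᵥ b)), fun x => ?_⟩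
    have hC : 0 ≤ C := by simpa using (norm_nonneg _).trans (hb 0)
    rw [hF]
    simp only
    rw [norm_mul, norm_e_real (im_realVec_dot _ _), one_mul, mul_assoc, ← Real.exp_add]
    refine (hb _).trans (mul_le_mul_of_nonneg_left (Real.exp_le_exp.2 ?_) hC)
    nlinarith [dotProduct_add_self_ge x b]
  obtain ⟨C', hbF⟩ := hbF
  have hFc : Continuous F := (continuous_e_dot ζ).mul
    ((continuous_kern (differentiable_const _) w c₁ c₂ (-Ω⁻¹)).comp (by fun_prop))
  have hterm : ∀ m : Fin g → ℤ,
      e (-(1 / 2 * (realVec b ⬝ᵥ (-Ω⁻¹ *ᵥ realVec b)))) * ∫ x, F x * e (intVec m ⬝ᵥ realVec x) =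
      -(e (1 / 2 * (z ⬝ᵥ (Ω *ᵥ z))) * invSqrtDet w v Ω (realVec w)) *
        thetaTerm v (fun _ => 1) (conjMat (-Ω⁻¹) *ᵥ c₁) (conjMat (-Ω⁻¹) *ᵥ c₂) (Ω *ᵥ z) Ω m := by
    intro m
    rw [hFhat, hzz, hΩz, thetaTerm_eq_kern hΩ]
    have h1 : e (-(1 / 2 * (realVec b ⬝ᵥ (-Ω⁻¹ *ᵥ realVec b)))) *
        e (-(realVec b ⬝ᵥ (realVec ζ + intVec m))) =
        e (1 / 2 * (realVec ζ ⬝ᵥ (Ω *ᵥ realVec ζ) - 2 * (realVec b ⬝ᵥ realVec ζ) -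
          realVec b ⬝ᵥ (-Ω⁻¹ *ᵥ realVec b))) *
        (e (-(1 / 2 * (realVec ζ ⬝ᵥ (Ω *ᵥ realVec ζ)))) * e (intVec m ⬝ᵥ realVec (-b))) := by
      rw [← e_add, ← e_add, ← e_add]
      congr 1
      have : realVec (-b) = -realVec b := by ext i; simp [realVec]
      rw [this, dotProduct_neg, dotProduct_add, dotProduct_comm (intVec m)]
      ring
    linear_combination (-invSqrtDet w v Ω (realVec w) *
      kern v (fun _ => 1) (conjMat (-Ω⁻¹) *ᵥ c₁) (conjMat (-Ω⁻¹) *ᵥ c₂) Ω (intReal m + ζ)) * h1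
  have hsum := summable_thetaTerm hΩ hM hv (conj_mem_negRegion hΩ hu hc₁)
    (conj_mem_negRegion hΩ hu hc₂) (isTestFunction_one _ _) (Ω *ᵥ z)
  have hFsum : Summable fun m : Fin g → ℤ => ∫ x, F x * e (intVec m ⬝ᵥ realVec x) := by
    have he : e (-(1 / 2 * (realVec b ⬝ᵥ (-Ω⁻¹ *ᵥ realVec b)))) ≠ 0 := Complex.exp_ne_zero _
    rw [← summable_mul_left_iff he]
    simp only [hterm]
    exact hsum.mul_left _
  have hpoisson := tsum_eq_tsum_fourier hFc (half_pos hδ) hbF hFsum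
  unfold theta
  rw [← tsum_mul_left]
  simp only [← hterm]
  rw [tsum_mul_left, ← hpoisson, ← tsum_mul_left]
  refine tsum_congr fun n => ?_
  rw [hz, thetaTerm_eq_kern hW, hF]
  simp only
  rw [realVec_intReal, dotProduct_comm (realVec ζ), mul_assoc]

end

end IndefTheta

theorem theorem3 (g : ℕ) (Ω : Matrix (Fin g) (Fin g) ℂ) (hΩ : Ω ∈ siegelIntermediate g 1)
    (z : Fin g → ℂ) :
    -- the action of `GL_g(ℤ)`
    (∀ (A : GL (Fin g) ℤ) (v : Fin g → ℝ) (c₁ c₂ : Fin g → ℂ) (f : ℂ → ℂ),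
      v ∈ negReal (imPart ((intMat A.val)ᵀ * Ω * intMat A.val)) →
      c₁ ∈ negRegion (imPart ((intMat A.val)ᵀ * Ω * intMat A.val)) →
      c₂ ∈ negRegion (imPart ((intMat A.val)ᵀ * Ω * intMat A.val)) →
      IsTestFunction f c₁ c₂ →
      Summable (thetaTerm v f c₁ c₂ z ((intMat A.val)ᵀ * Ω * intMat A.val)) ∧
      Summable (thetaTerm (A.val.map (fun a : ℤ => (a : ℝ)) *ᵥ v) f
        (intMat A.val *ᵥ c₁) (intMat A.val *ᵥ c₂) ((intMat (A⁻¹).val)ᵀ *ᵥ z) Ω) ∧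
      theta v f c₁ c₂ z ((intMat A.val)ᵀ * Ω * intMat A.val) =
        theta (A.val.map (fun a : ℤ => (a : ℝ)) *ᵥ v) f
          (intMat A.val *ᵥ c₁) (intMat A.val *ᵥ c₂) ((intMat (A⁻¹).val)ᵀ *ᵥ z) Ω) ∧
    -- translations
    (∀ (B : Matrix (Fin g) (Fin g) ℤ) (v : Fin g → ℝ) (c₁ c₂ : Fin g → ℂ) (f : ℂ → ℂ),
      B.IsSymm → v ∈ negReal (imPart Ω) →
      c₁ ∈ negRegion (imPart Ω) → c₂ ∈ negRegion (imPart Ω) → IsTestFunction f c₁ c₂ →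
      Summable (thetaTerm v f c₁ c₂ z (Ω + (2 : ℂ) • intMat B)) ∧
      Summable (thetaTerm v f c₁ c₂ z Ω) ∧
      theta v f c₁ c₂ z (Ω + (2 : ℂ) • intMat B) = theta v f c₁ c₂ z Ω) ∧
    -- inversion; `v` and `w` fix the branches belonging to `Im Ω` and to `Im(-Ω⁻¹)`, and `c` is
    -- the auxiliary vector in the definition of the square root of `det(iΩ⁻¹)`
    (IsUnit Ω.det → ∀ (v w : Fin g → ℝ) (c c₁ c₂ : Fin g → ℂ),
      v ∈ negReal (imPart Ω) → w ∈ negReal (imPart (-Ω⁻¹)) →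
      c ∈ negRegion (imPart (-Ω⁻¹)) →
      c₁ ∈ negRegion (imPart (-Ω⁻¹)) → c₂ ∈ negRegion (imPart (-Ω⁻¹)) →
      Summable (thetaTerm w (fun _ => 1) c₁ c₂ z (-Ω⁻¹)) ∧
      Summable (thetaTerm v (fun _ => 1) (-(conjMat Ω)⁻¹ *ᵥ c₁) (-(conjMat Ω)⁻¹ *ᵥ c₂)
        (Ω *ᵥ z) Ω) ∧
      theta w (fun _ => 1) c₁ c₂ z (-Ω⁻¹) =
        -(Complex.exp (Real.pi * Complex.I * (z ⬝ᵥ (Ω *ᵥ z))) / sqrtDet w v (-Ω⁻¹) c) *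
          theta v (fun _ => 1) (-(conjMat Ω)⁻¹ *ᵥ c₁) (-(conjMat Ω)⁻¹ *ᵥ c₂) (Ω *ᵥ z) Ω) := by
  have hs : Ω.IsSymm := hΩ.1
  have hM : Lorentzian (imPart Ω) := lorentzian_of_sigPos (imPart_isSymm hs) hΩ.2.1
  refine ⟨fun A v c₁ c₂ f hv hc₁ hc₂ hf => theta_congruence hs hM A hv hc₁ hc₂ hf z,
    fun B v c₁ c₂ f _ hv hc₁ hc₂ hf => ?_, fun hu v w c c₁ c₂ hv hw hc hc₁ hc₂ => ?_⟩
  · have hsum := summable_thetaTerm hs hM hv hc₁ hc₂ hf z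
    have hterm := funext fun n => thetaTerm_add_intMat Ω B v f c₁ c₂ z n
    refine ⟨by rw [hterm]; exact hsum, hsum, ?_⟩
    unfold theta
    rw [hterm]
  · have hM' := Lorentzian.neg_inv hs hu hM hv
    rw [← conjMat_neg_inv hu]
    refine ⟨summable_thetaTerm (isSymm_neg_inv hs) hM' hw hc₁ hc₂ (isTestFunction_one _ _) z,
      summable_thetaTerm hs hM hv (conj_mem_negRegion hs hu hc₁) (conj_mem_negRegion hs hu hc₂)
        (isTestFunction_one _ _) _, ?_⟩
    have he : Complex.exp (Real.pi * Complex.I * (z ⬝ᵥ (Ω *ᵥ z))) =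
        e (1 / 2 * (z ⬝ᵥ (Ω *ᵥ z))) := by
      unfold e
      congr 1
      ring
    rw [theta_neg_inv hs hu hM hv hw hc₁ hc₂, ← invSqrtDet_eq hs hu hM hv hw hc,
      ← inv_sqrtDet hu, ← div_eq_mul_inv, he]
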